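/- **Setting.** Let $H$, $U$ be complex Hilbert spaces and let $A$ be the infinitesimal generator of a strongly continuous semigroup $(e^{tA})_{t\ge 0}$ on $H$. Let $\mathcal D(A^*)'$ be the (anti)dual of $\mathcal D(A^*)$ (with the graph norm) with respect to the pivot space $H$, let $B\in\mathcal L(U,\mathcal D(A^*)')$, and let $B^*:\mathcal D(A^*)\to U$ be its adjoint, $(u\,|\,B^*\varepsilon)_U=\langle Bu,\varepsilon\rangle$. Let $\mu_0>\Re\lambda$ for all $\lambda$ in the spectrum of $A$, and for $\gamma\ge 0$ let $H_{-\gamma}=\mathcal D((\mu_0-A^*)^{\gamma})'$ (dual with respect to the pivot space $H$), where for $\gamma>0$ the fractional power $(\mu_0-A^*)^{\gamma}$ is the inverse of $(\mu_0-A^*)^{-\gamma}=\frac1{\Gamma(\gamma)}\int_0^\infty t^{\gamma-1}e^{-\mu_0t}(e^{tA})^*\,dt$. Assume: * $(\mathcal H_1)$ the spectrum of $A$ consists of isolated eigenvalues $\lambda_j$ of finite algebraic multiplicity, i.e. the projection $\frac1{2\pi i}\int_{|\lambda-\lambda_j|=\delta}(\lambda-A)^{-1}d\lambda$ has finite rank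 for some $\delta>0$ such that every spectral value other than $\lambda_j$ is at distance $>\delta$ from $\lambda_j$; * $(\mathcal H_3)$ the semigroup $(e^{tA})$ is analytic; * $(\mathcal H_5)$ there is $\gamma\in[0,1)$ such that $B\in\mathcal L(U,H_{-\gamma})$; * $(\mathcal H_6)$ the spectrum of $A$ has no finite cluster point. **Definitions.** Let $\sigma\in\mathbb R$. A solution of $y'=(A+\sigma)y+Bu$ is a function $y\in C([0,\infty);H)$ satisfying the equation in $\mathcal D(A^*)'$, i.e. $\frac{d}{dt}(y(t)|\varepsilon)=(y(t)|A^*\varepsilon)+\sigma(y(t)|\varepsilon)+\langle Bu(t),\varepsilon\rangle$ for all $t\ge0$ and $\varepsilon\in\mathcal D(A^*)$. The pair $(A+\sigma,B)$ is *stabilizable* if there are $F\in\mathcal L(H,U)$ and $C,\epsilon>0$ such that the system $y'=(A+\sigma)y+BFy$ has a solution for every initial value $y(0)\in H$ and all its solutions satisfy $\|y(t)\|_H\le Ce^{-\epsilon t}\|y(0)\|_H$ for all $t\ge0$. It is *stabilizable by controls in* a subspace $V\subset U$ if $(A+\sigma,B|_V)$ is stabilizable, with feedback in $\mathcal L(H,V)$.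 A family $v=(v_1,\dots,v_K)\in U^K$ is *admissible for stabilizability of $(A+\sigma,B)$* if $(A+\sigma,B)$ is stabilizable by controls in $\mathrm{span}\{v_1,\dots,v_K\}$. A *residual* set is an intersection of countably many open dense sets. For an eigenvalue $\lambda_j$ of $A$ let $\ell_j=\dim\ker(\lambda_j-A)$, let $\varepsilon_k(\overline\lambda_j)$, $k=1,\dots,\ell_j$, be a basis of $\ker(\overline\lambda_j-A^*)$, and let $W_j(v)$ be the $K\times\ell_j$ matrix $\big((v_l\,|\,B^*\varepsilon_k(\overline\lambda_j))_U\big)_{l,k}$. Let $\mathcal E_\sigma=\bigoplus_{\Re\lambda_j\ge-\sigma}\ker(\overline\lambda_j-A^*)$. Consider the conditions $$\forall\varepsilon\in\mathcal D(A^*),\ \forall\lambda\in\mathbb C,\ \Re\lambda\ge-\sigma:\quad A^*\varepsilon=\lambda\varepsilon\ \text{ and }\ B^*\varepsilon=0\ \Longrightarrow\ \varepsilon=0,\tag{$\mathrm{UC}_\sigma$}$$ $$\ell_j\le K\quad\text{for all } j \text{ with } \Re\lambda_j\ge-\sigma.\tag{M}$$ **Theorem.** Let $K\ge1$ be an integer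 and $\sigma>0$. For every $\lambda_j$ with $\Re\lambda_j\ge-\sigma$ the space $\ker(\overline\lambda_j-A^*)$ has dimension $\ell_j$ (so that the bases above exist), and: 1. $(A+\sigma,B)$ is stabilizable if and only if $(\mathrm{UC}_\sigma)$ holds. 2. $(A+\sigma,B)$ is stabilizable by controls in some subspace of $U$ of dimension at most $K$ if and only if $(\mathrm{UC}_\sigma)$ and (M) hold. If $\dim U\ge K$, the same equivalence holds with subspaces of dimension exactly $K$. 3. A family $v\in U^K$ is admissible for stabilizability of $(A+\sigma,B)$ if and only if $\operatorname{rank}W_j(v)=\ell_j$ for all $j$ with $\Re\lambda_j\ge-\sigma$ (and every choice of the bases). 4. Assume $(\mathrm{UC}_\sigma)$ and (M). Then the set of families $v\in U^K$ that are admissible for stabilizability of $(A+\sigma,B)$ is residual in $U^K$; if $\dim U\ge K$, so is the set of linearly independent admissible families. Moreover, if $v\in U^K$ is admissible for stabilizability of $(A+\sigma,B)$, then its orthogonal projection onto $(B^*\mathcal E_\sigma)^K$ exists and is admissible for stabilizability of $(A+\sigma,B)$. -/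

import Mathlib

open Set Filter Topology

noncomputable section

namespace FattoriniStab

/-! Inner products: `inner ℂ x y` is linear in `y`, so `inner ℂ x y` is `(y | x)` in the convention
where the inner product is linear in its first slot. -/

section Operators

variable {H : Type*} [NormedAddCommGroup H] [InnerProductSpace ℂ H]

/-! ### Semigroups and generators -/

/-- Strongly continuous semigroups of bounded operators (only the times `t ≥ 0` matter). -/
structure IsC0Semigroup (S : ℝ → H →L[ℂ] H) : Prop where
  zero : S 0 = 1
  add : ∀ s t : ℝ, 0 ≤ s → 0 ≤ t → S (s + t) = S s * S t
  continuousOn : ∀ x : H, ContinuousOn (fun t => S t x) (Ici 0)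

/-- `A` is the infinitesimal generator of `S`: `x ∈ D(A)` and `A x = y` if and only if
`(S t x - x) / t → y` as `t → 0+`. -/
def IsGenerator (A : H →ₗ.[ℂ] H) (S : ℝ → H →L[ℂ] H) : Prop :=
  ∀ x y : H, (x, y) ∈ A.graph ↔
    Tendsto (fun t : ℝ => ((t⁻¹ : ℝ) : ℂ) • (S t x - x)) (𝓝[>] 0) (𝓝 y)

/-- The open sector `{z ≠ 0 : |arg z| < θ}`. -/
def sector (θ : ℝ) : Set ℂ := {z | z ≠ 0 ∧ |z.arg| < θ}

/-- Analyticity of a semigroup: it extends to a holomorphic family with the semigroup property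
on a sector around the positive half-line, strongly continuous at `0` inside the sector. -/
def IsAnalyticSemigroup (S : ℝ → H →L[ℂ] H) : Prop :=
  ∃ θ : ℝ, 0 < θ ∧ θ ≤ Real.pi / 2 ∧ ∃ T : ℂ → H →L[ℂ] H,
    (∀ t : ℝ, 0 ≤ t → T (t : ℂ) = S t) ∧
    DifferentiableOn ℂ T (sector θ) ∧
    (∀ z ∈ sector θ, ∀ w ∈ sector θ, T (z + w) = T z * T w) ∧
    ∀ x : H, Tendsto (fun z => T z x) (𝓝[sector θ] 0) (𝓝 x)

/-! ### Spectrum, eigenspaces, Riesz projections -/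

/-- `R = (z - A)⁻¹` is a bounded everywhere defined inverse of `z - A : D(A) → H`. -/
def IsResolventAt (A : H →ₗ.[ℂ] H) (z : ℂ) (R : H →L[ℂ] H) : Prop :=
  ∀ x f : H, R f = x ↔ ∃ hx : x ∈ A.domain, z • x - A ⟨x, hx⟩ = f

/-- The spectrum of an unbounded operator. -/
def spec (A : H →ₗ.[ℂ] H) : Set ℂ := {z | ¬ ∃ R : H →L[ℂ] H, IsResolventAt A z R}

open Classical in
/-- The resolvent `(z - A)⁻¹` (and `0` if `z` is in the spectrum). -/
def resolventOp (A : H →ₗ.[ℂ] H) (z : ℂ) : H →L[ℂ] H :=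
  if h : ∃ R : H →L[ℂ] H, IsResolventAt A z R then h.choose else 0

/-- `(2 π i)⁻¹ ∮_{|z - c| = δ} (z - A)⁻¹ dz`. -/
def rieszProj (A : H →ₗ.[ℂ] H) (c : ℂ) (δ : ℝ) : H →L[ℂ] H :=
  (2 * (Real.pi : ℂ) * Complex.I)⁻¹ • ∮ z in C(c, δ), resolventOp A z

/-- The domain `D(T)` with the graph norm, realised as the graph `{(x, T x) : x ∈ D(T)}`
in `H × H`: the first component of an element is `x`, the second one is `T x`. -/
abbrev GraphDom (T : H →ₗ.[ℂ] H) : Type _ := T.graph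

/-- `Ker (c - T)`, as a subspace of `D(T)`. -/
def eigenspace (T : H →ₗ.[ℂ] H) (c : ℂ) : Submodule ℂ (GraphDom T) :=
  LinearMap.ker ((LinearMap.snd ℂ H H - c • LinearMap.fst ℂ H H).comp T.graph.subtype)

/-- The geometric multiplicity `dim Ker (c - T)`. -/
def geomMult (T : H →ₗ.[ℂ] H) (c : ℂ) : ℕ := Module.finrank ℂ (eigenspace T c)

/-- (H1): the spectrum consists of isolated eigenvalues of finite algebraic multiplicity, the
algebraic multiplicity being the rank of the Riesz projection along a circle that encloses no
other point of the spectrum. -/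
def HypH1 (A : H →ₗ.[ℂ] H) : Prop :=
  ∀ l ∈ spec A, eigenspace A l ≠ ⊥ ∧
    ∃ δ : ℝ, 0 < δ ∧ (∀ z ∈ spec A, z ≠ l → δ < dist z l) ∧
      FiniteDimensional ℂ (rieszProj A l δ).range

/-- (H6): the spectrum has no finite cluster point. -/
def HypH6 (A : H →ₗ.[ℂ] H) : Prop := ∀ z : ℂ, ¬ AccPt z (𝓟 (spec A))

/-- The eigenvalues `l` of `A` with `Re l ≥ -σ`. -/
def unstableSpec (A : H →ₗ.[ℂ] H) (σ : ℝ) : Set ℂ := {l | l ∈ spec A ∧ -σ ≤ l.re}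

/-! ### Fractional powers -/

/-- `(μ - G)^(-γ) = Γ(γ)⁻¹ ∫_0^∞ t^(γ-1) e^(-μ t) S(t) dt` for the generator `G` of `S` (`γ > 0`),
and the identity if `γ = 0`. -/
def negPow (S : ℝ → H →L[ℂ] H) (μ γ : ℝ) : H →L[ℂ] H :=
  if γ = 0 then 1
  else (((Real.Gamma γ)⁻¹ : ℝ) : ℂ) •
    ∫ t in Ioi (0 : ℝ), ((t ^ (γ - 1) * Real.exp (-μ * t) : ℝ) : ℂ) • S t

/-- `(μ - G)^γ`, the inverse of `(μ - G)^(-γ)`, with domain the range of `(μ - G)^(-γ)`. -/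
def fracPow (S : ℝ → H →L[ℂ] H) (μ γ : ℝ) : H →ₗ.[ℂ] H :=
  ((negPow S μ γ : H →ₗ[ℂ] H).toPMap ⊤).inverse

variable [CompleteSpace H]

/-- The adjoint semigroup `S(t)*`, which is generated by `A*` if `S` is generated by `A`. -/
def adjSemigroup (S : ℝ → H →L[ℂ] H) (t : ℝ) : H →L[ℂ] H := ContinuousLinearMap.adjoint (S t)

/-- `D((μ - A*)^γ)` with its graph norm, where `S` is the semigroup generated by `A`. -/
abbrev HStar (S : ℝ → H →L[ℂ] H) (μ γ : ℝ) : Type _ := GraphDom (fracPow (adjSemigroup S) μ γ)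

/-- `H_{-γ} = D((μ - A*)^γ)'`, the dual with respect to the pivot space `H`: bounded antilinear
functionals. An element `h` of `H` is identified with the functional `x ↦ (h | x)`. -/
abbrev HNeg (S : ℝ → H →L[ℂ] H) (μ γ : ℝ) : Type _ := HStar S μ γ →L⋆[ℂ] ℂ

/-- `D(A*)` with the graph norm; its elements are the pairs `(x, A* x)`. -/
abbrev DStar (A : H →ₗ.[ℂ] H) : Type _ := GraphDom A.adjoint

/-- `D(A*)'`, the dual with respect to the pivot space `H`: bounded antilinear functionals. -/
abbrev DStarDual (A : H →ₗ.[ℂ] H) : Type _ := DStar A →L⋆[ℂ] ℂ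

end Operators

section Control

variable {H : Type*} [NormedAddCommGroup H] [InnerProductSpace ℂ H] [CompleteSpace H]
variable {U : Type*} [NormedAddCommGroup U] [InnerProductSpace ℂ U]

/-- (H5): there is `γ ∈ [0, 1)` such that `B : U → D(A*)'` takes its values in `H_{-γ}` and is
bounded from `U` to `H_{-γ}`; a functional on `D((μ - A*)^γ)` is identified with its restriction
to the dense subspace `D(A*)`. -/
def HypH5 (A : H →ₗ.[ℂ] H) (S : ℝ → H →L[ℂ] H) (μ : ℝ) (B : U →L[ℂ] DStarDual A) : Prop :=
  ∃ γ : ℝ, 0 ≤ γ ∧ γ < 1 ∧ ∃ B' : U →L[ℂ] HNeg S μ γ,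
    ∀ (u : U) (e : DStar A) (e' : HStar S μ γ), e'.1.1 = e.1.1 → B u e = B' u e'

/-- `y ∈ C([0, ∞); H)` solves `y' = (A + σ) y + B u` on `[0, ∞)`, an equation in `D(A*)'`:
`d/dt (y | e) = (y | A* e) + σ (y | e) + ⟨B u, e⟩` for all `e ∈ D(A*)`. -/
def IsSolution (A : H →ₗ.[ℂ] H) (σ : ℝ) (B : U →L[ℂ] DStarDual A) (u : ℝ → U) (y : ℝ → H) :
    Prop :=
  ContinuousOn y (Ici 0) ∧
    ∀ e : DStar A, ∀ t : ℝ, 0 ≤ t →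
      HasDerivWithinAt (fun s => inner ℂ e.1.1 (y s))
        (inner ℂ e.1.2 (y t) + (σ : ℂ) * inner ℂ e.1.1 (y t) + B (u t) e) (Ici 0) t

/-- The pair `(A + σ, B)` is stabilizable: for some bounded feedback `F`, the closed-loop system
`y' = (A + σ) y + B F y` has a solution for every initial value in `H`, and all its solutions decay
exponentially (in particular they are unique). -/
def IsStabilizable (A : H →ₗ.[ℂ] H) (σ : ℝ) (B : U →L[ℂ] DStarDual A) : Prop :=
  ∃ F : H →L[ℂ] U, ∃ C > (0 : ℝ), ∃ ω > (0 : ℝ),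
    (∀ y₀ : H, ∃ y : ℝ → H, y 0 = y₀ ∧ IsSolution A σ B (fun t => F (y t)) y) ∧
    ∀ y : ℝ → H, IsSolution A σ B (fun t => F (y t)) y →
      ∀ t : ℝ, 0 ≤ t → ‖y t‖ ≤ C * Real.exp (-ω * t) * ‖y 0‖

/-- The restriction of the control operator to a subspace of `U`. -/
def restrictControl {A : H →ₗ.[ℂ] H} (B : U →L[ℂ] DStarDual A) (V : Submodule ℂ U) :
    V →L[ℂ] DStarDual A :=
  B.comp V.subtypeL

/-- `(A + σ, B)` is stabilizable by controls in some subspace of `U` of dimension exactly `K`. -/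
def IsStabilizableByDim (A : H →ₗ.[ℂ] H) (σ : ℝ) (B : U →L[ℂ] DStarDual A) (K : ℕ) : Prop :=
  ∃ V : Submodule ℂ U, FiniteDimensional ℂ V ∧ Module.finrank ℂ V = K ∧
    IsStabilizable A σ (restrictControl B V)

/-- `(A + σ, B)` is stabilizable by controls in some subspace of `U` of dimension at most `K`. -/
def IsStabilizableByDimLE (A : H →ₗ.[ℂ] H) (σ : ℝ) (B : U →L[ℂ] DStarDual A) (K : ℕ) : Prop :=
  ∃ V : Submodule ℂ U, FiniteDimensional ℂ V ∧ Module.finrank ℂ V ≤ K ∧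
    IsStabilizable A σ (restrictControl B V)

/-- The family `v` is admissible for stabilizability of `(A + σ, B)`: the pair is stabilizable by
controls in the span of `v`. -/
def IsAdmissible (A : H →ₗ.[ℂ] H) (σ : ℝ) (B : U →L[ℂ] DStarDual A) {K : ℕ} (v : Fin K → U) :
    Prop :=
  IsStabilizable A σ (restrictControl B (Submodule.span ℂ (range v)))

variable [CompleteSpace U]

/-- `B* : D(A*) → U`, determined by `(u | B* e) = ⟨B u, e⟩`. -/
def controlAdjoint {A : H →ₗ.[ℂ] H} (B : U →L[ℂ] DStarDual A) : DStar A →L[ℂ] U :=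
  ((InnerProductSpace.toDual ℂ U).symm.toContinuousLinearEquiv :
    (U →L[ℂ] ℂ) →L⋆[ℂ] U).comp B.flip

theorem inner_controlAdjoint {A : H →ₗ.[ℂ] H} (B : U →L[ℂ] DStarDual A) (e : DStar A) (u : U) :
    inner ℂ (controlAdjoint B e) u = B u e := by
  simp [controlAdjoint]

/-- (UC_σ). -/
def UCσ (A : H →ₗ.[ℂ] H) (σ : ℝ) (B : U →L[ℂ] DStarDual A) : Prop :=
  ∀ (e : DStar A) (l : ℂ), -σ ≤ l.re → e.1.2 = l • e.1.1 → controlAdjoint B e = 0 → e = 0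

/-- The matrix `((v_l | B* b_k))_{l, k}` of a finite family `v` and a family `b` of eigenvectors
of `A*`. -/
def rankMatrix {A : H →ₗ.[ℂ] H} (B : U →L[ℂ] DStarDual A) {K n : ℕ} (v : Fin K → U) {c : ℂ}
    (b : Fin n → eigenspace A.adjoint c) : Matrix (Fin K) (Fin n) ℂ :=
  Matrix.of fun l k => inner ℂ (controlAdjoint B (b k : DStar A)) (v l)

/-- The span `𝓔_σ` of the spaces `Ker (conj l - A*)` over the eigenvalues `l` of `A` with
`Re l ≥ -σ`. -/
def Eσ (A : H →ₗ.[ℂ] H) (σ : ℝ) : Submodule ℂ (DStar A) :=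
  ⨆ l ∈ unstableSpec A σ, eigenspace A.adjoint (starRingEnd ℂ l)

/-- The subspace `B* 𝓔_σ` of `U`. -/
def BstarEσ (A : H →ₗ.[ℂ] H) (σ : ℝ) (B : U →L[ℂ] DStarDual A) : Submodule ℂ U :=
  (Eσ A σ).map (controlAdjoint B : DStar A →ₗ[ℂ] U)

end Control

/-- A residual set: an intersection of countably many open and dense sets. -/
def IsResidualSet {X : Type*} [TopologicalSpace X] (s : Set X) : Prop :=
  ∃ O : ℕ → Set X, (∀ n, IsOpen (O n) ∧ Dense (O n)) ∧ s = ⋂ n, O n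

end FattoriniStab

end

noncomputable section

set_option linter.unusedSectionVars false

namespace FattoriniStab

/-! ### Characters on commutative subalgebras -/

section Gelfand

variable {𝔄 : Type*} [NormedRing 𝔄] [NormedAlgebra ℂ 𝔄]

/-! Necessity of unique continuation is a conserved direction. If `A* e = l e` with `Re l ≥ -σ` and
`B* e = 0`, then every solution satisfies `(y(t) | e) = e^{(conj l + σ) t} (y(0) | e)` whatever the
control is. This does not decay, so `e` is orthogonal to all initial values (`IsStabilizable.ucσ`).

For sufficiency the unstable part is split off. Norm continuity of the analytic semigroup bounds the
imaginary parts of the unstable eigenvalues, so (H6) leaves only finitely many of them. They give a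
spectral projection onto a finite-dimensional space `X`, and on the complement the semigroup decays
strictly faster than `e^{-σ t}` (`exists_spectralSplitting`). Both facts are read off from Gelfand
theory on the bicommutant of the semigroup, a commutative Banach algebra. A character either kills
`S 1` or sends it to `e^l` for a spectral value `l` of `A`, and the spectral radius formula turns
this into growth bounds. The sum `P` of the Riesz projections takes only the values 0 and 1 on
characters, so `P (1 - P)` is quasinilpotent of finite rank, hence nilpotent, and a polynomial in
`P` is the wanted idempotent.

Eigenvectors of the adjoint of `A|X` lift to eigenvectors of `A*`, so unique continuation is the
Hautus condition on `X`, and a Gramian feedback stabilizes that finite-dimensional system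
(`exists_stabilizing_feedback`). The feedback sees only the `X`-component. The stable component is
therefore a free decaying term plus a convolution of `e^{σ r} (1 - E) e^{rA} B` with a decaying
exponential, `E` being the spectral projection. By (H5) and the bound `‖(μ - A*)^γ (e^{tA})*‖ ≤ c
t^{-γ'}` with `γ < γ' < 1` (`exists_negPow_mul_eq`), this kernel has an integrable singularity at
zero, so the convolution decays too (`IsStableKernel.isStabilizable`).

Everything else applies this equivalence to the restriction of `B` to a finite-dimensional `V`.
There unique continuation says that no nonzero unstable eigenvector `e` of `A*` has `B* e`
orthogonal to `V`. For `V = span v` this is independence of the columns of the rank matrices, and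
for general `V` it makes the restricted `B*` injective on each eigenspace, whence (M). Independence
is an open condition, and it is dense once one family satisfies it, because a characteristic
polynomial has finitely many roots. Finitely many eigenvalues are involved, so admissible families
form an open dense set. Projecting `v` onto `B* 𝓔_σ` changes none of the inner products that matter.
-/

/-- The bicommutant of a set. -/
def bicommutant (s : Set 𝔄) : Subalgebra ℂ 𝔄 := Subalgebra.centralizer ℂ s.centralizer

theorem mem_bicommutant {s : Set 𝔄} {a : 𝔄} :
    a ∈ bicommutant s ↔ ∀ T : 𝔄, (∀ x ∈ s, x * T = T * x) → T * a = a * T := by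
  simp only [bicommutant, Subalgebra.mem_centralizer_iff, Set.mem_centralizer_iff]

theorem commute_of_mem_bicommutant {s : Set 𝔄} (hs : ∀ x ∈ s, ∀ y ∈ s, x * y = y * x)
    {a b : 𝔄} (ha : a ∈ bicommutant s) (hb : b ∈ bicommutant s) : a * b = b * a := by
  have h1 : ∀ x ∈ s, x * a = a * x := fun x hx =>
    mem_bicommutant.1 ha x fun y hy => hs y hy x hx
  exact mem_bicommutant.1 hb a h1

theorem isClosed_bicommutant (s : Set 𝔄) : IsClosed (bicommutant s : Set 𝔄) := by
  rw [bicommutant, Subalgebra.coe_centralizer]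
  exact Set.isClosed_centralizer _

/-- A continuous functional on `𝔄` whose restriction to the subalgebra `𝒜` is a character. -/
structure IsCharacterOn (𝒜 : Subalgebra ℂ 𝔄) (χ : 𝔄 →L[ℂ] ℂ) : Prop where
  map_one : χ 1 = 1
  map_mul : ∀ a ∈ 𝒜, ∀ b ∈ 𝒜, χ (a * b) = χ a * χ b

theorem IsCharacterOn.map_pow {𝒜 : Subalgebra ℂ 𝔄} {χ : 𝔄 →L[ℂ] ℂ} (h : IsCharacterOn 𝒜 χ)
    {a : 𝔄} (ha : a ∈ 𝒜) (n : ℕ) : χ (a ^ n) = χ a ^ n := by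
  induction n with
  | zero => simp [h.map_one]
  | succ n ih => rw [pow_succ, h.map_mul _ (pow_mem ha n) _ ha, ih, pow_succ]

variable [CompleteSpace 𝔄]

/-- A unit of the subalgebra is a unit of `𝔄`, so the spectrum can only grow on passing to the
closed commutative bicommutant, where Gelfand theory supplies a character. Hahn–Banach extends it to
`𝔄`, which makes it applicable to derivatives and integrals taken in `𝔄`. -/
theorem exists_isCharacterOn_of_mem_spectrum {s : Set 𝔄}
    (hs : ∀ x ∈ s, ∀ y ∈ s, x * y = y * x) {a : 𝔄} (ha : a ∈ bicommutant s) {z : ℂ}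
    (hz : z ∈ spectrum ℂ a) :
    ∃ χ : 𝔄 →L[ℂ] ℂ, IsCharacterOn (bicommutant s) χ ∧ χ a = z := by
  let 𝒜 := bicommutant s
  let _ : NormedCommRing 𝒜 :=
    { (inferInstance : NormedRing 𝒜) with
      mul_comm := fun x y => Subtype.ext (commute_of_mem_bicommutant hs x.2 y.2) }
  have : CompleteSpace 𝒜 := (isClosed_bicommutant s).completeSpace_coe
  let a' : 𝒜 := ⟨a, ha⟩
  have hz' : z ∈ spectrum ℂ a' := by
    intro hu
    apply hz
    have : IsUnit (𝒜.val (algebraMap ℂ 𝒜 z - a')) := hu.map 𝒜.val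
    exact this
  obtain ⟨f, hf⟩ := WeakDual.CharacterSpace.mem_spectrum_iff_exists.1 hz'
  obtain ⟨g, hg, -⟩ := exists_extension_norm_eq (𝕜 := ℂ) (E := 𝔄) 𝒜.toSubmodule
    (WeakDual.CharacterSpace.toCLM f)
  refine ⟨g, ⟨?_, ?_⟩, ?_⟩
  · have := hg (1 : 𝒜)
    refine this.trans ?_
    exact _root_.map_one f
  · intro x hx y hy
    have h1 := hg ((⟨x, hx⟩ : 𝒜) * ⟨y, hy⟩)
    have h2 := hg (⟨x, hx⟩ : 𝒜)
    have h3 := hg (⟨y, hy⟩ : 𝒜)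
    refine h1.trans ?_
    refine (_root_.map_mul f (⟨x, hx⟩ : 𝒜) ⟨y, hy⟩).trans ?_
    exact (congrArg₂ (· * ·) h2 h3).symm
  · exact (hg a').trans hf

theorem isUnit_of_forall_character_ne_zero {s : Set 𝔄}
    (hs : ∀ x ∈ s, ∀ y ∈ s, x * y = y * x) {a : 𝔄} (ha : a ∈ bicommutant s)
    (h : ∀ χ : 𝔄 →L[ℂ] ℂ, IsCharacterOn (bicommutant s) χ → χ a ≠ 0) : IsUnit a := by
  by_contra hu
  have : (0 : ℂ) ∈ spectrum ℂ a := spectrum.zero_mem ℂ hu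
  obtain ⟨χ, hχ, h0⟩ := exists_isCharacterOn_of_mem_spectrum hs ha this
  exact h χ hχ h0

theorem exists_norm_pow_le_of_spectrum_lt (a : 𝔄) {r : ℝ} (hr : 0 < r)
    (h : ∀ z ∈ spectrum ℂ a, ‖z‖ < r) :
    ∃ C > 0, ∃ ρ > 0, ρ < r ∧ ∀ n : ℕ, ‖a ^ n‖ ≤ C * ρ ^ n := by
  rcases subsingleton_or_nontrivial 𝔄 with hsub | hnt
  · refine ⟨1, one_pos, r / 2, by positivity, by linarith, fun n => ?_⟩
    rw [Subsingleton.elim (a ^ n) 0, norm_zero]; positivity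
  have hlt : spectralRadius ℂ a < (r.toNNReal : ENNReal) := by
    apply spectrum.spectralRadius_lt_of_forall_lt
    intro z hz
    rw [← NNReal.coe_lt_coe, Real.coe_toNNReal _ hr.le]
    exact h z hz
  obtain ⟨ρ, hρ1, hρ2⟩ := ENNReal.lt_iff_exists_nnreal_btwn.1 hlt
  have hρr : ρ < r.toNNReal := by exact_mod_cast hρ2
  have hev : ∀ᶠ n : ℕ in atTop, ‖a ^ n‖ ≤ (ρ : ℝ) ^ n := by
    have h1 := (spectrum.pow_nnnorm_pow_one_div_tendsto_nhds_spectralRadius a).eventually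
      (gt_mem_nhds hρ1)
    filter_upwards [h1, eventually_gt_atTop 0] with n hn hn0
    have hn0' : (0 : ℝ) < n := by exact_mod_cast hn0
    have h2 := ENNReal.rpow_le_rpow hn.le hn0'.le
    rw [← ENNReal.rpow_mul, one_div, inv_mul_cancel₀ hn0'.ne', ENNReal.rpow_one,
      ENNReal.rpow_natCast] at h2
    have h3 : ‖a ^ n‖₊ ≤ ρ ^ n := by exact_mod_cast h2
    exact_mod_cast h3
  obtain ⟨N, hN⟩ := eventually_atTop.1 hev
  have hr' : (ρ : ℝ) < r := by
    have := NNReal.coe_lt_coe.2 hρr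
    rwa [Real.coe_toNNReal _ hr.le] at this
  -- The spectral radius may be zero; the maximum with `r / 2` keeps the rate positive, and the
  -- finitely many powers below `N` go into the constant.
  set ρ' : ℝ := max (ρ : ℝ) (r / 2) with hρ'
  have hρ'0 : 0 < ρ' := lt_of_lt_of_le (by positivity) (le_max_right _ _)
  refine ⟨1 + ∑ n ∈ Finset.range N, ‖a ^ n‖ / ρ' ^ n, by positivity, ρ', hρ'0,
    max_lt hr' (by linarith), fun n => ?_⟩
  rcases lt_or_ge n N with hn | hn
  · have h1 : ‖a ^ n‖ / ρ' ^ n ≤ ∑ n ∈ Finset.range N, ‖a ^ n‖ / ρ' ^ n :=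
      Finset.single_le_sum (f := fun n => ‖a ^ n‖ / ρ' ^ n) (fun i _ => by positivity)
        (Finset.mem_range.2 hn)
    rw [div_le_iff₀ (by positivity)] at h1
    nlinarith [pow_pos hρ'0 n]
  · have h1 : ‖a ^ n‖ ≤ ρ' ^ n :=
      (hN n hn).trans (pow_le_pow_left₀ ρ.2 (le_max_left _ _) n)
    have h2 : 0 ≤ ∑ n ∈ Finset.range N, ‖a ^ n‖ / ρ' ^ n := by positivity
    nlinarith [pow_pos hρ'0 n]

end Gelfand

/-! ### Idempotents from almost idempotent operators of finite rank -/

/-- On its finite-dimensional range `f` has no nonzero eigenvalue, so the generalized eigenspace of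
0 is everything there. One more application of `f` is needed to land in the range. -/
theorem isNilpotent_of_finiteDimensional_range {E : Type*} [AddCommGroup E] [Module ℂ E]
    (f : Module.End ℂ E) [FiniteDimensional ℂ (LinearMap.range f)]
    (h : ∀ (z : ℂ) (x : E), f x = z • x → z ≠ 0 → x = 0) : IsNilpotent f := by
  have hmap : ∀ x ∈ LinearMap.range f, f x ∈ LinearMap.range f := fun x _ => ⟨x, rfl⟩
  let g : Module.End ℂ (LinearMap.range f) := f.restrict hmap
  have hbot : ∀ z : ℂ, z ≠ 0 → g.maxGenEigenspace z = ⊥ := by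
    intro z hz
    by_contra hne
    have hev : g.HasUnifEigenvalue z ⊤ := hne
    have hev1 : g.HasEigenvalue z := hev.lt zero_lt_one
    obtain ⟨v, hv⟩ := hev1.exists_hasEigenvector
    have h1 : g v = z • v := hv.apply_eq_smul
    have h2 : f v = z • (v : E) := congrArg Subtype.val h1
    exact hv.2 (Subtype.ext (h z v h2 hz))
  have htop : g.maxGenEigenspace 0 = ⊤ := by
    rw [eq_top_iff, ← Module.End.iSup_maxGenEigenspace_eq_top g]
    refine iSup_le fun z => ?_
    rcases eq_or_ne z 0 with rfl | hz
    · exact le_rfl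
    · rw [hbot z hz]; exact bot_le
  have hnil : g ^ Module.finrank ℂ (LinearMap.range f) = 0 := by
    ext x
    have hx : x ∈ g.maxGenEigenspace 0 := htop ▸ Submodule.mem_top
    rw [Module.End.maxGenEigenspace_eq_genEigenspace_finrank, Module.End.mem_genEigenspace_nat] at hx
    simpa using hx
  refine ⟨Module.finrank ℂ (LinearMap.range f) + 1, ?_⟩
  ext x
  have key : ∀ (n : ℕ) (y : LinearMap.range f), ((g ^ n) y : E) = (f ^ n) y := by
    intro n
    induction n with
    | zero => intro y; rfl
    | succ n ih => intro y; rw [pow_succ, pow_succ, Module.End.mul_apply, Module.End.mul_apply, ih]; rfl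
  rw [pow_succ, Module.End.mul_apply, ← key _ ⟨f x, ⟨x, rfl⟩⟩, hnil]
  rfl

/-- If `(p - p²)ⁿ = 0`, then `1 - (1 - pⁿ)ⁿ` is idempotent. -/
theorem isIdempotentElem_one_sub_one_sub_pow_pow {R : Type*} [Ring R] (p : R) (n : ℕ)
    (h : (p * (1 - p)) ^ n = 0) : IsIdempotentElem (1 - (1 - p ^ n) ^ n) := by
  have hcomm : Commute p (1 - p) := (Commute.one_right p).sub_right (Commute.refl p)
  have h0 : p ^ n * (1 - p) ^ n = 0 := by rw [← hcomm.mul_pow, h]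
  have hgeom1 : 1 - p ^ n = (1 - p) * ∑ i ∈ Finset.range n, p ^ i :=
    (mul_neg_geom_sum p n).symm
  have hgeom2 : 1 - (1 - p ^ n) ^ n = (∑ i ∈ Finset.range n, (1 - p ^ n) ^ i) * p ^ n := by
    have := geom_sum_mul_neg (1 - p ^ n) n
    rw [sub_sub_cancel] at this
    exact this.symm
  have hc2 : Commute (1 - p) (∑ i ∈ Finset.range n, p ^ i) :=
    Commute.sum_right _ _ _ fun i _ => hcomm.symm.pow_right i
  -- The two complementary elements are multiples of `p ^ n` and of `(1 - p) ^ n`, whose product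
  -- vanishes.
  have hz : (1 - (1 - p ^ n) ^ n) * (1 - p ^ n) ^ n = 0 := by
    rw [hgeom2]
    nth_rewrite 2 [hgeom1]
    rw [hc2.mul_pow, mul_assoc, ← mul_assoc (p ^ n), h0, zero_mul, mul_zero]
  rw [IsIdempotentElem]
  nth_rewrite 2 [show (1 - (1 - p ^ n) ^ n) = 1 - ((1 - p ^ n) ^ n) from rfl]
  rw [mul_sub, mul_one, hz, sub_zero]

section Semigroups

variable {H : Type*} [NormedAddCommGroup H] [InnerProductSpace ℂ H]
variable {A : H →ₗ.[ℂ] H} {S : ℝ → H →L[ℂ] H}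

/-! ### Strongly continuous semigroups -/

theorem IsC0Semigroup.commute (hS : IsC0Semigroup S) {s t : ℝ} (hs : 0 ≤ s) (ht : 0 ≤ t) :
    S s * S t = S t * S s := by
  rw [← hS.add s t hs ht, add_comm, hS.add t s ht hs]

theorem IsC0Semigroup.exists_norm_le [CompleteSpace H] (hS : IsC0Semigroup S) (b : ℝ) :
    ∃ M > 0, ∀ t ∈ Icc 0 b, ‖S t‖ ≤ M := by
  obtain ⟨M, hM⟩ := banach_steinhaus (g := fun t : Icc (0 : ℝ) b => S t) (fun x => by
    obtain ⟨C, hC⟩ := isCompact_Icc.exists_bound_of_continuousOn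
      ((hS.continuousOn x).mono (t := Icc 0 b) Icc_subset_Ici_self)
    exact ⟨C, fun i => hC i i.2⟩)
  exact ⟨max M 1, by positivity, fun t ht => (hM ⟨t, ht⟩).trans (le_max_left _ _)⟩

theorem IsC0Semigroup.natCast_mul (hS : IsC0Semigroup S) {t : ℝ} (ht : 0 ≤ t) (n : ℕ) :
    S (n * t) = S t ^ n := by
  induction n with
  | zero => simp [hS.zero]
  | succ n ih =>
    rw [Nat.cast_succ, add_mul, one_mul, hS.add _ _ (by positivity) ht, ih, pow_succ]

/-- A power bound for the time-one map, composed with a commuting operator, gives an exponential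
bound for the semigroup. -/
theorem IsC0Semigroup.exists_norm_mul_le_exp [CompleteSpace H] (hS : IsC0Semigroup S)
    {Q : H →L[ℂ] H} {C ρ : ℝ} (hρ : 0 < ρ)
    (h : ∀ n : ℕ, ‖S n * Q‖ ≤ C * ρ ^ n) :
    ∃ C' > 0, ∀ t : ℝ, 0 ≤ t → ‖S t * Q‖ ≤ C' * Real.exp (Real.log ρ * t) := by
  obtain ⟨M, hM0, hM⟩ := hS.exists_norm_le 1
  have hC : 0 ≤ C := by simpa using (norm_nonneg _).trans (h 0)
  refine ⟨M * (C + 1) * Real.exp |Real.log ρ|, by positivity, fun t ht => ?_⟩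
  set n := ⌊t⌋₊
  have hn : (n : ℝ) ≤ t := Nat.floor_le ht
  have hn' : t < n + 1 := Nat.lt_floor_add_one t
  have h1 : S t = S (t - n) * S n := by
    rw [← hS.add _ _ (by linarith) (by positivity), sub_add_cancel]
  have h2 : ‖S t * Q‖ ≤ M * (C * ρ ^ n) := by
    rw [h1, mul_assoc]
    exact (norm_mul_le _ _).trans (mul_le_mul (hM _ ⟨by linarith, by linarith⟩) (h n)
      (norm_nonneg _) hM0.le)
  -- Rounding `t` down to `n` changes the exponent by at most `|log ρ|`.
  have h3 : ρ ^ n ≤ Real.exp |Real.log ρ| * Real.exp (Real.log ρ * t) := by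
    rw [← Real.rpow_natCast, Real.rpow_def_of_pos hρ, ← Real.exp_add]
    apply Real.exp_le_exp.2
    have := neg_abs_le (Real.log ρ * (t - n))
    rw [abs_mul, abs_of_nonneg (by linarith : 0 ≤ t - n)] at this
    nlinarith [abs_nonneg (Real.log ρ)]
  calc ‖S t * Q‖ ≤ M * (C * ρ ^ n) := h2
    _ ≤ M * ((C + 1) * (Real.exp |Real.log ρ| * Real.exp (Real.log ρ * t))) := by
        gcongr
        linarith
    _ = _ := by ring

/-! ### Generators -/

theorem IsGenerator.mem_graph_of_commute (hA : IsGenerator A S) {T : H →L[ℂ] H}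
    (hT : ∀ t, 0 ≤ t → S t * T = T * S t) {x y : H} (h : (x, y) ∈ A.graph) :
    (T x, T y) ∈ A.graph := by
  rw [hA] at h ⊢
  have h1 := (T.continuous.tendsto y).comp h
  refine h1.congr' ?_
  filter_upwards [self_mem_nhdsWithin] with t ht
  have : S t (T x) = T (S t x) := congrArg (· x) (hT t (le_of_lt ht))
  simp [this, map_sub]

theorem IsGenerator.semigroup_mem_graph (hS : IsC0Semigroup S) (hA : IsGenerator A S) {t : ℝ}
    (ht : 0 ≤ t) {x y : H} (h : (x, y) ∈ A.graph) : (S t x, S t y) ∈ A.graph :=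
  hA.mem_graph_of_commute (fun _ hs => hS.commute hs ht) h

theorem LinearPMap_graph_unique {x y y' : H} (h : (x, y) ∈ A.graph) (h' : (x, y') ∈ A.graph) :
    y = y' := by
  obtain ⟨u, hu1, hu2⟩ := (LinearPMap.mem_graph_iff A).1 h
  obtain ⟨v, hv1, hv2⟩ := (LinearPMap.mem_graph_iff A).1 h'
  have : u = v := Subtype.ext (hu1.trans hv1.symm)
  subst this
  exact hu2.symm.trans hv2

theorem IsGenerator.mem_graph_of_hasDerivAt (hS : IsC0Semigroup S) (hA : IsGenerator A S) {t : ℝ}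
    (ht : 0 < t) {D : H →L[ℂ] H} (hD : HasDerivAt S D t) (x : H) : (S t x, D x) ∈ A.graph := by
  rw [hA]
  have h1 : HasDerivAt (fun s => S s x) (D x) t :=
    ((ContinuousLinearMap.apply ℂ H x).restrictScalars ℝ).hasFDerivAt.comp_hasDerivAt t hD
  have h2 := (h1.tendsto_slope_zero).mono_left
    (nhdsWithin_mono 0 (fun s (hs : 0 < s) => ne_of_gt hs) : 𝓝[>] (0 : ℝ) ≤ 𝓝[≠] 0)
  refine h2.congr' ?_
  filter_upwards [self_mem_nhdsWithin] with s hs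
  have hs' : 0 < s := hs
  have : S (t + s) x = S s (S t x) := by
    rw [add_comm, hS.add s t hs'.le ht.le]; rfl
  rw [this]
  exact RCLike.real_smul_eq_coe_smul (K := ℂ) s⁻¹ _

/-! ### Analytic semigroups -/

theorem isOpen_sector (θ : ℝ) (hθ : θ ≤ Real.pi / 2) : IsOpen (sector θ) := by
  rw [isOpen_iff_mem_nhds]
  rintro z ⟨hz, harg⟩
  have hpi := Real.pi_pos
  have hsl : z ∈ Complex.slitPlane := by
    rw [Complex.mem_slitPlane_iff_arg]
    refine ⟨fun h => ?_, hz⟩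
    rw [h, abs_of_pos hpi] at harg
    linarith
  have hc : ContinuousAt (fun w : ℂ => |w.arg|) z := (Complex.continuousAt_arg hsl).abs
  filter_upwards [hc.eventually (gt_mem_nhds harg), isOpen_ne.mem_nhds hz] with w h1 h2
  exact ⟨h2, h1⟩

theorem ofReal_mem_sector {θ : ℝ} (hθ : 0 < θ) {t : ℝ} (ht : 0 < t) : (t : ℂ) ∈ sector θ :=
  ⟨by exact_mod_cast ht.ne', by rw [Complex.arg_ofReal_of_nonneg ht.le]; simpa using hθ⟩

/-- The sector is an open cone, so a disc about 1 inside it scales to discs about `t` of radius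
proportional to `t`. These are the discs for Cauchy's estimate. -/
theorem exists_closedBall_subset_sector {θ : ℝ} (hθ : 0 < θ) (hθ' : θ ≤ Real.pi / 2) :
    ∃ c : ℝ, 0 < c ∧ c < 1 ∧ ∀ t : ℝ, 0 < t → Metric.closedBall (t : ℂ) (c * t) ⊆ sector θ := by
  have h1 : sector θ ∈ 𝓝 (1 : ℂ) :=
    (isOpen_sector θ hθ').mem_nhds (by simpa using ofReal_mem_sector hθ one_pos)
  obtain ⟨c, hc, hsub⟩ := Metric.nhds_basis_closedBall.mem_iff.1 h1
  refine ⟨min c (1 / 2), by positivity, (min_le_right _ _).trans_lt (by norm_num), ?_⟩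
  intro t ht w hw
  have htc : (t : ℂ) ≠ 0 := by exact_mod_cast ht.ne'
  have h2 : w / t ∈ Metric.closedBall (1 : ℂ) c := by
    rw [Metric.mem_closedBall, dist_eq_norm] at hw ⊢
    have : w / t - 1 = (w - t) / t := by field_simp
    rw [this, norm_div, Complex.norm_real, Real.norm_of_nonneg ht.le, div_le_iff₀ ht]
    exact hw.trans (by gcongr; exact min_le_left _ _)
  obtain ⟨h3, h4⟩ := hsub h2
  have h5 : w = (t : ℂ) * (w / t) := by field_simp
  refine ⟨fun h => h3 (by rw [h, zero_div]), ?_⟩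
  rw [h5, Complex.arg_real_mul _ ht]
  exact h4

variable [CompleteSpace H]

/-- Only strong convergence at 0 is given. A sequence `z n → 0` with unbounded norms would
contradict the uniform boundedness principle. -/
theorem exists_norm_le_of_tendsto_apply {θ : ℝ} {T : ℂ → H →L[ℂ] H}
    (h : ∀ x : H, Tendsto (fun z => T z x) (𝓝[sector θ] 0) (𝓝 x)) :
    ∃ r > 0, ∃ M > 0, ∀ z ∈ sector θ, ‖z‖ < r → ‖T z‖ ≤ M := by
  by_contra hcon
  push Not at hcon
  have h1 : ∀ n : ℕ, ∃ z ∈ sector θ, ‖z‖ < 1 / ((n : ℝ) + 1) ∧ (n : ℝ) + 1 < ‖T z‖ := fun n =>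
    hcon _ (by positivity) _ (by positivity)
  choose z hz hz1 hz2 using h1
  have hlim : Tendsto z atTop (𝓝[sector θ] 0) := by
    refine tendsto_nhdsWithin_iff.2 ⟨?_, Eventually.of_forall hz⟩
    exact squeeze_zero_norm (fun n => (hz1 n).le) tendsto_one_div_add_atTop_nhds_zero_nat
  obtain ⟨C, hC⟩ := banach_steinhaus (g := fun n => T (z n)) (fun x => by
    obtain ⟨C, hC⟩ := (Metric.isBounded_range_of_tendsto _ ((h x).comp hlim)).exists_norm_le
    exact ⟨C, fun n => hC _ ⟨n, rfl⟩⟩)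
  obtain ⟨n, hn⟩ := exists_nat_gt C
  linarith [hC n, hz2 n]

/-- The consequences of analyticity that are used: differentiability in operator norm for positive
times, and the bound `‖S'(t)‖ ≤ C / t` near zero. -/
structure IsDifferentiableSemigroup (S : ℝ → H →L[ℂ] H) (S' : ℝ → H →L[ℂ] H) : Prop where
  hasDerivAt : ∀ t, 0 < t → HasDerivAt S (S' t) t
  norm_le : ∃ C > 0, ∀ t ∈ Ioc (0 : ℝ) 1, ‖S' t‖ ≤ C / t

omit [CompleteSpace H] in
theorem IsC0Semigroup.hasDerivAt_add (hS : IsC0Semigroup S) {S' : ℝ → H →L[ℂ] H}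
    (hd : ∀ t, 0 < t → HasDerivAt S (S' t) t)
    {s t : ℝ} (hs : 0 < s) (ht : 0 ≤ t) : S' (s + t) = S' s * S t := by
  have h1 : HasDerivAt (fun r => S (r + t)) (S' (s + t)) s :=
    (hd (s + t) (by linarith)).comp_add_const s t
  have h2 : HasDerivAt (fun r => S r * S t) (S' s * S t) s :=
    (hd s hs).mul_const (S t)
  refine h1.unique (h2.congr_of_eventuallyEq ?_)
  filter_upwards [lt_mem_nhds hs] with r hr
  exact hS.add r t (le_of_lt hr) ht

omit [CompleteSpace H] in
theorem IsC0Semigroup.hasDerivAt_add' (hS : IsC0Semigroup S) {S' : ℝ → H →L[ℂ] H}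
    (hd : ∀ t, 0 < t → HasDerivAt S (S' t) t)
    {s t : ℝ} (hs : 0 < s) (ht : 0 ≤ t) : S' (s + t) = S t * S' s := by
  have h1 : HasDerivAt (fun r => S (r + t)) (S' (s + t)) s :=
    (hd (s + t) (by linarith)).comp_add_const s t
  have h2 : HasDerivAt (fun r => S t * S r) (S t * S' s) s :=
    (hd s hs).const_mul (S t)
  refine h1.unique (h2.congr_of_eventuallyEq ?_)
  filter_upwards [lt_mem_nhds hs] with r hr
  rw [hS.add r t (le_of_lt hr) ht, hS.commute (le_of_lt hr) ht]

/-- Cauchy's estimate on the disc of radius `c t` about `t`, on which the extension is bounded,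
gives `‖S'(t)‖ ≤ M / (c t)` for small `t`. Up to time 1 the factorization `S'(t) = S'(t₁) S(t - t₁)`
suffices. -/
theorem IsAnalyticSemigroup.exists_isDifferentiableSemigroup (hS : IsC0Semigroup S)
    (h : IsAnalyticSemigroup S) : ∃ S', IsDifferentiableSemigroup S S' := by
  obtain ⟨θ, hθ, hθ', T, hTS, hTd, -, hT0⟩ := h
  have hd : ∀ t : ℝ, 0 < t → HasDerivAt S (deriv T (t : ℂ)) t := by
    intro t ht
    have h1 : HasDerivAt T (deriv T (t : ℂ)) (t : ℂ) :=
      (hTd.differentiableAt ((isOpen_sector θ hθ').mem_nhds (ofReal_mem_sector hθ ht))).hasDerivAt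
    have h2 := HasDerivAt.scomp t h1 (Complex.ofRealCLM.hasDerivAt (x := t))
    simp only [Complex.ofRealCLM_apply, Complex.ofReal_one, one_smul] at h2
    refine h2.congr_of_eventuallyEq ?_
    filter_upwards [lt_mem_nhds ht] with s hs
    exact (hTS s (le_of_lt hs)).symm
  obtain ⟨c, hc0, hc1, hball⟩ := exists_closedBall_subset_sector hθ hθ'
  obtain ⟨r, hr, M, hM, hb⟩ := exists_norm_le_of_tendsto_apply hT0
  obtain ⟨N, hN, hbN⟩ := hS.exists_norm_le 1
  -- For `t ≤ t₁` the disc of radius `c t ≤ t` about `t` stays within `‖z‖ ≤ 2 t ≤ r / 2`, where the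
  -- uniform bound holds.
  set t₁ := r / 4
  have ht₁ : 0 < t₁ := by positivity
  have hsmall : ∀ t : ℝ, 0 < t → t ≤ t₁ → ‖deriv T (t : ℂ)‖ ≤ M / c / t := by
    intro t ht htt
    have hct : 0 < c * t := by positivity
    have hcl : DiffContOnCl ℂ T (Metric.ball (t : ℂ) (c * t)) :=
      (hTd.mono (hball t ht)).diffContOnCl_ball subset_rfl
    rw [div_div]
    refine Complex.norm_deriv_le_of_forall_mem_sphere_norm_le hct hcl fun z hz => ?_
    have hz' := Metric.sphere_subset_closedBall hz
    refine hb z (hball t ht hz') ?_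
    rw [Metric.mem_closedBall, dist_eq_norm] at hz'
    have h1 : ‖z‖ ≤ ‖z - t‖ + ‖(t : ℂ)‖ := by simpa using norm_add_le (z - t) (t : ℂ)
    rw [Complex.norm_real, Real.norm_of_nonneg ht.le] at h1
    have : c * t ≤ t := by nlinarith
    have : t₁ = r / 4 := rfl
    linarith
  refine ⟨fun t => deriv T (t : ℂ), hd, max (M / c) (‖deriv T (t₁ : ℂ)‖ * N), ?_, ?_⟩
  · exact lt_max_of_lt_left (by positivity)
  rintro t ⟨ht, ht1⟩
  rcases le_or_gt t t₁ with hle | hlt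
  · exact (hsmall t ht hle).trans (by gcongr; exact le_max_left _ _)
  · have h1 := hS.hasDerivAt_add (S' := fun t => deriv T (t : ℂ)) hd ht₁ (sub_nonneg.2 hlt.le)
    rw [add_sub_cancel] at h1
    rw [h1, le_div_iff₀ ht]
    have h2 : ‖deriv T (t₁ : ℂ) * S (t - t₁)‖ ≤ ‖deriv T (t₁ : ℂ)‖ * N :=
      (norm_mul_le _ _).trans
        (by gcongr; exact hbN _ ⟨by linarith, by linarith⟩)
    calc _ ≤ ‖deriv T (t₁ : ℂ) * S (t - t₁)‖ * 1 := by gcongr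
      _ ≤ _ := by rw [mul_one]; exact h2.trans (le_max_right _ _)

variable {S' : ℝ → H →L[ℂ] H}

theorem IsDifferentiableSemigroup.continuousOn (hd : IsDifferentiableSemigroup S S') :
    ContinuousOn S (Ioi 0) := fun t ht => (hd.hasDerivAt t ht).continuousAt.continuousWithinAt

theorem IsDifferentiableSemigroup.continuousOn_deriv (hS : IsC0Semigroup S)
    (hd : IsDifferentiableSemigroup S S') : ContinuousOn S' (Ioi 0) := by
  intro t ht
  have ht' : 0 < t := ht
  have h1 : ContinuousAt (fun s => S' (t / 2) * S (s - t / 2)) t := by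
    refine continuousAt_const.mul (ContinuousAt.comp (g := S) ?_ (by fun_prop))
    exact (hd.hasDerivAt _ (by linarith)).continuousAt
  refine (h1.congr ?_).continuousWithinAt
  filter_upwards [lt_mem_nhds (by linarith : t / 2 < t)] with s hs
  rw [← hS.hasDerivAt_add hd.hasDerivAt (by linarith) (by linarith), add_sub_cancel]

theorem IsDifferentiableSemigroup.mem_graph (hS : IsC0Semigroup S) (hA : IsGenerator A S)
    (hd : IsDifferentiableSemigroup S S') {t : ℝ} (ht : 0 < t) (x : H) :
    (S t x, S' t x) ∈ A.graph :=
  hA.mem_graph_of_hasDerivAt hS ht (hd.hasDerivAt t ht) x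

theorem IsDifferentiableSemigroup.deriv_apply (hS : IsC0Semigroup S) (hA : IsGenerator A S)
    (hd : IsDifferentiableSemigroup S S') {t : ℝ} (ht : 0 < t) {x y : H}
    (h : (x, y) ∈ A.graph) : S' t x = S t y :=
  LinearPMap_graph_unique (hd.mem_graph hS hA ht x) (hA.semigroup_mem_graph hS ht.le h)

theorem IsC0Semigroup.tendsto_apply_zero (hS : IsC0Semigroup S) (x : H) :
    Tendsto (fun t => S t x) (𝓝[>] 0) (𝓝 x) := by
  have h1 := hS.continuousOn x 0 self_mem_Ici
  rw [ContinuousWithinAt, hS.zero] at h1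
  exact h1.mono_left (nhdsWithin_mono 0 Ioi_subset_Ici_self)

theorem IsDifferentiableSemigroup.dense_domain (hS : IsC0Semigroup S) (hA : IsGenerator A S)
    (hd : IsDifferentiableSemigroup S S') : Dense (A.domain : Set H) := by
  intro x
  refine mem_closure_of_tendsto (hS.tendsto_apply_zero x) ?_
  filter_upwards [self_mem_nhdsWithin] with t ht
  obtain ⟨u, hu, -⟩ := (LinearPMap.mem_graph_iff A).1 (hd.mem_graph hS hA ht x)
  have : S t x = u := hu.symm
  rw [this]
  exact u.2

/-! ### The adjoint -/

theorem mem_adjoint_graph_iff (hdense : Dense (A.domain : Set H)) {e f : H} :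
    (e, f) ∈ A.adjoint.graph ↔ ∀ x y, (x, y) ∈ A.graph → inner ℂ f x = inner ℂ e y := by
  constructor
  · intro h x y hxy
    obtain ⟨u, hu1, hu2⟩ := (LinearPMap.mem_graph_iff _).1 h
    obtain ⟨v, hv1, hv2⟩ := (LinearPMap.mem_graph_iff _).1 hxy
    have := LinearPMap.adjoint_isFormalAdjoint hdense u v
    simp only at hu1 hu2 hv1 hv2
    rw [hu1, hu2, hv1, hv2] at this
    exact this
  · intro h
    have h1 : ∀ x : A.domain, inner ℂ f (x : H) = inner ℂ e (A x) := fun x =>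
      h x (A x) (A.mem_graph x)
    have hm : e ∈ A.adjoint.domain := LinearPMap.mem_adjoint_domain_of_exists e ⟨f, h1⟩
    rw [LinearPMap.mem_graph_iff]
    exact ⟨⟨e, hm⟩, rfl, LinearPMap.adjoint_apply_eq hdense _ h1⟩

open ContinuousLinearMap in
theorem IsDifferentiableSemigroup.mem_adjoint_graph (hS : IsC0Semigroup S) (hA : IsGenerator A S)
    (hd : IsDifferentiableSemigroup S S') {t : ℝ} (ht : 0 < t) (e : H) :
    (adjoint (S t) e, adjoint (S' t) e) ∈ A.adjoint.graph := by
  rw [mem_adjoint_graph_iff (hd.dense_domain hS hA)]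
  intro x y h
  rw [adjoint_inner_left, adjoint_inner_left, hd.deriv_apply hS hA ht h]

open ContinuousLinearMap in
theorem adjoint_mem_adjoint_graph_of_commute (hA : IsGenerator A S)
    (hdense : Dense (A.domain : Set H)) {T : H →L[ℂ] H}
    (hT : ∀ t, 0 ≤ t → S t * T = T * S t) {e f : H} (h : (e, f) ∈ A.adjoint.graph) :
    (adjoint T e, adjoint T f) ∈ A.adjoint.graph := by
  rw [mem_adjoint_graph_iff hdense] at h ⊢
  intro x y hxy
  rw [adjoint_inner_left, adjoint_inner_left]
  exact h _ _ (hA.mem_graph_of_commute hT hxy)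

open ContinuousLinearMap in
theorem IsDifferentiableSemigroup.adjoint_deriv_apply (hS : IsC0Semigroup S)
    (hA : IsGenerator A S) (hd : IsDifferentiableSemigroup S S') {t : ℝ} (ht : 0 < t) {e f : H}
    (h : (e, f) ∈ A.adjoint.graph) : adjoint (S' t) e = adjoint (S t) f :=
  LinearPMap_graph_unique (hd.mem_adjoint_graph hS hA ht e)
    (adjoint_mem_adjoint_graph_of_commute hA (hd.dense_domain hS hA)
      (fun _ hs => hS.commute hs ht.le) h)

theorem continuous_adjoint_clm : Continuous (fun T : H →L[ℂ] H => ContinuousLinearMap.adjoint T) :=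
  (ContinuousLinearMap.adjoint (𝕜 := ℂ) (E := H) (F := H)).continuous

open ContinuousLinearMap in
theorem IsC0Semigroup.adjoint_add (hS : IsC0Semigroup S) {s t : ℝ} (hs : 0 ≤ s) (ht : 0 ≤ t)
    (e : H) : adjoint (S (s + t)) e = adjoint (S s) (adjoint (S t) e) := by
  rw [add_comm, hS.add t s ht hs]
  change adjoint (S t ∘L S s) e = _
  rw [adjoint_comp]; rfl

-- On vectors `S(s)* f` with `s > 0`, norm continuity of `S` at `s` gives the limit. Such vectors
-- span a dense subspace, since a vector `x` orthogonal to all `S(s)* S(s) x` has `S(s) x = 0` for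
-- all `s > 0` and hence vanishes; the local bound on `‖S t‖` extends the limit to all of `H`.
open ContinuousLinearMap in
theorem IsDifferentiableSemigroup.tendsto_adjoint_apply_zero (hS : IsC0Semigroup S)
    (hd : IsDifferentiableSemigroup S S') (e : H) :
    Tendsto (fun t => adjoint (S t) e) (𝓝[>] 0) (𝓝 e) := by
  obtain ⟨M, hM0, hM⟩ := hS.exists_norm_le 1
  let V : Submodule ℂ H := Submodule.span ℂ {v | ∃ s > 0, ∃ f, v = adjoint (S s) f}
  have hV : ∀ v ∈ V, Tendsto (fun t => adjoint (S t) v) (𝓝[>] 0) (𝓝 v) := by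
    intro v hv
    induction hv using Submodule.span_induction with
    | mem v hv =>
      obtain ⟨s, hs, f, rfl⟩ := hv
      have h1 : ContinuousAt (fun t => adjoint (S (t + s)) f) 0 := by
        have h2 : ContinuousAt S (0 + s) := (hd.hasDerivAt _ (by simpa using hs)).continuousAt
        have h3 : ContinuousAt (fun t => S (t + s)) 0 :=
          ContinuousAt.comp (g := S) h2 (by fun_prop)
        exact ((continuous_adjoint_clm.continuousAt.comp h3).clm_apply continuousAt_const)
      have h2 : Tendsto (fun t => adjoint (S (t + s)) f) (𝓝[>] 0) (𝓝 (adjoint (S s) f)) := by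
        simpa using h1.tendsto.mono_left (nhdsWithin_le_nhds (s := Ioi 0))
      refine h2.congr' ?_
      filter_upwards [self_mem_nhdsWithin] with t ht
      exact hS.adjoint_add (le_of_lt ht) hs.le f
    | zero => simp
    | add x y _ _ hx hy => simpa using hx.add hy
    | smul a x _ hx => simpa using hx.const_smul a
  have hdense : V.topologicalClosure = ⊤ := by
    rw [Submodule.topologicalClosure_eq_top_iff, Submodule.eq_bot_iff]
    intro x hx
    have h0 : ∀ s > 0, S s x = 0 := by
      intro s hs
      have := hx _ (Submodule.subset_span ⟨s, hs, S s x, rfl⟩)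
      rwa [adjoint_inner_left, inner_self_eq_zero] at this
    refine tendsto_nhds_unique (hS.tendsto_apply_zero x) ?_
    refine tendsto_const_nhds.congr' ?_
    filter_upwards [self_mem_nhdsWithin] with s hs
    exact (h0 s hs).symm
  have he : e ∈ closure (V : Set H) := by
    rw [← Submodule.topologicalClosure_coe, hdense]; trivial
  rw [Metric.tendsto_nhds]
  intro ε hε
  obtain ⟨v, hvV, hv⟩ := Metric.mem_closure_iff.1 he (ε / (M + 2)) (by positivity)
  have h1 := (Metric.tendsto_nhds.1 (hV v hvV)) (ε / (M + 2)) (by positivity)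
  filter_upwards [h1, Ioo_mem_nhdsGT (one_pos : (0 : ℝ) < 1)] with t ht htI
  have h2 : dist (adjoint (S t) e) (adjoint (S t) v) ≤ M * dist e v := by
    rw [dist_eq_norm, dist_eq_norm, ← map_sub]
    refine (le_opNorm _ _).trans ?_
    gcongr
    rw [LinearIsometryEquiv.norm_map]
    exact hM t ⟨htI.1.le, htI.2.le⟩
  have h3 : M * dist e v ≤ M * (ε / (M + 2)) := by gcongr
  calc dist (adjoint (S t) e) e ≤ dist (adjoint (S t) e) (adjoint (S t) v)
        + dist (adjoint (S t) v) v + dist v e := dist_triangle4 _ _ _ _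
    _ < M * (ε / (M + 2)) + ε / (M + 2) + ε / (M + 2) := by
        rw [dist_comm v e]; linarith
    _ = ε := by field_simp; ring

open ContinuousLinearMap in
theorem IsDifferentiableSemigroup.continuousOn_adjoint_apply (hS : IsC0Semigroup S)
    (hd : IsDifferentiableSemigroup S S') (e : H) :
    ContinuousOn (fun t => adjoint (S t) e) (Ici 0) := by
  intro t ht
  rcases eq_or_lt_of_le (show (0 : ℝ) ≤ t from ht) with rfl | h0
  · rw [← continuousWithinAt_Ioi_iff_Ici, ContinuousWithinAt, hS.zero, ← star_eq_adjoint,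
      star_one]
    exact hd.tendsto_adjoint_apply_zero hS e
  · have h1 : ContinuousAt S t := (hd.hasDerivAt t h0).continuousAt
    exact ((continuous_adjoint_clm.continuousAt.comp h1).clm_apply
      continuousAt_const).continuousWithinAt

end Semigroups

section Spectral

variable {H : Type*} [NormedAddCommGroup H] [InnerProductSpace ℂ H]
variable {A : H →ₗ.[ℂ] H} {S S' : ℝ → H →L[ℂ] H}

/-! ### Resolvents -/

theorem isResolventAt_resolventOp {z : ℂ} (hz : z ∉ spec A) :
    IsResolventAt A z (resolventOp A z) := by
  have h : ∃ R : H →L[ℂ] H, IsResolventAt A z R := not_not.1 hz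
  rw [resolventOp, dif_pos h]
  exact h.choose_spec

theorem IsResolventAt.mem_graph {z : ℂ} {R : H →L[ℂ] H} (h : IsResolventAt A z R) (f : H) :
    (R f, z • R f - f) ∈ A.graph := by
  obtain ⟨hx, he⟩ := (h (R f) f).1 rfl
  rw [LinearPMap.mem_graph_iff]
  refine ⟨⟨R f, hx⟩, rfl, ?_⟩
  exact (sub_eq_iff_eq_add'.2 (sub_eq_iff_eq_add.1 he)).symm

theorem IsResolventAt.apply_of_mem_graph {z : ℂ} {R : H →L[ℂ] H} (h : IsResolventAt A z R)
    {x y : H} (hxy : (x, y) ∈ A.graph) : R (z • x - y) = x := by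
  obtain ⟨u, hu1, hu2⟩ := (LinearPMap.mem_graph_iff A).1 hxy
  simp only at hu1 hu2
  subst hu1 hu2
  exact (h _ _).2 ⟨u.2, rfl⟩

theorem IsResolventAt.commute (hA : IsGenerator A S) {z : ℂ} {R : H →L[ℂ] H}
    (h : IsResolventAt A z R) {T : H →L[ℂ] H} (hT : ∀ t, 0 ≤ t → S t * T = T * S t) :
    T * R = R * T := by
  ext f
  have h1 := hA.mem_graph_of_commute hT (h.mem_graph f)
  have h2 := h.apply_of_mem_graph h1
  rw [map_sub T, map_smul T, sub_sub_cancel] at h2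
  exact h2.symm

theorem IsResolventAt.sub_eq {z w : ℂ} {R Q : H →L[ℂ] H}
    (hR : IsResolventAt A z R) (hQ : IsResolventAt A w Q) : Q = R + (z - w) • (R * Q) := by
  ext f
  have h1 := hR.apply_of_mem_graph (hQ.mem_graph f)
  have h2 : z • Q f - (w • Q f - f) = (z - w) • Q f + f := by rw [sub_smul]; abel
  rw [h2, map_add, map_smul] at h1
  rw [add_comm] at h1
  exact h1.symm

/-- Solving the resolvent identity for the resolvent at `z` near `w` gives `R (1 + (z - w) R)⁻¹`,
and inversion is continuous at 1. Continuity within the resolvent set is all that the circle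
integrals need. -/
theorem continuousOn_resolventOp [CompleteSpace H] :
    ContinuousOn (resolventOp A) (spec A)ᶜ := by
  intro w hw
  have hR := isResolventAt_resolventOp hw
  set R := resolventOp A w
  have hcont : ContinuousAt (fun z : ℂ => R * Ring.inverse (1 + (z - w) • R)) w := by
    refine continuousAt_const.mul ?_
    have h0 : (1 : H →L[ℂ] H) + (w - w) • R = ((1 : (H →L[ℂ] H)ˣ) : H →L[ℂ] H) := by simp
    refine ContinuousAt.comp (g := Ring.inverse) (f := fun z : ℂ => 1 + (z - w) • R) ?_
      (by fun_prop)
    rw [h0]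
    exact NormedRing.inverse_continuousAt 1
  have hunit : ∀ᶠ z in 𝓝 w, IsUnit (1 + (z - w) • R) := by
    have h1 : ContinuousAt (fun z : ℂ => (1 : H →L[ℂ] H) + (z - w) • R) w := by fun_prop
    have h2 : {x : H →L[ℂ] H | IsUnit x} ∈ 𝓝 ((1 : H →L[ℂ] H) + (w - w) • R) := by
      refine Units.isOpen.mem_nhds ?_
      simp
    exact h1 h2
  have heq : ∀ᶠ z in 𝓝[(spec A)ᶜ] w,
      resolventOp A z = R * Ring.inverse (1 + (z - w) • R) := by
    filter_upwards [nhdsWithin_le_nhds hunit, self_mem_nhdsWithin] with z hz hzs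
    have h1 := (isResolventAt_resolventOp hzs).sub_eq hR
    have h2 : R = resolventOp A z * (1 + (z - w) • R) := by
      rw [mul_add, mul_one, mul_smul_comm]; exact h1
    rw [Ring.eq_mul_inverse_iff_mul_eq _ _ _ hz]
    exact h2.symm
  refine (hcont.continuousWithinAt.congr_of_eventuallyEq heq ?_)
  simp [R]

/-! ### Characters of the commutative algebra generated by the semigroup -/

/-- The bicommutant of the semigroup. -/
def semigroupAlgebra (S : ℝ → H →L[ℂ] H) : Subalgebra ℂ (H →L[ℂ] H) := bicommutant (S '' Ici 0)

theorem mem_semigroupAlgebra {a : H →L[ℂ] H} : a ∈ semigroupAlgebra S ↔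
    ∀ T : H →L[ℂ] H, (∀ t, 0 ≤ t → S t * T = T * S t) → T * a = a * T := by
  rw [semigroupAlgebra, mem_bicommutant]
  simp only [forall_mem_image, mem_Ici]

theorem semigroup_mem_semigroupAlgebra {t : ℝ} (ht : 0 ≤ t) : S t ∈ semigroupAlgebra S :=
  mem_semigroupAlgebra.2 fun _ hT => (hT t ht).symm

theorem IsC0Semigroup.forall_image_commute (hS : IsC0Semigroup S) :
    ∀ x ∈ S '' Ici 0, ∀ y ∈ S '' Ici 0, x * y = y * x := by
  rintro _ ⟨s, hs, rfl⟩ _ ⟨t, ht, rfl⟩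
  exact hS.commute hs ht

theorem IsC0Semigroup.commute_of_mem (hS : IsC0Semigroup S) {a b : H →L[ℂ] H}
    (ha : a ∈ semigroupAlgebra S) (hb : b ∈ semigroupAlgebra S) : a * b = b * a :=
  commute_of_mem_bicommutant hS.forall_image_commute ha hb

theorem resolventOp_mem_semigroupAlgebra (hA : IsGenerator A S) {z : ℂ} (hz : z ∉ spec A) :
    resolventOp A z ∈ semigroupAlgebra S :=
  mem_semigroupAlgebra.2 fun _ hT => (isResolventAt_resolventOp hz).commute hA hT

variable [CompleteSpace H]

/-- The character `χ` restricts to evaluation at the spectral value `l` on the resolvents. -/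
def IsCharacterAt (A : H →ₗ.[ℂ] H) (χ : (H →L[ℂ] H) →L[ℂ] ℂ) (l : ℂ) : Prop :=
  ∀ z ∉ spec A, χ (resolventOp A z) * (z - l) = 1

theorem IsCharacterAt.mem_spec {χ : (H →L[ℂ] H) →L[ℂ] ℂ} {l : ℂ} (h : IsCharacterAt A χ l) :
    l ∈ spec A := by
  by_contra hl
  simpa using h l hl

/-- The function `t ↦ χ (S t)` is multiplicative and differentiable, hence satisfies `f' = l f` with
`l = χ (S' 1) / χ (S 1)`. Applying `χ` to `S 1 = z S(1) R(z) - S'(1) R(z)` and dividing by `χ (S 1)`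
places `χ` at `l`. -/
theorem exists_isCharacterAt_of_ne_zero (hS : IsC0Semigroup S) (hA : IsGenerator A S)
    (hd : IsDifferentiableSemigroup S S') {χ : (H →L[ℂ] H) →L[ℂ] ℂ}
    (hχ : IsCharacterOn (semigroupAlgebra S) χ) (h1 : χ (S 1) ≠ 0) :
    ∃ l : ℂ, IsCharacterAt A χ l ∧ χ (S 1) = Complex.exp l := by
  have hadd : ∀ s t : ℝ, 0 ≤ s → 0 ≤ t → χ (S (s + t)) = χ (S s) * χ (S t) := fun s t hs ht => by
    rw [hS.add s t hs ht]
    exact hχ.map_mul _ (semigroup_mem_semigroupAlgebra hs) _ (semigroup_mem_semigroupAlgebra ht)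
  have hder : ∀ t, 0 < t → HasDerivAt (fun t => χ (S t)) (χ (S' t)) t := fun t ht =>
    (χ.restrictScalars ℝ).hasFDerivAt.comp_hasDerivAt t (hd.hasDerivAt t ht)
  set l := χ (S' 1) / χ (S 1)
  have hl : ∀ t, 0 < t → χ (S' t) = l * χ (S t) := by
    intro t ht
    have e1 : HasDerivAt (fun r => χ (S (1 + r))) (χ (S' (1 + t))) t :=
      (hder (1 + t) (by linarith)).comp_const_add 1 t
    have e2 : HasDerivAt (fun r => χ (S (1 + r))) (χ (S 1) * χ (S' t)) t := by
      refine ((hder t ht).const_mul (χ (S 1))).congr_of_eventuallyEq ?_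
      filter_upwards [lt_mem_nhds ht] with r hr using hadd 1 r zero_le_one (le_of_lt hr)
    have e3 : HasDerivAt (fun r => χ (S (r + t))) (χ (S' (1 + t))) 1 :=
      (hder (1 + t) (by linarith)).comp_add_const 1 t
    have e4 : HasDerivAt (fun r => χ (S (r + t))) (χ (S' 1) * χ (S t)) 1 := by
      refine ((hder 1 one_pos).mul_const (χ (S t))).congr_of_eventuallyEq ?_
      filter_upwards [lt_mem_nhds (one_pos : (0 : ℝ) < 1)] with r hr
        using hadd r t (le_of_lt hr) ht.le
    have e5 : χ (S 1) * χ (S' t) = χ (S' 1) * χ (S t) := (e1.unique e2).symm.trans (e3.unique e4)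
    simp only [l]
    field_simp
    rw [mul_comm, e5]
  refine ⟨l, ?_, ?_⟩
  · intro z hz
    have hR := isResolventAt_resolventOp hz
    set R := resolventOp A z
    have e1 : S 1 = z • (S 1 * R) - S' 1 * R := by
      ext f
      have := hd.deriv_apply hS hA one_pos (hR.mem_graph f)
      simp [this, map_sub]
    have hRm : R ∈ semigroupAlgebra S := resolventOp_mem_semigroupAlgebra hA hz
    -- Multiplicativity passes to `S' 1` by differentiating `χ (S t * R)`, so membership of `S' 1`
    -- in the algebra is not needed.
    have e2 : χ (S' 1 * R) = χ (S' 1) * χ R := by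
      have d1 : HasDerivAt (fun t => χ (S t * R)) (χ (S' 1 * R)) 1 :=
        (χ.restrictScalars ℝ).hasFDerivAt.comp_hasDerivAt 1
          ((hd.hasDerivAt 1 one_pos).mul_const R)
      refine d1.unique (((hder 1 one_pos).mul_const (χ R)).congr_of_eventuallyEq ?_)
      filter_upwards [lt_mem_nhds (one_pos : (0 : ℝ) < 1)] with r hr
      exact hχ.map_mul _ (semigroup_mem_semigroupAlgebra (le_of_lt hr)) _ hRm
    have e3 := congrArg χ e1
    rw [map_sub, map_smul, hχ.map_mul _ (semigroup_mem_semigroupAlgebra zero_le_one) _ hRm, e2,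
      hl 1 one_pos, smul_eq_mul] at e3
    apply mul_left_cancel₀ h1
    linear_combination -e3
  -- `S` need not be norm continuous at 0, so no limit `t → 0` is available under `χ`. Instead the
  -- constant function is compared at times 1 and 2, using `χ (S 2) = χ (S 1)²`.
  · have hconst : ∀ t ∈ Ioi (0 : ℝ), HasDerivAt
        (fun t : ℝ => χ (S t) * Complex.exp (-(l * t))) 0 t := by
      intro t ht
      have d1 : HasDerivAt (fun t : ℝ => Complex.exp (-(l * t)))
          (Complex.exp (-(l * t)) * (-(l * 1))) t :=
        (((hasDerivAt_id t).ofReal_comp.const_mul l).neg).cexp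
      refine ((hder t ht).mul d1).congr_deriv ?_
      rw [hl t ht]; ring
    have h12 : χ (S 1) * Complex.exp (-(l * (1 : ℝ))) = χ (S 2) * Complex.exp (-(l * (2 : ℝ))) :=
      (convex_Ioi (0 : ℝ)).is_const_of_fderivWithin_eq_zero (𝕜 := ℝ)
        (f := fun t : ℝ => χ (S t) * Complex.exp (-(l * t)))
        (fun t ht => (hconst t ht).differentiableAt.differentiableWithinAt)
        (fun t ht => by
          rw [fderivWithin_of_isOpen isOpen_Ioi ht]
          ext
          simpa using (hconst t ht).deriv)
        (mem_Ioi.2 one_pos) (mem_Ioi.2 two_pos)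
    have h2 : χ (S 2) = χ (S 1) * χ (S 1) := by
      rw [← hadd 1 1 zero_le_one zero_le_one]; norm_num
    rw [h2, mul_assoc] at h12
    have h3 := mul_left_cancel₀ h1 h12
    have h4 : Complex.exp (-(l * (2 : ℝ))) =
        Complex.exp (-(l * (1 : ℝ))) * Complex.exp (-l) := by
      rw [← Complex.exp_add]; congr 1; push_cast; ring
    rw [h4, mul_left_comm (χ (S 1))] at h3
    have h5 : χ (S 1) * Complex.exp (-l) = 1 :=
      mul_left_cancel₀ (Complex.exp_ne_zero (-(l * (1 : ℝ)))) (by rw [← h3, mul_one])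
    rw [Complex.exp_neg] at h5
    field_simp at h5
    exact h5

/-- One nonzero value `χ (R(w))` determines all others through the resolvent identity, with `l = w -
1 / χ (R(w))`. -/
theorem resolvent_character_dichotomy (hA : IsGenerator A S) {χ : (H →L[ℂ] H) →L[ℂ] ℂ}
    (hχ : IsCharacterOn (semigroupAlgebra S) χ) :
    (∀ z ∉ spec A, χ (resolventOp A z) = 0) ∨ ∃ l, IsCharacterAt A χ l := by
  by_contra! hcon
  obtain ⟨⟨w, hw, hw0⟩, h2⟩ := hcon
  refine h2 (w - (χ (resolventOp A w))⁻¹) fun z hz => ?_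
  have h1 := congrArg χ ((isResolventAt_resolventOp hz).sub_eq (isResolventAt_resolventOp hw))
  rw [map_add, map_smul, hχ.map_mul _ (resolventOp_mem_semigroupAlgebra hA hz) _
    (resolventOp_mem_semigroupAlgebra hA hw), smul_eq_mul] at h1
  field_simp
  linear_combination -h1

/-- Exponential bounds from characters. -/
theorem exists_norm_le_exp_of_character_lt (hS : IsC0Semigroup S) {Q : H →L[ℂ] H}
    (hQ : Q ∈ semigroupAlgebra S) (hQQ : Q * Q = Q) {w : ℝ}
    (h : ∀ χ, IsCharacterOn (semigroupAlgebra S) χ → χ Q ≠ 0 → ‖χ (S 1)‖ < Real.exp w) :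
    ∃ C > 0, ∃ a < w, ∀ t : ℝ, 0 ≤ t → ‖S t * Q‖ ≤ C * Real.exp (a * t) := by
  have h1m : S 1 ∈ semigroupAlgebra S := semigroup_mem_semigroupAlgebra zero_le_one
  obtain ⟨C, hC, ρ, hρ, hρw, hb⟩ := exists_norm_pow_le_of_spectrum_lt (S 1 * Q)
    (Real.exp_pos w) (fun z hz => by
      obtain ⟨χ, hχ, rfl⟩ := exists_isCharacterOn_of_mem_spectrum hS.forall_image_commute
        (mul_mem h1m hQ) hz
      rw [hχ.map_mul _ h1m _ hQ]
      have hq : χ Q * χ Q = χ Q := by rw [← hχ.map_mul _ hQ _ hQ, hQQ]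
      by_cases h0 : χ Q = 0
      · simp [h0, Real.exp_pos]
      · have : χ Q = 1 := mul_left_cancel₀ h0 (by rw [hq, mul_one])
        rw [this, mul_one]
        exact h χ hχ h0)
  -- The trailing `Q` is for `n = 0`, where the power on the right is 1.
  have hpow : ∀ n : ℕ, S n * Q = (S 1 * Q) ^ n * Q := by
    intro n
    have hQn : Q ^ n * Q = Q := by
      induction n with
      | zero => simp
      | succ n ih => rw [pow_succ, mul_assoc, hQQ, ih]
    have hcomm : Commute (S 1) Q := hS.commute_of_mem h1m hQ
    have := hS.natCast_mul zero_le_one n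
    rw [mul_one] at this
    rw [hcomm.mul_pow, this, mul_assoc, hQn]
  obtain ⟨C', hC', hb'⟩ := hS.exists_norm_mul_le_exp (Q := Q) (C := C * ‖Q‖) hρ (fun n => by
    rw [hpow]
    refine (norm_mul_le _ _).trans ?_
    calc _ ≤ (C * ρ ^ n) * ‖Q‖ := by gcongr; exact hb n
      _ = _ := by ring)
  exact ⟨C', hC', Real.log ρ, (Real.log_lt_iff_lt_exp hρ).2 hρw, hb'⟩

/-- The growth bound of the semigroup is smaller than every strict bound of the spectrum. -/
theorem exists_norm_le_exp_of_spec_lt (hS : IsC0Semigroup S) (hA : IsGenerator A S)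
    (hd : IsDifferentiableSemigroup S S') {w : ℝ} (hw : ∀ l ∈ spec A, l.re < w) :
    ∃ C > 0, ∃ a < w, ∀ t : ℝ, 0 ≤ t → ‖S t‖ ≤ C * Real.exp (a * t) := by
  have := exists_norm_le_exp_of_character_lt hS (one_mem (semigroupAlgebra S)) (mul_one 1) (w := w)
    (fun χ hχ _ => by
      by_cases h0 : χ (S 1) = 0
      · simp [h0, Real.exp_pos]
      · obtain ⟨l, hl, he⟩ := exists_isCharacterAt_of_ne_zero hS hA hd hχ h0
        rw [he, Complex.norm_exp]
        exact Real.exp_lt_exp.2 (hw l hl.mem_spec))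
  simpa only [mul_one] using this

/-! ### Eigenvectors -/

omit [CompleteSpace H] in
theorem eq_exp_smul_of_hasDerivAt {G : ℝ → H} {c : ℂ} {x : H}
    (hG : ∀ t, 0 < t → HasDerivAt G (c • G t) t) (h0 : Tendsto G (𝓝[>] 0) (𝓝 x)) {t : ℝ}
    (ht : 0 < t) : G t = Complex.exp (c * t) • x := by
  have hconst : ∀ t ∈ Ioi (0 : ℝ), HasDerivAt
      (fun t : ℝ => Complex.exp (-(c * t)) • G t) 0 t := by
    intro t ht
    have d1 : HasDerivAt (fun t : ℝ => Complex.exp (-(c * t)))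
        (Complex.exp (-(c * t)) * (-(c * 1))) t :=
      (((hasDerivAt_id t).ofReal_comp.const_mul c).neg).cexp
    refine (d1.smul (hG t ht)).congr_deriv ?_
    rw [smul_smul, ← add_smul]
    convert! zero_smul ℂ (G t) using 2
    ring
  have hc : ∀ s ∈ Ioi (0 : ℝ), Complex.exp (-(c * t)) • G t = Complex.exp (-(c * s)) • G s :=
    fun s hs => (convex_Ioi (0 : ℝ)).is_const_of_fderivWithin_eq_zero (𝕜 := ℝ)
      (f := fun t : ℝ => Complex.exp (-(c * t)) • G t)
      (fun t ht => (hconst t ht).differentiableAt.differentiableWithinAt)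
      (fun t ht => by
        rw [fderivWithin_of_isOpen isOpen_Ioi ht]
        ext
        simpa using (hconst t ht).deriv) (mem_Ioi.2 ht) hs
  have hlim : Tendsto (fun s : ℝ => Complex.exp (-(c * s)) • G s) (𝓝[>] 0) (𝓝 x) := by
    have : Tendsto (fun s : ℝ => Complex.exp (-(c * s))) (𝓝[>] 0) (𝓝 1) := by
      have h : Continuous fun s : ℝ => Complex.exp (-(c * s)) := by fun_prop
      simpa using (h.tendsto 0).mono_left (nhdsWithin_le_nhds (s := Ioi (0 : ℝ)))
    simpa using this.smul h0
  have hx : Complex.exp (-(c * t)) • G t = x :=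
    tendsto_nhds_unique (tendsto_const_nhds.congr' (by
      filter_upwards [self_mem_nhdsWithin] with s hs using hc s hs)) hlim
  rw [← hx, smul_smul, ← Complex.exp_add, add_neg_cancel, Complex.exp_zero, one_smul]

theorem IsDifferentiableSemigroup.apply_eigenvector (hS : IsC0Semigroup S) (hA : IsGenerator A S)
    (hd : IsDifferentiableSemigroup S S') {x : H} {l : ℂ} (h : (x, l • x) ∈ A.graph) {t : ℝ}
    (ht : 0 < t) : S t x = Complex.exp (l * t) • x := by
  refine eq_exp_smul_of_hasDerivAt (G := fun t => S t x) (fun t ht => ?_)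
    (hS.tendsto_apply_zero x) ht
  have h1 : HasDerivAt (fun s => S s x) (S' t x) t :=
    ((ContinuousLinearMap.apply ℂ H x).restrictScalars ℝ).hasFDerivAt.comp_hasDerivAt t
      (hd.hasDerivAt t ht)
  rwa [hd.deriv_apply hS hA ht h, map_smul] at h1

omit [CompleteSpace H] in
theorem HasDerivAt.adjoint_clm [CompleteSpace H] {G : ℝ → H →L[ℂ] H} {G' : H →L[ℂ] H} {t : ℝ}
    (h : HasDerivAt G G' t) : HasDerivAt (fun t => ContinuousLinearMap.adjoint (G t))
      (ContinuousLinearMap.adjoint G') t := by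
  let Φ : (H →L[ℂ] H) →L[ℝ] (H →L[ℂ] H) :=
    { toFun := fun T => ContinuousLinearMap.adjoint T
      map_add' := fun x y => map_add _ x y
      map_smul' := fun r x => by
        rw [RCLike.real_smul_eq_coe_smul (K := ℂ), map_smulₛₗ]
        simp
      cont := continuous_adjoint_clm }
  exact Φ.hasFDerivAt.comp_hasDerivAt t h

open ContinuousLinearMap in
theorem IsDifferentiableSemigroup.hasDerivAt_adjoint_apply (hd : IsDifferentiableSemigroup S S')
    {t : ℝ} (ht : 0 < t) (e : H) :
    HasDerivAt (fun t => adjoint (S t) e) (adjoint (S' t) e) t :=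
  ((ContinuousLinearMap.apply ℂ H e).restrictScalars ℝ).hasFDerivAt.comp_hasDerivAt t
    (HasDerivAt.adjoint_clm (hd.hasDerivAt t ht))

open ContinuousLinearMap in
theorem IsDifferentiableSemigroup.adjoint_apply_eigenvector (hS : IsC0Semigroup S)
    (hA : IsGenerator A S) (hd : IsDifferentiableSemigroup S S') {e : H} {c : ℂ}
    (h : (e, c • e) ∈ A.adjoint.graph) {t : ℝ} (ht : 0 < t) :
    adjoint (S t) e = Complex.exp (c * t) • e := by
  refine eq_exp_smul_of_hasDerivAt (G := fun t => adjoint (S t) e) (fun t ht => ?_)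
    (hd.tendsto_adjoint_apply_zero hS e) ht
  have h1 := hd.hasDerivAt_adjoint_apply ht e
  rwa [hd.adjoint_deriv_apply hS hA ht h, map_smul] at h1

theorem mem_eigenspace_iff {T : H →ₗ.[ℂ] H} {c : ℂ} {x : GraphDom T} :
    x ∈ eigenspace T c ↔ x.1.2 = c • x.1.1 := by
  rw [eigenspace, LinearMap.mem_ker]
  simp [sub_eq_zero]

theorem HypH1.exists_eigenvector (h1 : HypH1 A) {l : ℂ} (hl : l ∈ spec A) :
    ∃ x : H, x ≠ 0 ∧ (x, l • x) ∈ A.graph := by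
  obtain ⟨u, hu, hu0⟩ := Submodule.exists_mem_ne_zero_of_ne_bot (h1 l hl).1
  rw [mem_eigenspace_iff] at hu
  refine ⟨u.1.1, fun h => hu0 ?_, ?_⟩
  · ext
    · exact h
    · rw [hu, h, smul_zero]; rfl
  · rw [← hu]; exact u.2

/-- For an unstable eigenvalue `l` and `h = π / |Im l|` the number `e^{l h}` is negative, so `‖S(1 +
h) - S(1)‖ ≥ |e^l| |e^{l h} - 1| ≥ e^{-σ}`. Norm continuity of `S` at 1 keeps `h` away from 0, hence
bounds `Im l`. The unstable spectrum then lies in a compact rectangle, and (H6) forbids an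
accumulation point. -/
theorem finite_unstableSpec (hS : IsC0Semigroup S) (hA : IsGenerator A S)
    (hd : IsDifferentiableSemigroup S S') {w : ℝ} (hw : ∀ l ∈ spec A, l.re < w)
    (h1 : HypH1 A) (h6 : HypH6 A) (σ : ℝ) : (unstableSpec A σ).Finite := by
  have hc : ContinuousAt S 1 := (hd.hasDerivAt 1 one_pos).continuousAt
  obtain ⟨δ, hδ, hδ'⟩ := Metric.continuousAt_iff.1 hc (Real.exp (-σ)) (Real.exp_pos _)
  have hπ := Real.pi_pos
  have him : ∀ l ∈ unstableSpec A σ, |l.im| ≤ Real.pi / δ := by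
    rintro l ⟨hl, hlσ⟩
    by_contra! hcon
    have hpos : 0 < |l.im| := lt_trans (by positivity) hcon
    obtain ⟨x, hx0, hx⟩ := h1.exists_eigenvector hl
    set h := Real.pi / |l.im| with hh
    have hh0 : 0 < h := by positivity
    have hhδ : h < δ := by
      rw [hh, div_lt_iff₀ hpos, mul_comm]
      rwa [div_lt_iff₀ hδ] at hcon
    have e1 := hδ' (x := 1 + h) (by simpa [abs_of_pos hh0] using hhδ)
    have e2 : S (1 + h) x - S 1 x = (Complex.exp l * (Complex.exp (l * h) - 1)) • x := by
      rw [hd.apply_eigenvector hS hA hx one_pos, hd.apply_eigenvector hS hA hx (by linarith),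
        ← sub_smul]
      congr 1
      rw [mul_sub, ← Complex.exp_add]
      push_cast
      ring_nf
    have e3 : ‖Complex.exp l * (Complex.exp (l * h) - 1)‖ ≤ ‖S (1 + h) - S 1‖ := by
      have := (S (1 + h) - S 1).le_opNorm x
      rw [sub_apply, e2, norm_smul] at this
      exact le_of_mul_le_mul_right this (norm_pos_iff.2 hx0)
    have hcos : Real.cos (l.im * h) = -1 := by
      rcases abs_cases l.im with ⟨ha, _⟩ | ⟨ha, _⟩
      · rw [hh, ha]
        have : l.im ≠ 0 := by rw [← ha]; exact hpos.ne'
        field_simp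
        exact Real.cos_pi
      · rw [hh, ha]
        have : l.im ≠ 0 := by intro h0; rw [h0] at hpos; simp at hpos
        rw [show l.im * (Real.pi / -l.im) = -Real.pi by field_simp, Real.cos_neg]
        exact Real.cos_pi
    have e4 : 1 ≤ ‖Complex.exp (l * h) - 1‖ := by
      refine le_trans ?_ (Complex.abs_re_le_norm _)
      rw [Complex.sub_re, Complex.exp_re]
      simp only [Complex.mul_re, Complex.mul_im, Complex.ofReal_re, Complex.ofReal_im, mul_zero,
        sub_zero, zero_add, Complex.one_re]
      rw [hcos, abs_of_neg (by nlinarith [Real.exp_pos (l.re * h)])]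
      nlinarith [Real.exp_pos (l.re * h)]
    have e5 : Real.exp (-σ) ≤ ‖Complex.exp l‖ := by
      rw [Complex.norm_exp]; exact Real.exp_le_exp.2 hlσ
    rw [norm_mul] at e3
    rw [dist_eq_norm] at e1
    nlinarith [Real.exp_pos (-σ), norm_nonneg (Complex.exp l)]
  by_contra hinf
  have hsub : unstableSpec A σ ⊆ Icc (-σ) w ×ℂ Icc (-(Real.pi / δ)) (Real.pi / δ) := by
    intro l hl
    rw [Complex.mem_reProdIm]
    exact ⟨⟨hl.2, (hw l hl.1).le⟩, abs_le.1 (him l hl)⟩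
  obtain ⟨z, -, hz⟩ := Set.Infinite.exists_accPt_of_subset_isCompact hinf
    (isCompact_Icc.reProdIm isCompact_Icc) hsub
  exact h6 z (hz.mono (principal_mono.2 fun l hl => hl.1))

end Spectral

section Splitting

variable {H : Type*} [NormedAddCommGroup H] [InnerProductSpace ℂ H] [CompleteSpace H]
variable {A : H →ₗ.[ℂ] H} {S S' : ℝ → H →L[ℂ] H}

/-! ### Riesz projections -/

/-- The circle of radius `δ` about the spectral point `l` isolates `l`. -/
def Isolates (A : H →ₗ.[ℂ] H) (l : ℂ) (δ : ℝ) : Prop :=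
  0 < δ ∧ ∀ z ∈ spec A, z ≠ l → δ < dist z l

theorem Isolates.sphere_subset {l : ℂ} {δ : ℝ} (h : Isolates A l δ) :
    Metric.sphere l δ ⊆ (spec A)ᶜ := by
  intro z hz hzs
  rw [Metric.mem_sphere] at hz
  have hne : z ≠ l := by
    rintro rfl
    rw [dist_self] at hz
    exact h.1.ne hz
  exact absurd hz (h.2 z hzs hne).ne'

theorem Isolates.map_rieszProj {l : ℂ} {δ : ℝ} (h : Isolates A l δ) {F : Type*}
    [NormedAddCommGroup F] [NormedSpace ℂ F] [CompleteSpace F] (Φ : (H →L[ℂ] H) →L[ℂ] F) :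
    Φ (rieszProj A l δ) =
      (2 * (Real.pi : ℂ) * Complex.I)⁻¹ • ∮ z in C(l, δ), Φ (resolventOp A z) := by
  have hci : CircleIntegrable (resolventOp A) l δ :=
    (continuousOn_resolventOp.mono h.sphere_subset).circleIntegrable h.1.le
  rw [rieszProj, map_smul, circleIntegral, circleIntegral,
    ← Φ.intervalIntegral_comp_comm hci.out]
  simp only [map_smul]

theorem Isolates.rieszProj_mem (hA : IsGenerator A S) {l : ℂ} {δ : ℝ} (h : Isolates A l δ) :
    rieszProj A l δ ∈ semigroupAlgebra S := by
  rw [mem_semigroupAlgebra]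
  intro T hT
  let Φ : (H →L[ℂ] H) →L[ℂ] (H →L[ℂ] H) :=
    ContinuousLinearMap.mul ℂ _ T - (ContinuousLinearMap.mul ℂ _).flip T
  have h1 := h.map_rieszProj Φ
  have h2 : (∮ z in C(l, δ), Φ (resolventOp A z)) = ∮ z in C(l, δ), 0 := by
    refine circleIntegral.integral_congr h.1.le fun z hz => ?_
    have := mem_semigroupAlgebra.1 (resolventOp_mem_semigroupAlgebra hA (h.sphere_subset hz)) T hT
    simp [Φ, this]
  rw [h2] at h1
  have h3 : Φ (rieszProj A l δ) = 0 := by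
    rw [h1]
    simp [circleIntegral]
  simpa [Φ, sub_eq_zero] using h3

theorem Isolates.character_rieszProj_of_forall_eq_zero {l : ℂ} {δ : ℝ} (h : Isolates A l δ)
    {χ : (H →L[ℂ] H) →L[ℂ] ℂ} (h0 : ∀ z ∉ spec A, χ (resolventOp A z) = 0) :
    χ (rieszProj A l δ) = 0 := by
  have h2 : (∮ z in C(l, δ), χ (resolventOp A z)) = ∮ z in C(l, δ), 0 :=
    circleIntegral.integral_congr h.1.le fun z hz => h0 z (h.sphere_subset hz)
  rw [h.map_rieszProj χ, h2]
  simp [circleIntegral]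

/-- Under `χ` the resolvent becomes `(z - m)⁻¹`, and Cauchy's formula decides according to whether
`m` is the centre; every other spectral value lies outside the closed disc. -/
theorem Isolates.character_rieszProj {l : ℂ} {δ : ℝ} (h : Isolates A l δ)
    {χ : (H →L[ℂ] H) →L[ℂ] ℂ} {m : ℂ} (hm : IsCharacterAt A χ m) :
    χ (rieszProj A l δ) = if m = l then 1 else 0 := by
  have h2 : (∮ z in C(l, δ), χ (resolventOp A z)) = ∮ z in C(l, δ), (z - m)⁻¹ :=
    circleIntegral.integral_congr h.1.le fun z hz =>
      eq_inv_of_mul_eq_one_left (hm z (h.sphere_subset hz))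
  rw [h.map_rieszProj χ, h2]
  split_ifs with hml
  · rw [hml, circleIntegral.integral_sub_inv_of_mem_ball (Metric.mem_ball_self h.1), smul_eq_mul]
    exact inv_mul_cancel₀ Complex.two_pi_I_ne_zero
  · have hdist := h.2 m hm.mem_spec hml
    rw [Complex.circleIntegral_eq_zero_of_differentiable_on_off_countable h.1.le countable_empty
      (f := fun z => (z - m)⁻¹), smul_zero]
    · intro z hz
      have hne : z - m ≠ 0 := by
        rw [sub_ne_zero]
        rintro rfl
        exact absurd (Metric.mem_closedBall.1 hz) (not_le.2 hdist)
      exact ((continuousAt_id.sub continuousAt_const).inv₀ hne).continuousWithinAt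
    · rintro z ⟨hz, -⟩
      have hne : z - m ≠ 0 := by
        rw [sub_ne_zero]
        rintro rfl
        exact absurd (Metric.mem_ball.1 hz).le (not_le.2 hdist)
      exact (differentiableAt_id.sub_const m).inv hne

/-! ### The spectral projection of the unstable part -/

theorem finiteDimensional_range_of_comp {f g : H →L[ℂ] H} (h : FiniteDimensional ℂ f.range) :
    FiniteDimensional ℂ (f * g).range := by
  refine Submodule.finiteDimensional_of_le (S₂ := f.range) ?_
  rintro _ ⟨x, rfl⟩
  exact ⟨g x, rfl⟩

theorem finiteDimensional_range_sum {ι : Type*} (s : Finset ι) (f : ι → H →L[ℂ] H)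
    (h : ∀ i ∈ s, FiniteDimensional ℂ (f i).range) :
    FiniteDimensional ℂ (∑ i ∈ s, f i).range := by
  classical
  induction s using Finset.induction_on with
  | empty =>
    rw [Finset.sum_empty]
    refine Submodule.finiteDimensional_of_le (S₂ := ⊥) ?_
    rintro _ ⟨x, rfl⟩
    simp
  | insert i s hi ih =>
    rw [Finset.sum_insert hi]
    have := h i (Finset.mem_insert_self _ _)
    have := ih fun j hj => h j (Finset.mem_insert_of_mem hj)
    refine Submodule.finiteDimensional_of_le (S₂ := (f i).range ⊔ (∑ i ∈ s, f i).range) ?_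
    rintro _ ⟨x, rfl⟩
    exact Submodule.add_mem_sup ⟨x, rfl⟩ ⟨x, rfl⟩

/-- The spectral projection associated with the spectral values of real part at least `-σ`. -/
structure IsUnstableProjection (A : H →ₗ.[ℂ] H) (S : ℝ → H →L[ℂ] H) (σ : ℝ) (E : H →L[ℂ] H) :
    Prop where
  mem : E ∈ semigroupAlgebra S
  idem : E * E = E
  finite : FiniteDimensional ℂ E.range
  character : ∀ χ, IsCharacterOn (semigroupAlgebra S) χ →
    (χ E = 0 ∧ ∀ l, IsCharacterAt A χ l → l.re < -σ) ∨
    (χ E = 1 ∧ ∃ l, IsCharacterAt A χ l ∧ -σ ≤ l.re)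

/-- Idempotency of the sum `P` of Riesz projections is not proved by a double contour integral.
Characters show that `P` is idempotent modulo a nilpotent element, and a polynomial in `P` without
constant term corrects this while keeping finite rank and character values. -/
theorem exists_isUnstableProjection (hS : IsC0Semigroup S) (hA : IsGenerator A S)
    (hd : IsDifferentiableSemigroup S S') {w : ℝ} (hw : ∀ l ∈ spec A, l.re < w)
    (h1 : HypH1 A) (h6 : HypH6 A) (σ : ℝ) : ∃ E, IsUnstableProjection A S σ E := by
  have hfin := finite_unstableSpec hS hA hd hw h1 h6 σ
  have h1' : ∀ l ∈ spec A, ∃ δ : ℝ, Isolates A l δ ∧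
      FiniteDimensional ℂ (rieszProj A l δ).range := fun l hl => by
    obtain ⟨-, δ, h0, h2, h3⟩ := h1 l hl
    exact ⟨δ, ⟨h0, h2⟩, h3⟩
  choose! δ hδ hδf using h1'
  set s := hfin.toFinset
  have hs : ∀ l, l ∈ s ↔ l ∈ spec A ∧ -σ ≤ l.re := fun l => hfin.mem_toFinset
  set P : H →L[ℂ] H := ∑ l ∈ s, rieszProj A l (δ l) with hP
  have hPm : P ∈ semigroupAlgebra S :=
    sum_mem fun l hl => (hδ l ((hs l).1 hl).1).rieszProj_mem hA
  have hPf : FiniteDimensional ℂ P.range :=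
    finiteDimensional_range_sum s _ fun l hl => hδf l ((hs l).1 hl).1
  have hχP : ∀ χ, IsCharacterOn (semigroupAlgebra S) χ →
      (χ P = 0 ∧ ∀ l, IsCharacterAt A χ l → l.re < -σ) ∨
      (χ P = 1 ∧ ∃ l, IsCharacterAt A χ l ∧ -σ ≤ l.re) := by
    intro χ hχ
    have hsum : χ P = ∑ l ∈ s, χ (rieszProj A l (δ l)) := by rw [hP, map_sum]
    by_cases hex : ∃ m, IsCharacterAt A χ m ∧ -σ ≤ m.re
    · obtain ⟨m, hm, hmσ⟩ := hex
      refine Or.inr ⟨?_, m, hm, hmσ⟩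
      rw [hsum, Finset.sum_congr rfl
        fun l hl => (hδ l ((hs l).1 hl).1).character_rieszProj hm, Finset.sum_ite_eq,
        if_pos ((hs m).2 ⟨hm.mem_spec, hmσ⟩)]
    · push Not at hex
      refine Or.inl ⟨?_, hex⟩
      rw [hsum]
      refine Finset.sum_eq_zero fun l hl => ?_
      rcases resolvent_character_dichotomy hA hχ with h0 | ⟨m, hm⟩
      · exact (hδ l ((hs l).1 hl).1).character_rieszProj_of_forall_eq_zero h0
      · rw [(hδ l ((hs l).1 hl).1).character_rieszProj hm, if_neg]
        rintro rfl
        exact absurd ((hs m).1 hl).2 (not_le.2 (hex m hm))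
  have hNm : P * (1 - P) ∈ semigroupAlgebra S := mul_mem hPm (sub_mem (one_mem _) hPm)
  -- Every character kills `P (1 - P)`, so `z - P (1 - P)` is invertible for `z ≠ 0`; finite rank
  -- upgrades quasinilpotent to nilpotent.
  obtain ⟨n, hn⟩ : ∃ n, (P * (1 - P)) ^ n = 0 := by
    have hf : FiniteDimensional ℂ (P * (1 - P)).range := finiteDimensional_range_of_comp hPf
    obtain ⟨n, hn⟩ := @isNilpotent_of_finiteDimensional_range H _ _
      (P * (1 - P)).toLinearMap hf (fun z x hx hz => by
        have hu : IsUnit (z • (1 : H →L[ℂ] H) - P * (1 - P)) := by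
          refine isUnit_of_forall_character_ne_zero hS.forall_image_commute
            (sub_mem (Subalgebra.smul_mem _ (one_mem _) z) hNm) fun χ hχ => ?_
          have : χ (P * (1 - P)) = 0 := by
            rw [hχ.map_mul _ hPm _ (sub_mem (one_mem _) hPm), map_sub, hχ.map_one]
            rcases hχP χ hχ with ⟨h, -⟩ | ⟨h, -⟩ <;> simp [h]
          rw [map_sub, map_smul, hχ.map_one, this]
          simpa using hz
        obtain ⟨u, hu⟩ := hu
        have h0 : (u : H →L[ℂ] H) x = 0 := by
          rw [hu]
          have hx' : (P * (1 - P)) x = z • x := hx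
          simp only [sub_apply, smul_apply, one_apply_eq_self, hx', sub_self]
        have h2 := congrArg (fun T : H →L[ℂ] H => T x) u.inv_mul
        have h3 : (↑u⁻¹ : H →L[ℂ] H) ((u : H →L[ℂ] H) x) = x := h2
        rw [← h3, h0, map_zero])
    refine ⟨n, ?_⟩
    ext x
    have hpow : ∀ k : ℕ, ((P * (1 - P)) ^ k) x = ((P * (1 - P)).toLinearMap ^ k) x := by
      intro k
      induction k generalizing x with
      | zero => rfl
      | succ k ih => rw [pow_succ, pow_succ]; exact ih _
    rw [hpow, hn]; rfl
  -- The exponent must be positive: then `1 - (1 - p ^ m) ^ m` fixes 0 and 1, which preserves the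
  -- character values, and a left factor `P` can be pulled out.
  have hn1 : (P * (1 - P)) ^ (n + 1) = 0 := by rw [pow_succ, hn, zero_mul]
  set m := n + 1 with hm
  refine ⟨1 - (1 - P ^ m) ^ m, ?_, isIdempotentElem_one_sub_one_sub_pow_pow P m hn1, ?_, ?_⟩
  · exact sub_mem (one_mem _) (pow_mem (sub_mem (one_mem _) (pow_mem hPm _)) _)
  · have : 1 - (1 - P ^ m) ^ m = P * (P ^ n * ∑ i ∈ Finset.range m, (1 - P ^ m) ^ i) := by
      rw [← mul_assoc, ← pow_succ', ← hm]
      have := mul_neg_geom_sum (1 - P ^ m) m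
      rw [sub_sub_cancel] at this
      exact this.symm
    rw [this]
    exact finiteDimensional_range_of_comp hPf
  · intro χ hχ
    have e : χ (1 - (1 - P ^ m) ^ m) = 1 - (1 - χ P ^ m) ^ m := by
      rw [map_sub, hχ.map_one, hχ.map_pow (sub_mem (one_mem _) (pow_mem hPm _)), map_sub,
        hχ.map_one, hχ.map_pow hPm]
    rw [e]
    rcases hχP χ hχ with ⟨h, h'⟩ | ⟨h, h'⟩
    · exact Or.inl ⟨by simp [h, hm], h'⟩
    · exact Or.inr ⟨by simp [h, hm], h'⟩

namespace IsUnstableProjection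

variable {σ : ℝ} {E : H →L[ℂ] H}

theorem commute (h : IsUnstableProjection A S σ E) (hS : IsC0Semigroup S) {t : ℝ} (ht : 0 ≤ t) :
    S t * E = E * S t :=
  hS.commute_of_mem (semigroup_mem_semigroupAlgebra ht) h.mem

/-- A character that does not kill `1 - E` either kills `S 1` or sits at a spectral value with `Re l
< -σ`. The spectral radius bound makes the rate strictly smaller than `-σ`. -/
theorem exists_decay (h : IsUnstableProjection A S σ E) (hS : IsC0Semigroup S)
    (hA : IsGenerator A S) (hd : IsDifferentiableSemigroup S S') :
    ∃ C > 0, ∃ a < -σ, ∀ t : ℝ, 0 ≤ t → ‖S t * (1 - E)‖ ≤ C * Real.exp (a * t) := by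
  refine exists_norm_le_exp_of_character_lt hS (sub_mem (one_mem _) h.mem) ?_ fun χ hχ h0 => ?_
  · rw [mul_sub, mul_one, sub_mul, one_mul, h.idem, sub_self, sub_zero]
  · rcases h.character χ hχ with ⟨-, h2⟩ | ⟨h1, -⟩
    · by_cases h3 : χ (S 1) = 0
      · simp [h3, Real.exp_pos]
      · obtain ⟨l, hl, he⟩ := exists_isCharacterAt_of_ne_zero hS hA hd hχ h3
        rw [he, Complex.norm_exp]
        exact Real.exp_lt_exp.2 (h2 l hl)
    · rw [map_sub, hχ.map_one, h1, sub_self] at h0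
      exact absurd rfl h0

/-- On the finite-dimensional range of `E` strong continuity is norm continuity, so `1 - E + S t *
E` is invertible for small `t` and `E` factors through `S t`; a power reaches time 1. Hence the
range of `E` lies in the domain of `A`, and characters with `χ E = 1` cannot kill `S 1`. -/
theorem exists_eq_mul (h : IsUnstableProjection A S σ E) (hS : IsC0Semigroup S) :
    ∃ W ∈ semigroupAlgebra S, E = S 1 * W := by
  have hfin := h.finite
  obtain ⟨t, ht0, hu⟩ : ∃ t > 0, IsUnit (1 - E + S t * E) := by
    have hc : ContinuousOn (fun t => (S t).comp E.range.subtypeL) (Ici 0) := by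
      rw [continuousOn_clm_apply]
      exact fun y => hS.continuousOn y
    have hc2 : ContinuousOn (fun t => 1 - E + S t * E) (Ici 0) := by
      have h1 : ContinuousOn (fun t => ((S t).comp E.range.subtypeL).comp
          (E.codRestrict E.range fun x => ⟨x, rfl⟩)) (Ici 0) := hc.clm_comp continuousOn_const
      exact continuousOn_const.add h1
    have h2 : {x : H →L[ℂ] H | IsUnit x} ∈ 𝓝 (1 - E + S 0 * E) := by
      refine Units.isOpen.mem_nhds ?_
      rw [hS.zero, one_mul, sub_add_cancel]
      exact isUnit_one
    have h3 : ∀ᶠ t in 𝓝[>] (0 : ℝ), IsUnit (1 - E + S t * E) :=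
      (hc2 0 self_mem_Ici).mono Ioi_subset_Ici_self h2
    obtain ⟨t, ht, ht'⟩ := (h3.and self_mem_nhdsWithin).exists
    exact ⟨t, ht', ht⟩
  obtain ⟨u, hu⟩ := hu
  have hum : (u : H →L[ℂ] H) ∈ semigroupAlgebra S := by
    rw [hu]
    exact add_mem (sub_mem (one_mem _) h.mem)
      (mul_mem (semigroup_mem_semigroupAlgebra ht0.le) h.mem)
  have hvm : (↑u⁻¹ : H →L[ℂ] H) ∈ semigroupAlgebra S := by
    rw [mem_semigroupAlgebra] at hum ⊢
    intro T hT
    exact (Commute.units_inv_right (hum T hT : Commute T u)).eq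
  have e1 : (u : H →L[ℂ] H) * E = S t * E := by
    rw [hu, add_mul, sub_mul, one_mul, mul_assoc, h.idem, sub_self, zero_add]
  have e2 : E = S t * (E * ↑u⁻¹) := by
    rw [← mul_assoc, ← e1, hS.commute_of_mem hum h.mem, mul_assoc, Units.mul_inv, mul_one]
  set W := E * (↑u⁻¹ : H →L[ℂ] H)
  have hW : W ∈ semigroupAlgebra S := mul_mem h.mem hvm
  -- With `k t > 1` one has `S(t)^k = S(1) S(k t - 1)`.
  obtain ⟨k, hk⟩ := exists_nat_gt (1 / t)
  have hkt : 1 < k * t := by rwa [div_lt_iff₀ ht0] at hk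
  have hk0 : k ≠ 0 := by
    rintro rfl
    simp at hkt
    linarith
  have hEk : E ^ k = E := by
    obtain ⟨j, rfl⟩ := Nat.exists_eq_succ_of_ne_zero hk0
    exact IsIdempotentElem.pow_succ_eq j h.idem
  refine ⟨S (k * t - 1) * W ^ k,
    mul_mem (semigroup_mem_semigroupAlgebra (by linarith)) (pow_mem hW _), ?_⟩
  have hcomm : Commute (S t) W := hS.commute_of_mem (semigroup_mem_semigroupAlgebra ht0.le) hW
  rw [← mul_assoc, ← hS.add 1 _ zero_le_one (by linarith), add_sub_cancel, hS.natCast_mul ht0.le,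
    ← hcomm.mul_pow, ← e2, hEk]

-- If `Re c < -σ`, then with `k = e^{conj c}` no character kills `(S 1 - k) E + (1 - E)`: where `χ E
-- = 1`, `|χ (S 1)| ≥ e^{-σ} > |k|`. So this operator is invertible, although its range is
-- orthogonal to `e`.
open ContinuousLinearMap in
theorem re_ge_of_adjoint_eigenvector (h : IsUnstableProjection A S σ E) (hS : IsC0Semigroup S)
    (hA : IsGenerator A S) (hd : IsDifferentiableSemigroup S S') {z : ℂ} (hz : z ∉ spec A) {e : H} {c : ℂ} (he0 : e ≠ 0)
    (he : (e, c • e) ∈ A.adjoint.graph) (hE : adjoint E e = e) : -σ ≤ c.re := by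
  by_contra! hc
  have h1m : S 1 ∈ semigroupAlgebra S := semigroup_mem_semigroupAlgebra zero_le_one
  set k := Complex.exp (starRingEnd ℂ c) with hk
  obtain ⟨W, hW, hEW⟩ := h.exists_eq_mul hS
  have hu : IsUnit ((S 1 - k • 1) * E + (1 - E)) := by
    have hm : S 1 - k • 1 ∈ semigroupAlgebra S :=
      sub_mem h1m (Subalgebra.smul_mem _ (one_mem _) k)
    refine isUnit_of_forall_character_ne_zero hS.forall_image_commute
      (add_mem (mul_mem hm h.mem) (sub_mem (one_mem _) h.mem)) fun χ hχ => ?_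
    rw [map_add, hχ.map_mul _ hm _ h.mem, map_sub, map_sub, map_smul, hχ.map_one]
    rcases h.character χ hχ with ⟨h1, -⟩ | ⟨h1, l, hl, hlσ⟩
    · simp [h1]
    · have hne : χ (S 1) ≠ 0 := by
        intro h0
        rw [hEW, hχ.map_mul _ h1m _ hW, h0, zero_mul] at h1
        exact zero_ne_one h1
      obtain ⟨l', hl', hexp⟩ := exists_isCharacterAt_of_ne_zero hS hA hd hχ hne
      have hlσ' : -σ ≤ l'.re := by
        rcases h.character χ hχ with ⟨h2, -⟩ | ⟨-, -⟩
        · rw [h1] at h2; exact absurd h2 one_ne_zero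
        -- Since the resolvent set contains `z`, two spectral values attached to the same character
        -- coincide.
        · by_contra! hlt
          have e1 := hl z hz
          have e2 := hl' z hz
          have e3 : χ (resolventOp A z) ≠ 0 := left_ne_zero_of_mul_eq_one e1
          have e4 : z - l = z - l' := mul_left_cancel₀ e3 (e1.trans e2.symm)
          have : l = l' := by linear_combination -e4
          rw [this] at hlσ
          linarith
      rw [h1, hexp, sub_self, add_zero, mul_one, smul_eq_mul, mul_one, sub_ne_zero]
      intro heq
      have := congrArg norm heq
      rw [hk, Complex.norm_exp, Complex.norm_exp, Complex.conj_re, Real.exp_eq_exp] at this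
      linarith
  obtain ⟨u, hu⟩ := hu
  have hS1 := hd.adjoint_apply_eigenvector hS hA he one_pos
  have key : ∀ y, inner ℂ e ((u : H →L[ℂ] H) y) = 0 := by
    intro y
    have i1 : inner ℂ e (E y) = inner ℂ e y := by rw [← adjoint_inner_left, hE]
    have i2 : inner ℂ e (S 1 (E y)) = k * inner ℂ e y := by
      rw [← adjoint_inner_left, hS1, inner_smul_left, i1, ← Complex.exp_conj]
      simp [hk]
    rw [hu]
    simp only [add_apply, sub_apply, mul_apply_eq_comp, smul_apply,
      one_apply_eq_self, inner_add_right, inner_sub_right, inner_smul_right, i1, i2]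
    ring
  have h2 := key ((↑u⁻¹ : H →L[ℂ] H) e)
  have h3 : (u : H →L[ℂ] H) ((↑u⁻¹ : H →L[ℂ] H) e) = e :=
    congrArg (fun T : H →L[ℂ] H => T e) u.mul_inv
  rw [h3, inner_self_eq_zero] at h2
  exact he0 h2

end IsUnstableProjection

/-! ### Splitting off the unstable subspace -/

/-- A splitting of the semigroup into an unstable part on a finite-dimensional subspace `X` of the
domain, with projection `L` and generator `M`, and a part with growth bound below `-σ`. -/
structure SpectralSplitting (A : H →ₗ.[ℂ] H) (S : ℝ → H →L[ℂ] H) (σ : ℝ) where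
  X : Submodule ℂ H
  finiteDimensional : FiniteDimensional ℂ X
  completeSpace : CompleteSpace X
  L : H →L[ℂ] X
  M : X →L[ℂ] X
  L_coe : ∀ x : X, L x = x
  mem_graph : ∀ x : X, ((x : H), (M x : H)) ∈ A.graph
  commute : ∀ t, 0 ≤ t → S t * X.subtypeL.comp L = X.subtypeL.comp L * S t
  decay : ∃ C > 0, ∃ a < -σ, ∀ t : ℝ, 0 ≤ t →
    ‖S t * (1 - X.subtypeL.comp L)‖ ≤ C * Real.exp (a * t)
  re_ge : ∀ (p : X) (c : ℂ), p ≠ 0 → ContinuousLinearMap.adjoint M p = c • p → -σ ≤ c.re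

attribute [instance] SpectralSplitting.finiteDimensional SpectralSplitting.completeSpace

namespace SpectralSplitting

variable {σ : ℝ} (D : SpectralSplitting A S σ)

/-- The projection of `H` onto the unstable subspace. -/
def proj : H →L[ℂ] H := D.X.subtypeL.comp D.L

theorem proj_apply (x : H) : D.proj x = D.L x := rfl

theorem L_apply_of_mem_graph (hA : IsGenerator A S) {x y : H} (h : (x, y) ∈ A.graph) :
    D.L y = D.M (D.L x) :=
  Subtype.ext (LinearPMap_graph_unique (hA.mem_graph_of_commute D.commute h) (D.mem_graph (D.L x)))

-- Dual form of `L A ⊆ M L`: the adjoint of `L` maps into the domain of `A*` and intertwines `M*`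
-- with `A*`. Through it, eigenvectors on `X` become eigenvectors of `A*`, and vectors of `X` become
-- test functions for the weak equation.
open ContinuousLinearMap in
theorem adjoint_L_mem_graph (hA : IsGenerator A S) (hdense : Dense (A.domain : Set H)) (p : D.X) :
    (adjoint D.L p, adjoint D.L (adjoint D.M p)) ∈ A.adjoint.graph := by
  rw [mem_adjoint_graph_iff hdense]
  intro x y h
  rw [adjoint_inner_left, adjoint_inner_left, adjoint_inner_left, D.L_apply_of_mem_graph hA h]

open ContinuousLinearMap in
theorem adjoint_L_injective : Function.Injective (adjoint D.L) := by
  rw [injective_iff_map_eq_zero]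
  intro p hp
  have : inner ℂ p p = 0 := by
    nth_rewrite 2 [← D.L_coe p]
    rw [← adjoint_inner_left, hp, inner_zero_left]
  exact inner_self_eq_zero.1 this

end SpectralSplitting

theorem exists_spectralSplitting (hS : IsC0Semigroup S) (hA : IsGenerator A S)
    (hd : IsDifferentiableSemigroup S S') {w : ℝ} (hw : ∀ l ∈ spec A, l.re < w)
    (h1 : HypH1 A) (h6 : HypH6 A) (σ : ℝ) : Nonempty (SpectralSplitting A S σ) := by
  obtain ⟨E, hE⟩ := exists_isUnstableProjection hS hA hd hw h1 h6 σ
  have hwz : (w : ℂ) ∉ spec A := fun h => absurd (hw _ h) (by simp)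
  obtain ⟨W, hW, hEW⟩ := hE.exists_eq_mul hS
  have hfin := hE.finite
  have hcomp : CompleteSpace E.range := FiniteDimensional.complete ℂ _
  have hfix : ∀ x : E.range, E x = x := by
    rintro ⟨_, y, rfl⟩
    exact congrArg (fun T : H →L[ℂ] H => T y) hE.idem
  let L : H →L[ℂ] E.range := E.codRestrict E.range fun x => ⟨x, rfl⟩
  have hL : E.range.subtypeL.comp L = E := rfl
  have hLc : ∀ x : E.range, L x = x := fun x => Subtype.ext (hfix x)
  -- On the range, `x = S(1) W x`, so `A x = S'(1) W x` is given by a bounded operator.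
  let M : E.range →L[ℂ] E.range := L.comp ((S' 1 * W).comp E.range.subtypeL)
  have hgr : ∀ x : E.range, ((x : H), S' 1 (W x)) ∈ A.graph := by
    intro x
    have h2 := hd.mem_graph hS hA one_pos (W x)
    have h3 : S 1 (W x) = x :=
      (congrArg (fun T : H →L[ℂ] H => T (x : H)) hEW).symm.trans (hfix x)
    rwa [h3] at h2
  have hM : ∀ x : E.range, ((x : H), (M x : H)) ∈ A.graph := by
    intro x
    have h4 := hA.mem_graph_of_commute (fun t ht => hE.commute hS ht) (hgr x)
    rw [hfix x] at h4
    exact h4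
  have hdense := hd.dense_domain hS hA
  refine ⟨⟨E.range, hfin, hcomp, L, M, hLc, hM, fun t ht => by rw [hL]; exact hE.commute hS ht,
    by rw [hL]; exact hE.exists_decay hS hA hd, fun p c hp hpc => ?_⟩⟩
  have hLp : ContinuousLinearMap.adjoint L p ≠ 0 := by
    intro h0
    apply hp
    have : inner ℂ p p = 0 := by
      nth_rewrite 2 [← hLc p]
      rw [← ContinuousLinearMap.adjoint_inner_left, h0, inner_zero_left]
    exact inner_self_eq_zero.1 this
  refine hE.re_ge_of_adjoint_eigenvector hS hA hd hwz hLp ?_ ?_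
  · rw [mem_adjoint_graph_iff hdense]
    intro x y h
    have hy : L y = M (L x) := Subtype.ext (LinearPMap_graph_unique
      (hA.mem_graph_of_commute (fun t ht => hE.commute hS ht) h) (hM (L x)))
    rw [inner_smul_left, ContinuousLinearMap.adjoint_inner_left,
      ContinuousLinearMap.adjoint_inner_left, hy, ← ContinuousLinearMap.adjoint_inner_left M, hpc,
      inner_smul_left]
  · refine ext_inner_right ℂ fun x => ?_
    rw [ContinuousLinearMap.adjoint_inner_left, ContinuousLinearMap.adjoint_inner_left,
      ContinuousLinearMap.adjoint_inner_left]
    congr 1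
    exact hLc (L x)

end Splitting

/-! ### Fractional powers and smoothing by the semigroup -/

section FractionalPowers

open MeasureTheory

variable {H : Type*} [NormedAddCommGroup H] [InnerProductSpace ℂ H] [CompleteSpace H]
variable {A : H →ₗ.[ℂ] H} {S S' : ℝ → H →L[ℂ] H}

theorem integrableOn_rpow_mul_exp_neg_mul {s b : ℝ} (hs : -1 < s) (hb : 0 < b) :
    IntegrableOn (fun x : ℝ => x ^ s * Real.exp (-b * x)) (Ioi 0) := by
  simpa using integrableOn_rpow_mul_exp_neg_mul_rpow hs one_pos hb

theorem continuousOn_rpow_mul_exp_neg_mul (s b : ℝ) :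
    ContinuousOn (fun x : ℝ => x ^ s * Real.exp (-b * x)) (Ioi 0) :=
  ContinuousOn.mul
    (fun x hx => (Real.continuousAt_rpow_const x s (Or.inl (ne_of_gt hx))).continuousWithinAt)
    (by fun_prop)

/-- This is the Beta integral at `(γ, 1 - γ)`. Its independence of `p` is what makes the integral
kernels of the powers `-γ` and `-(1 - γ)` convolve to the kernel of the resolvent. -/
theorem integral_rpow_mul_sub_rpow {γ p : ℝ} (h0 : 0 < γ) (h1 : γ < 1) (hp : 0 < p) :
    ∫ q in (0 : ℝ)..p, q ^ (γ - 1) * (p - q) ^ (-γ) = Real.Gamma γ * Real.Gamma (1 - γ) := by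
  have e1 := Complex.betaIntegral_scaled (γ : ℂ) (1 - γ : ℝ) hp
  have e2 := Complex.Gamma_mul_Gamma_eq_betaIntegral (s := (γ : ℂ)) (t := ((1 - γ : ℝ) : ℂ))
    (by simpa using h0) (by simpa using h1)
  have e3 : (γ : ℂ) + ((1 - γ : ℝ) : ℂ) = 1 := by push_cast; ring
  rw [e3, Complex.Gamma_one, one_mul] at e2
  rw [e3, sub_self, Complex.cpow_zero, one_mul, ← e2, Complex.Gamma_ofReal, Complex.Gamma_ofReal]
    at e1
  have e4 : ∫ x in (0 : ℝ)..p, (x : ℂ) ^ ((γ : ℂ) - 1) * ((p : ℂ) - x) ^ (((1 - γ : ℝ) : ℂ) - 1) =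
      ∫ x in (0 : ℝ)..p, ((x ^ (γ - 1) * (p - x) ^ (-γ) : ℝ) : ℂ) := by
    refine intervalIntegral.integral_congr fun x hx => ?_
    rw [uIcc_of_le hp.le] at hx
    rw [Complex.ofReal_mul, Complex.ofReal_cpow hx.1, Complex.ofReal_cpow (sub_nonneg.2 hx.2)]
    congr 2 <;> push_cast <;> ring
  rw [e4, intervalIntegral.integral_ofReal] at e1
  exact_mod_cast e1

theorem IsDifferentiableSemigroup.exists_deriv_norm_le (hS : IsC0Semigroup S)
    (hd : IsDifferentiableSemigroup S S') {C a : ℝ} (hC : 0 < C)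
    (hb : ∀ t, 0 ≤ t → ‖S t‖ ≤ C * Real.exp (a * t)) :
    ∃ C' > 0, ∀ t, 0 < t → ‖S' t‖ ≤ C' * (1 / t + 1) * Real.exp (a * t) := by
  obtain ⟨c, hc, hcb⟩ := hd.norm_le
  refine ⟨c * Real.exp |a| + c * C * Real.exp |a|, by positivity, fun t ht => ?_⟩
  rcases le_or_gt t 1 with h1 | h1
  · have h2 : 1 ≤ Real.exp |a| * Real.exp (a * t) := by
      rw [← Real.exp_add]
      apply Real.one_le_exp
      have := neg_abs_le (a * t)
      rw [abs_mul, abs_of_pos ht] at this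
      nlinarith [abs_nonneg a]
    calc ‖S' t‖ ≤ c / t * 1 := by rw [mul_one]; exact hcb t ⟨ht, h1⟩
      _ ≤ c / t * (Real.exp |a| * Real.exp (a * t)) := by gcongr
      _ = c * Real.exp |a| * (1 / t) * Real.exp (a * t) := by ring
      _ ≤ _ := by
        gcongr
        · exact le_add_of_nonneg_right (by positivity)
        · linarith
  · have e1 := hS.hasDerivAt_add hd.hasDerivAt one_pos (sub_nonneg.2 h1.le)
    rw [add_sub_cancel] at e1
    have h2 : Real.exp (a * (t - 1)) ≤ Real.exp |a| * Real.exp (a * t) := by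
      rw [← Real.exp_add, Real.exp_le_exp]
      nlinarith [neg_abs_le a]
    calc ‖S' t‖ ≤ ‖S' 1‖ * ‖S (t - 1)‖ := by rw [e1]; exact norm_mul_le _ _
      _ ≤ c * (C * Real.exp (a * (t - 1))) := by
        gcongr
        · simpa using hcb 1 ⟨one_pos, le_rfl⟩
        · exact hb _ (by linarith)
      _ ≤ c * (C * (Real.exp |a| * Real.exp (a * t))) := by gcongr
      _ = c * C * Real.exp |a| * 1 * Real.exp (a * t) := by ring
      _ ≤ _ := by
        gcongr
        · exact le_add_of_nonneg_left (by positivity)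
        · have : 0 < 1 / t := by positivity
          linarith

theorem integrableOn_smul_semigroup (hd : IsDifferentiableSemigroup S S') {C a μ : ℝ} (ha : a < μ)
    (hb : ∀ t, 0 ≤ t → ‖S t‖ ≤ C * Real.exp (a * t)) {s : ℝ} (hs : -1 < s) :
    IntegrableOn (fun t : ℝ => (t ^ s * Real.exp (-μ * t)) • S t) (Ioi 0) := by
  have hg := (integrableOn_rpow_mul_exp_neg_mul hs (sub_pos.2 ha)).const_mul C
  refine Integrable.mono' hg ?_ ?_
  · refine ContinuousOn.aestronglyMeasurable ?_ measurableSet_Ioi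
    exact (continuousOn_rpow_mul_exp_neg_mul s μ).smul hd.continuousOn
  · filter_upwards [ae_restrict_mem measurableSet_Ioi] with t ht
    have ht' : 0 < t := ht
    rw [norm_smul, Real.norm_of_nonneg (by positivity)]
    calc _ ≤ t ^ s * Real.exp (-μ * t) * (C * Real.exp (a * t)) := by gcongr; exact hb t ht'.le
      _ = C * (t ^ s * (Real.exp (-μ * t) * Real.exp (a * t))) := by ring
      _ = _ := by rw [← Real.exp_add]; ring_nf

/-- Domination of the integrand in the formula for `(μ - A)^(1-γ) S(t)`. -/
theorem norm_smul_deriv_le {C a μ : ℝ} (hC : 0 < C) (hb : ∀ t, 0 < t →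
    ‖μ • S t - S' t‖ ≤ C * (1 / t + 1) * Real.exp (a * t)) {γ γ' : ℝ} (h0 : 0 < γ')
    (h1 : γ' < 1) {t r : ℝ} (ht : 0 < t) (ht1 : t ≤ 1) (hr : 0 < r) :
    ‖(r ^ (-γ) * Real.exp (-μ * r)) • (μ • S (t + r) - S' (t + r))‖ ≤
      t ^ (-γ') * (C * Real.exp |a| * (r ^ (γ' - 1 - γ) * Real.exp (-(μ - a) * r) +
        r ^ (-γ) * Real.exp (-(μ - a) * r))) := by
  have htr : 0 < t + r := by linarith
  -- This splits `1 / (t + r)` into a power of `t` and one of `r`. After multiplication by `r ^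
  -- (-γ)` the exponent of `r` is `γ' - 1 - γ`, integrable at zero when `γ' > γ`.
  have e1 : t ^ γ' * r ^ (1 - γ') ≤ t + r := by
    calc t ^ γ' * r ^ (1 - γ') ≤ (t + r) ^ γ' * (t + r) ^ (1 - γ') := by
          gcongr
          · linarith
          · linarith
      _ = t + r := by rw [← Real.rpow_add htr, add_sub_cancel, Real.rpow_one]
  have e2 : 1 / (t + r) ≤ t ^ (-γ') * r ^ (γ' - 1) := by
    have : t ^ (-γ') * r ^ (γ' - 1) = 1 / (t ^ γ' * r ^ (1 - γ')) := by
      rw [Real.rpow_neg ht.le, ← neg_sub 1 γ', Real.rpow_neg hr.le]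
      field_simp
    rw [this]
    exact one_div_le_one_div_of_le (by positivity) e1
  have e3 : (1 : ℝ) ≤ t ^ (-γ') := Real.one_le_rpow_of_pos_of_le_one_of_nonpos ht ht1 (by linarith)
  have e4 : Real.exp (a * (t + r)) ≤ Real.exp |a| * Real.exp (a * r) := by
    rw [← Real.exp_add, Real.exp_le_exp]
    nlinarith [le_abs_self a, abs_nonneg a]
  rw [norm_smul, Real.norm_of_nonneg (by positivity)]
  calc _ ≤ r ^ (-γ) * Real.exp (-μ * r) *
        (C * (1 / (t + r) + 1) * Real.exp (a * (t + r))) := by gcongr; exact hb _ htr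
    _ ≤ r ^ (-γ) * Real.exp (-μ * r) *
        (C * (t ^ (-γ') * r ^ (γ' - 1) + t ^ (-γ')) * (Real.exp |a| * Real.exp (a * r))) := by
        gcongr
    _ = t ^ (-γ') * (C * Real.exp |a| *
        ((r ^ (γ' - 1) * r ^ (-γ) + r ^ (-γ)) * (Real.exp (-μ * r) * Real.exp (a * r)))) := by ring
    _ = _ := by
        rw [← Real.rpow_add hr, ← Real.exp_add]
        ring_nf

theorem continuousOn_smul_sub_deriv (hS : IsC0Semigroup S)
    (hd : IsDifferentiableSemigroup S S') (μ : ℝ) {t : ℝ} (ht : 0 < t) :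
    ContinuousOn (fun p => μ • S (t + p) - S' (t + p)) (Ioi 0) := by
  have hm : MapsTo (fun p : ℝ => t + p) (Ioi 0) (Ioi 0) := fun p hp => add_pos ht hp
  have hc : ContinuousOn (fun p : ℝ => t + p) (Ioi 0) := by fun_prop
  have h1 : ContinuousOn (fun p => S (t + p)) (Ioi 0) := hd.continuousOn.comp hc hm
  have h2 : ContinuousOn (fun p => S' (t + p)) (Ioi 0) := (hd.continuousOn_deriv hS).comp hc hm
  exact (ContinuousOn.smul (f := fun _ : ℝ => μ) continuousOn_const h1).sub h2

/-- The identity `(μ - A)⁻¹ (μ - A) S(t) = S(t)` in integral form: the integrand is the derivative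
of `-e^{-μ p} S(t + p)`. -/
theorem integral_exp_smul_resolvent_deriv (hS : IsC0Semigroup S)
    (hd : IsDifferentiableSemigroup S S') {C a μ : ℝ} (hC : 0 < C) (ha : a < μ)
    (hb : ∀ t, 0 ≤ t → ‖S t‖ ≤ C * Real.exp (a * t)) {t : ℝ} (ht : 0 < t) :
    ∫ p in Ioi (0 : ℝ), Real.exp (-μ * p) • (μ • S (t + p) - S' (t + p)) = S t := by
  obtain ⟨C', hC', hb'⟩ := hd.exists_deriv_norm_le hS hC hb
  have hder : ∀ p ∈ Ici (0 : ℝ), HasDerivAt (fun p => -(Real.exp (-μ * p) • S (t + p)))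
      (Real.exp (-μ * p) • (μ • S (t + p) - S' (t + p))) p := by
    intro p hp
    have hp' : 0 < t + p := add_pos_of_pos_of_nonneg ht hp
    have h1 : HasDerivAt (fun p => S (t + p)) (S' (t + p)) p :=
      (hd.hasDerivAt _ hp').comp_const_add t p
    have h2 : HasDerivAt (fun p : ℝ => Real.exp (-μ * p)) (Real.exp (-μ * p) * (-μ * 1)) p :=
      ((hasDerivAt_id p).const_mul (-μ)).exp
    refine (h2.smul h1).neg.congr_deriv ?_
    module
  have hcomp : ∀ p : ℝ, 0 ≤ p → ‖S (t + p)‖ ≤ C * Real.exp (a * t) * Real.exp (a * p) := by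
    intro p hp
    refine (hb _ (by linarith)).trans_eq ?_
    rw [mul_add, Real.exp_add]; ring
  have hint : IntegrableOn (fun p => Real.exp (-μ * p) • (μ • S (t + p) - S' (t + p)))
      (Ioi 0) := by
    have hg : IntegrableOn (fun p : ℝ => (|μ| * (C * Real.exp (a * t)) +
        C' * (1 / t + 1) * Real.exp (a * t)) * Real.exp (-(μ - a) * p)) (Ioi 0) :=
      (exp_neg_integrableOn_Ioi 0 (sub_pos.2 ha)).const_mul _
    refine Integrable.mono' hg ?_ ?_
    · refine ContinuousOn.aestronglyMeasurable ?_ measurableSet_Ioi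
      have hexp : ContinuousOn (fun p : ℝ => Real.exp (-μ * p)) (Ioi 0) := by fun_prop
      exact hexp.smul (continuousOn_smul_sub_deriv hS hd μ ht)
    · filter_upwards [ae_restrict_mem measurableSet_Ioi] with p hp
      have hp' : 0 < p := hp
      have h1 : ‖S' (t + p)‖ ≤ C' * (1 / t + 1) * (Real.exp (a * t) * Real.exp (a * p)) := by
        refine (hb' _ (by linarith)).trans ?_
        rw [← Real.exp_add, ← mul_add]
        gcongr
        linarith
      rw [norm_smul, Real.norm_of_nonneg (Real.exp_pos _).le]
      calc _ ≤ Real.exp (-μ * p) * (‖μ • S (t + p)‖ + ‖S' (t + p)‖) := by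
            gcongr; exact norm_sub_le _ _
        _ ≤ Real.exp (-μ * p) * (|μ| * (C * Real.exp (a * t) * Real.exp (a * p)) +
            C' * (1 / t + 1) * (Real.exp (a * t) * Real.exp (a * p))) := by
            gcongr
            rw [norm_smul, Real.norm_eq_abs]
            gcongr
            exact hcomp p hp'.le
        _ = (|μ| * (C * Real.exp (a * t)) + C' * (1 / t + 1) * Real.exp (a * t)) *
            (Real.exp (-μ * p) * Real.exp (a * p)) := by ring
        _ = _ := by rw [← Real.exp_add]; ring_nf
  have hlim : Tendsto (fun p => -(Real.exp (-μ * p) • S (t + p))) atTop (𝓝 (-0)) := by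
    refine Tendsto.neg ?_
    have hz : Tendsto (fun p : ℝ => C * Real.exp (a * t) * Real.exp (-(μ - a) * p)) atTop (𝓝 0) := by
      have h3 : Tendsto (fun p : ℝ => Real.exp (-(μ - a) * p)) atTop (𝓝 0) := by
        refine Real.tendsto_exp_atBot.comp ?_
        exact tendsto_id.const_mul_atTop_of_neg (by linarith)
      simpa using h3.const_mul (C * Real.exp (a * t))
    refine squeeze_zero_norm' ?_ hz
    filter_upwards [eventually_ge_atTop 0] with p hp
    rw [norm_smul, Real.norm_of_nonneg (Real.exp_pos _).le]
    calc _ ≤ Real.exp (-μ * p) * (C * Real.exp (a * t) * Real.exp (a * p)) := by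
          gcongr; exact hcomp p hp
      _ = C * Real.exp (a * t) * (Real.exp (-μ * p) * Real.exp (a * p)) := by ring
      _ = _ := by rw [← Real.exp_add]; ring_nf
  rw [integral_Ioi_of_hasDerivAt_of_tendsto' hder hint hlim]
  simp

theorem negPow_eq {γ : ℝ} (hγ : γ ≠ 0) (μ : ℝ) : negPow S μ γ =
    (Real.Gamma γ)⁻¹ • ∫ t in Ioi (0 : ℝ), (t ^ (γ - 1) * Real.exp (-μ * t)) • S t := by
  rw [negPow, if_neg hγ]
  simp only [Complex.coe_smul]

theorem integral_clm_commute {F : ℝ → H →L[ℂ] H} {T : H →L[ℂ] H}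
    (hF : IntegrableOn F (Ioi 0)) (h : ∀ t, 0 < t → T * F t = F t * T) :
    T * (∫ t in Ioi (0 : ℝ), F t) = (∫ t in Ioi (0 : ℝ), F t) * T := by
  have h1 := (ContinuousLinearMap.mul ℂ (H →L[ℂ] H) T).integral_comp_comm hF
  have h2 := ((ContinuousLinearMap.mul ℂ (H →L[ℂ] H)).flip T).integral_comp_comm hF
  simp only [ContinuousLinearMap.mul_apply', ContinuousLinearMap.flip_apply] at h1 h2
  rw [← h1, ← h2]
  exact setIntegral_congr_fun measurableSet_Ioi fun t ht => h t ht

/-- `S(t) = (μ - A)^(-γ) G(t)` with `‖G(t)‖ ≤ c t^(-γ')` for every `γ' > γ`. -/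
theorem exists_negPow_mul_eq (hS : IsC0Semigroup S)
    (hd : IsDifferentiableSemigroup S S') {C a μ : ℝ} (hC : 0 < C) (ha : a < μ)
    (hb : ∀ t, 0 ≤ t → ‖S t‖ ≤ C * Real.exp (a * t)) {γ γ' : ℝ} (h0 : 0 < γ) (h1 : γ < γ')
    (h2 : γ' < 1) :
    ∃ c > 0, ∀ t ∈ Ioc (0 : ℝ) 1, ∃ G : H →L[ℂ] H, negPow S μ γ * G = S t ∧
      G * negPow S μ γ = S t ∧ ‖G‖ ≤ c * t ^ (-γ') := by
  obtain ⟨C', hC', hb'⟩ := hd.exists_deriv_norm_le hS hC hb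
  have hbG : ∀ t, 0 < t → ‖μ • S t - S' t‖ ≤ (|μ| * C + C') * (1 / t + 1) * Real.exp (a * t) := by
    intro t ht
    have : (0 : ℝ) < 1 / t := by positivity
    calc _ ≤ ‖μ • S t‖ + ‖S' t‖ := norm_sub_le _ _
      _ ≤ |μ| * (C * Real.exp (a * t)) * 1 + C' * (1 / t + 1) * Real.exp (a * t) := by
        rw [norm_smul, Real.norm_eq_abs, mul_one]
        gcongr
        · exact hb t ht.le
        · exact hb' t ht
      _ ≤ |μ| * (C * Real.exp (a * t)) * (1 / t + 1) + C' * (1 / t + 1) * Real.exp (a * t) := by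
        gcongr
        linarith
      _ = _ := by ring
  have hC2 : 0 < |μ| * C + C' := by positivity
  set C₂ := |μ| * C + C'
  set ψ : ℝ → ℝ := fun r => C₂ * Real.exp |a| * (r ^ (γ' - 1 - γ) * Real.exp (-(μ - a) * r) +
        r ^ (-γ) * Real.exp (-(μ - a) * r)) with hψ
  have hψint : IntegrableOn ψ (Ioi 0) :=
    ((integrableOn_rpow_mul_exp_neg_mul (by linarith) (sub_pos.2 ha)).add
      (integrableOn_rpow_mul_exp_neg_mul (by linarith) (sub_pos.2 ha))).const_mul _
  have hΓ : 0 < Real.Gamma γ := Real.Gamma_pos_of_pos h0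
  have hΓ' : 0 < Real.Gamma (1 - γ) := Real.Gamma_pos_of_pos (by linarith)
  have hψ0 : 0 ≤ ∫ r in Ioi (0 : ℝ), ψ r := setIntegral_nonneg measurableSet_Ioi fun r hr => by
    have : 0 < r := hr
    positivity
  refine ⟨(Real.Gamma (1 - γ))⁻¹ * ((∫ r in Ioi (0 : ℝ), ψ r) + 1), by positivity, ?_⟩
  rintro t ⟨ht, ht1⟩
  set F₁ : ℝ → H →L[ℂ] H := fun q => (q ^ (γ - 1) * Real.exp (-μ * q)) • S q with hF₁
  -- Up to `1 / Γ(1 - γ)`, the integral of `F₂` is `(μ - A)^{-(1-γ)} (μ - A) S(t)`, that is, `(μ -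
  -- A)^γ S(t)`.
  set F₂ : ℝ → H →L[ℂ] H :=
    fun r => (r ^ (-γ) * Real.exp (-μ * r)) • (μ • S (t + r) - S' (t + r)) with hF₂
  have hF₁int : IntegrableOn F₁ (Ioi 0) := integrableOn_smul_semigroup hd ha hb (by linarith)
  have hF₂b : ∀ r, 0 < r → ‖F₂ r‖ ≤ t ^ (-γ') * ψ r := fun r hr =>
    norm_smul_deriv_le hC2 hbG (by linarith) h2 ht ht1 hr
  have hF₂int : IntegrableOn F₂ (Ioi 0) := by
    refine Integrable.mono' (hψint.const_mul (t ^ (-γ'))) ?_ ?_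
    · refine ContinuousOn.aestronglyMeasurable ?_ measurableSet_Ioi
      exact (continuousOn_rpow_mul_exp_neg_mul (-γ) μ).smul
        (continuousOn_smul_sub_deriv hS hd μ ht)
    · filter_upwards [ae_restrict_mem measurableSet_Ioi] with r hr using hF₂b r hr
  have hmulG : ∀ q r, 0 < q → 0 < r → S q * (μ • S (t + r) - S' (t + r)) =
      μ • S (t + (q + r)) - S' (t + (q + r)) := by
    intro q r hq hr
    have e : t + (q + r) = (t + r) + q := by ring
    rw [e, hS.hasDerivAt_add' hd.hasDerivAt (by linarith) hq.le, hS.add _ _ (by linarith) hq.le,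
      hS.commute (by linarith) hq.le, mul_sub, mul_smul_comm]
  have hmulG' : ∀ q r, 0 < q → 0 < r → (μ • S (t + r) - S' (t + r)) * S q =
      S q * (μ • S (t + r) - S' (t + r)) := by
    intro q r hq hr
    rw [mul_sub, sub_mul, mul_smul_comm, smul_mul_assoc, hS.commute (by linarith) hq.le,
      ← hS.hasDerivAt_add hd.hasDerivAt (by linarith) hq.le,
      ← hS.hasDerivAt_add' hd.hasDerivAt (by linarith) hq.le]
  -- The product of the two integrals is the integral over `p` of their convolution, whose scalar
  -- part is the Beta integral.
  have hconv := integral_posConvolution hF₁int hF₂int (ContinuousLinearMap.mul ℝ (H →L[ℂ] H))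
  have hinner : ∀ p ∈ Ioi (0 : ℝ),
      ∫ q in (0 : ℝ)..p, ContinuousLinearMap.mul ℝ (H →L[ℂ] H) (F₁ q) (F₂ (p - q)) =
      (Real.Gamma γ * Real.Gamma (1 - γ)) •
        (Real.exp (-μ * p) • (μ • S (t + p) - S' (t + p))) := by
    intro p hp
    have hp' : 0 < p := hp
    rw [← integral_rpow_mul_sub_rpow h0 (by linarith) hp', ← intervalIntegral.integral_smul_const]
    refine intervalIntegral.integral_congr_ae ?_
    have hpne : ∀ᵐ q : ℝ, q ≠ p := by simp [ae_iff, measure_singleton]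
    filter_upwards [hpne] with q hqp hq
    rw [uIoc_of_le hp'.le] at hq
    have hq' : q < p := lt_of_le_of_ne hq.2 hqp
    simp only [ContinuousLinearMap.mul_apply', F₁, F₂]
    rw [smul_mul_smul_comm, hmulG q (p - q) hq.1 (by linarith), add_sub_cancel, smul_smul]
    congr 1
    have : Real.exp (-μ * p) = Real.exp (-μ * q) * Real.exp (-μ * (p - q)) := by
      rw [← Real.exp_add]; ring_nf
    rw [this]; ring
  rw [setIntegral_congr_fun measurableSet_Ioi hinner, integral_smul,
    integral_exp_smul_resolvent_deriv hS hd hC ha hb ht, ContinuousLinearMap.mul_apply'] at hconv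
  have hprod : negPow S μ γ * ((Real.Gamma (1 - γ))⁻¹ • ∫ r in Ioi (0 : ℝ), F₂ r) = S t := by
    rw [negPow_eq h0.ne', smul_mul_smul_comm, ← hconv, smul_smul]
    rw [show (Real.Gamma γ)⁻¹ * (Real.Gamma (1 - γ))⁻¹ * (Real.Gamma γ * Real.Gamma (1 - γ)) = 1 by
      field_simp, one_smul]
  refine ⟨(Real.Gamma (1 - γ))⁻¹ • ∫ r in Ioi (0 : ℝ), F₂ r, hprod, ?_, ?_⟩
  · rw [← hprod, negPow_eq h0.ne', smul_mul_smul_comm, smul_mul_smul_comm, mul_comm]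
    congr 1
    symm
    refine integral_clm_commute hF₂int fun r hr => ?_
    symm
    refine integral_clm_commute hF₁int fun q hq => ?_
    simp only [hF₂]
    rw [smul_mul_smul_comm, smul_mul_smul_comm, hmulG' q r hq hr, mul_comm]
  · rw [norm_smul, Real.norm_of_nonneg (by positivity), mul_assoc]
    gcongr
    calc _ ≤ ∫ r in Ioi (0 : ℝ), t ^ (-γ') * ψ r :=
          norm_integral_le_of_norm_le (hψint.const_mul _) (by
            filter_upwards [ae_restrict_mem measurableSet_Ioi] with r hr using hF₂b r hr)
      _ = (∫ r in Ioi (0 : ℝ), ψ r) * t ^ (-γ') := by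
          rw [integral_const_mul, mul_comm]
      _ ≤ _ := by gcongr; linarith

end FractionalPowers

section Kernel

variable {H : Type*} [NormedAddCommGroup H] [InnerProductSpace ℂ H] [CompleteSpace H]
variable {U : Type*} [NormedAddCommGroup U] [InnerProductSpace ℂ U]
variable {A : H →ₗ.[ℂ] H} {S S' : ℝ → H →L[ℂ] H} {B : U →L[ℂ] DStarDual A}

open ContinuousLinearMap

/-! ### The smoothing estimate for the control operator -/

theorem isC0Semigroup_adjSemigroup (hS : IsC0Semigroup S) (hd : IsDifferentiableSemigroup S S') :
    IsC0Semigroup (adjSemigroup S) where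
  zero := by rw [adjSemigroup, hS.zero, ← star_eq_adjoint, star_one]
  add s t hs ht := ContinuousLinearMap.ext fun e => hS.adjoint_add hs ht e
  continuousOn e := hd.continuousOn_adjoint_apply hS e

theorem isDifferentiableSemigroup_adjSemigroup (hd : IsDifferentiableSemigroup S S') :
    IsDifferentiableSemigroup (adjSemigroup S) (fun t => adjoint (S' t)) where
  hasDerivAt t ht := HasDerivAt.adjoint_clm (hd.hasDerivAt t ht)
  norm_le := by
    obtain ⟨C, hC, h⟩ := hd.norm_le
    exact ⟨C, hC, fun t ht => by rw [LinearIsometryEquiv.norm_map]; exact h t ht⟩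

omit [CompleteSpace H] in
theorem mem_graph_fracPow {μ γ : ℝ} (hinj : ∀ x, negPow S μ γ x = 0 → x = 0) (x : H) :
    (negPow S μ γ x, x) ∈ (fracPow S μ γ).graph := by
  refine LinearPMap.mem_inverse_graph (f := (negPow S μ γ : H →ₗ[ℂ] H).toPMap ⊤) ?_
    ⟨x, Submodule.mem_top⟩
  rw [LinearMap.ker_eq_bot']
  intro y hy
  exact Subtype.ext (hinj y hy)

/-- On `(0, 1]`, the operators `S(t)` map into the domain of `(μ - A)^γ` with an integrable
bound. -/
theorem exists_negPow_mul_eq_and_injective (hS : IsC0Semigroup S)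
    (hd : IsDifferentiableSemigroup S S') {C a μ : ℝ} (hC : 0 < C) (ha : a < μ)
    (hb : ∀ t, 0 ≤ t → ‖S t‖ ≤ C * Real.exp (a * t)) {γ : ℝ} (h0 : 0 ≤ γ) (h1 : γ < 1) :
    ∃ γ' : ℝ, 0 < γ' ∧ γ' < 1 ∧ (∀ x, negPow S μ γ x = 0 → x = 0) ∧
      ∃ c > 0, ∀ t ∈ Ioc (0 : ℝ) 1, ∃ G : H →L[ℂ] H, negPow S μ γ * G = S t ∧
        ‖G‖ ≤ c * t ^ (-γ') := by
  rcases h0.eq_or_lt with rfl | hpos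
  · have hone : negPow S μ 0 = 1 := if_pos rfl
    obtain ⟨M, hM, hMb⟩ := hS.exists_norm_le 1
    -- For `γ = 0` the power is the identity and any exponent in `(0, 1)` would do.
    refine ⟨1 / 2, by norm_num, by norm_num, fun x hx => by simpa [hone] using hx, M, hM, ?_⟩
    rintro t ⟨ht, ht1⟩
    refine ⟨S t, by rw [hone, one_mul], ?_⟩
    have : (1 : ℝ) ≤ t ^ (-(1 / 2 : ℝ)) :=
      Real.one_le_rpow_of_pos_of_le_one_of_nonpos ht ht1 (by norm_num)
    calc ‖S t‖ ≤ M * 1 := by rw [mul_one]; exact hMb t ⟨ht.le, ht1⟩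
      _ ≤ _ := by gcongr
  · obtain ⟨c, hc, h⟩ := exists_negPow_mul_eq hS hd hC ha hb hpos
      (by linarith : γ < (1 + γ) / 2) (by linarith)
    refine ⟨(1 + γ) / 2, by linarith, by linarith, fun x hx => ?_, c, hc, fun t ht => ?_⟩
    · have h2 : ∀ t ∈ Ioc (0 : ℝ) 1, S t x = 0 := by
        intro t ht
        obtain ⟨G, -, hG, -⟩ := h t ht
        rw [← hG, mul_apply_eq_comp, hx, map_zero]
      refine tendsto_nhds_unique (hS.tendsto_apply_zero x) ?_
      refine tendsto_const_nhds.congr' ?_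
      filter_upwards [Ioc_mem_nhdsGT (one_pos : (0 : ℝ) < 1)] with s hs using (h2 s hs).symm
    · obtain ⟨G, h1, -, h2⟩ := h t ht
      exact ⟨G, h1, h2⟩

theorem exists_norm_apply_apply_le {E : Type*} [NormedAddCommGroup E] [NormedSpace ℂ E]
    (b : U →L[ℂ] (E →L⋆[ℂ] ℂ)) : ∃ C > 0, ∀ u e, ‖b u e‖ ≤ C * ‖u‖ * ‖e‖ :=
  ⟨‖b‖ + 1, by positivity, fun u e => (b.le_opNorm₂ u e).trans (by gcongr; linarith)⟩

/-- By (H5), testing `B u` on `S(t)* e` costs only the graph norm of `S(t)* e` for `(μ - A*)^γ`, and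
the factorization through the negative power, applied to the adjoint semigroup, bounds it by a
multiple of `t^{-γ'} ‖e‖`. The exponent returned here is `γ'`, not the one in (H5). -/
theorem HypH5.exists_norm_le (hS : IsC0Semigroup S) (hA : IsGenerator A S)
    (hd : IsDifferentiableSemigroup S S') {μ : ℝ} (hμ : ∀ l ∈ spec A, l.re < μ)
    (h5 : HypH5 A S μ B) :
    ∃ γ : ℝ, 0 < γ ∧ γ < 1 ∧ ∃ c > 0, ∀ t ∈ Ioc (0 : ℝ) 1, ∀ (u : U) (e f : H)
      (h : (adjoint (S t) e, f) ∈ A.adjoint.graph),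
      ‖B u ⟨(adjoint (S t) e, f), h⟩‖ ≤ c * t ^ (-γ) * ‖u‖ * ‖e‖ := by
  obtain ⟨γ, h0, h1, B', hB'⟩ := h5
  obtain ⟨C, hC, a, ha, hb⟩ := exists_norm_le_exp_of_spec_lt hS hA hd hμ
  have hb' : ∀ t, 0 ≤ t → ‖adjSemigroup S t‖ ≤ C * Real.exp (a * t) := fun t ht => by
    rw [adjSemigroup, LinearIsometryEquiv.norm_map]; exact hb t ht
  have hS' := isC0Semigroup_adjSemigroup hS hd
  obtain ⟨γ', hγ0, hγ1, hinj, c, hc, hG⟩ := exists_negPow_mul_eq_and_injective hS'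
    (isDifferentiableSemigroup_adjSemigroup hd) hC ha hb' h0 h1
  obtain ⟨M, hM, hMb⟩ := hS'.exists_norm_le 1
  obtain ⟨b, hb0, hbB⟩ := exists_norm_apply_apply_le B'
  refine ⟨γ', hγ0, hγ1, b * (M + c), by positivity, ?_⟩
  intro t ht u e f h
  obtain ⟨G, hG1, hG2⟩ := hG t ht
  have e1 : negPow (adjSemigroup S) μ γ (G e) = adjoint (S t) e :=
    congrArg (fun T : H →L[ℂ] H => T e) hG1
  have hmem := mem_graph_fracPow hinj (G e)
  rw [e1] at hmem
  let e' : HStar S μ γ := ⟨(adjoint (S t) e, G e), hmem⟩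
  have hone : (1 : ℝ) ≤ t ^ (-γ') :=
    Real.one_le_rpow_of_pos_of_le_one_of_nonpos ht.1 ht.2 (by linarith)
  have he' : ‖e'‖ ≤ (M + c) * t ^ (-γ') * ‖e‖ := by
    have n1 : ‖adjoint (S t) e‖ ≤ M * ‖e‖ :=
      (le_opNorm _ _).trans (by gcongr; exact hMb t ⟨ht.1.le, ht.2⟩)
    have n2 : ‖G e‖ ≤ c * t ^ (-γ') * ‖e‖ := (le_opNorm _ _).trans (by gcongr)
    have n3 : ‖e'‖ = max ‖adjoint (S t) e‖ ‖G e‖ := rfl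
    rw [n3, max_le_iff]
    constructor
    · calc _ ≤ M * 1 * ‖e‖ := by rw [mul_one]; exact n1
        _ ≤ (M + c) * t ^ (-γ') * ‖e‖ := by gcongr; linarith
    · refine n2.trans ?_
      gcongr
      linarith
  rw [hB' u ⟨(adjoint (S t) e, f), h⟩ e' rfl]
  calc ‖B' u e'‖ ≤ b * ‖u‖ * ‖e'‖ := hbB u e'
    _ ≤ b * ‖u‖ * ((M + c) * t ^ (-γ') * ‖e‖) := by gcongr
    _ = _ := by ring

/-- `K t = S(t) B`, as bounded operators from `U` to `H` with an integrable singularity at `0`. -/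
structure IsControlKernel (A : H →ₗ.[ℂ] H) (S : ℝ → H →L[ℂ] H) (B : U →L[ℂ] DStarDual A) (γ : ℝ)
    (K : ℝ → U →L[ℂ] H) : Prop where
  inner_eq : ∀ t, 0 < t → ∀ (u : U) (e f : H) (h : (adjoint (S t) e, f) ∈ A.adjoint.graph),
    inner ℂ e (K t u) = B u ⟨(adjoint (S t) e, f), h⟩
  norm_le : ∃ C > 0, ∀ t ∈ Ioc (0 : ℝ) 1, ‖K t‖ ≤ C * t ^ (-γ)

theorem HypH5.exists_isControlKernel [CompleteSpace U] (hS : IsC0Semigroup S)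
    (hA : IsGenerator A S) (hd : IsDifferentiableSemigroup S S') {μ : ℝ}
    (hμ : ∀ l ∈ spec A, l.re < μ) (h5 : HypH5 A S μ B) :
    ∃ γ : ℝ, 0 < γ ∧ γ < 1 ∧ ∃ K, IsControlKernel A S B γ K := by
  obtain ⟨γ, hγ0, hγ1, c, hc, hb⟩ := h5.exists_norm_le hS hA hd hμ
  have hex : ∀ t : ℝ, ∃ K : U →L[ℂ] H, 0 < t → ∀ (u : U) (e f : H)
      (h : (adjoint (S t) e, f) ∈ A.adjoint.graph),
      inner ℂ e (K u) = B u ⟨(adjoint (S t) e, f), h⟩ := by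
    intro t
    by_cases ht : 0 < t
    -- For `t > 0` the operator `S(t)*` is bounded from `H` to `D(A*)` with its graph norm, so `K t`
    -- can be taken as the adjoint of `B* S(t)*`.
    · let R : H →L[ℂ] DStar A := ((adjoint (S t)).prod (adjoint (S' t))).codRestrict
        A.adjoint.graph fun e => hd.mem_adjoint_graph hS hA ht e
      refine ⟨adjoint ((controlAdjoint B).comp R), fun _ u e f h => ?_⟩
      have hf : f = adjoint (S' t) e :=
        LinearPMap_graph_unique h (hd.mem_adjoint_graph hS hA ht e)
      subst hf
      rw [adjoint_inner_right, comp_apply, inner_controlAdjoint]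
      rfl
    · exact ⟨0, fun h => absurd h ht⟩
  choose K hK using hex
  refine ⟨γ, hγ0, hγ1, K, fun t ht => hK t ht, c, hc, fun t ht => ?_⟩
  refine opNorm_le_bound _ (by have := ht.1; positivity) fun u => ?_
  -- Testing against `e = K t u` itself gives `‖K t u‖² ≤ c t^{-γ} ‖u‖ ‖K t u‖`.
  have h1 := hb t ht u (K t u) _ (hd.mem_adjoint_graph hS hA ht.1 (K t u))
  rw [← hK t ht.1 u (K t u), inner_self_eq_norm_sq_to_K, norm_pow, RCLike.norm_ofReal, abs_norm,
    sq] at h1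
  rcases (norm_nonneg (K t u)).eq_or_lt with h0 | h0
  · rw [← h0]
    have := ht.1
    positivity
  · exact le_of_mul_le_mul_right h1 h0

namespace IsControlKernel

variable {γ : ℝ} {K : ℝ → U →L[ℂ] H}

theorem add (hK : IsControlKernel A S B γ K) (hS : IsC0Semigroup S) (hA : IsGenerator A S)
    (hd : IsDifferentiableSemigroup S S') {s t : ℝ} (hs : 0 ≤ s) (ht : 0 < t) :
    K (s + t) = (S s).comp (K t) := by
  ext u
  refine ext_inner_left ℂ fun e => ?_
  have hst : 0 < s + t := by linarith
  have h1 := hd.mem_adjoint_graph hS hA hst e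
  have h2 : (adjoint (S t) (adjoint (S s) e), adjoint (S' (s + t)) e) ∈ A.adjoint.graph := by
    rwa [← hS.adjoint_add ht.le hs, add_comm t s]
  rw [hK.inner_eq _ hst u e _ h1, comp_apply, ← adjoint_inner_left,
    hK.inner_eq t ht u _ _ h2]
  congr 1
  refine Subtype.ext (Prod.ext ?_ rfl)
  simp only
  rw [← hS.adjoint_add ht.le hs, add_comm t s]

theorem continuousOn (hK : IsControlKernel A S B γ K) (hS : IsC0Semigroup S)
    (hA : IsGenerator A S) (hd : IsDifferentiableSemigroup S S') : ContinuousOn K (Ioi 0) := by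
  intro t ht
  have ht' : 0 < t := ht
  have h1 : ContinuousAt (fun s => (S (s - t / 2)).comp (K (t / 2))) t := by
    refine ContinuousAt.clm_comp (ContinuousAt.comp (g := S) ?_ (by fun_prop)) continuousAt_const
    exact (hd.hasDerivAt _ (by linarith)).continuousAt
  refine (h1.congr ?_).continuousWithinAt
  filter_upwards [lt_mem_nhds (by linarith : t / 2 < t)] with s hs
  rw [← hK.add hS hA hd (by linarith) (by linarith), sub_add_cancel]

theorem inner_of_mem_graph (hK : IsControlKernel A S B γ K) (hS : IsC0Semigroup S)
    (hA : IsGenerator A S) (hd : IsDifferentiableSemigroup S S') {t : ℝ} (ht : 0 < t) (u : U)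
    {e f : H} (h : (e, f) ∈ A.adjoint.graph) :
    inner ℂ e (K t u) = B u ⟨(adjoint (S t) e, adjoint (S t) f),
      adjoint_mem_adjoint_graph_of_commute hA (hd.dense_domain hS hA)
        (fun _ hs => hS.commute hs ht.le) h⟩ :=
  hK.inner_eq t ht u e _ _

end IsControlKernel

end Kernel

section Gramian

open ContinuousLinearMap

variable {X : Type*} [NormedAddCommGroup X] [InnerProductSpace ℂ X] [CompleteSpace X]
variable {U : Type*} [NormedAddCommGroup U] [InnerProductSpace ℂ U] [CompleteSpace U]

/-! ### Stabilization in finite dimension -/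

/-- The flow of a bounded operator. -/
def flow (M : X →L[ℂ] X) (t : ℝ) : X →L[ℂ] X := NormedSpace.exp (t • M)

theorem flow_zero (M : X →L[ℂ] X) : flow M 0 = 1 := by simp [flow]

theorem hasDerivAt_flow (M : X →L[ℂ] X) (t : ℝ) : HasDerivAt (flow M) (flow M t * M) t :=
  hasDerivAt_exp_smul_const M t

theorem hasDerivAt_flow' (M : X →L[ℂ] X) (t : ℝ) : HasDerivAt (flow M) (M * flow M t) t :=
  hasDerivAt_exp_smul_const' M t

theorem continuous_flow (M : X →L[ℂ] X) : Continuous (flow M) :=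
  continuous_iff_continuousAt.2 fun t => (hasDerivAt_flow M t).continuousAt

theorem flow_add (M : X →L[ℂ] X) (s t : ℝ) : flow M (s + t) = flow M s * flow M t := by
  let _ : NormedAlgebra ℚ (X →L[ℂ] X) := NormedAlgebra.restrictScalars ℚ ℝ _
  rw [flow, add_smul]
  exact NormedSpace.exp_add_of_commute (((Commute.refl M).smul_left s).smul_right t)

/-- The integrand of the Gramian. -/
def gramIntegrand (M : X →L[ℂ] X) (b : U →L[ℂ] X) (s : ℝ) : X →L[ℂ] X :=
  flow (-M) s * ((b.comp (adjoint b)) * adjoint (flow (-M) s))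

theorem inner_gramIntegrand (M : X →L[ℂ] X) (b : U →L[ℂ] X) (s : ℝ) (p : X) :
    inner ℂ p (gramIntegrand M b s p) = ((‖adjoint b (adjoint (flow (-M) s) p)‖ ^ 2 : ℝ) : ℂ) := by
  rw [gramIntegrand, mul_apply_eq_comp, mul_apply_eq_comp, comp_apply, ← adjoint_inner_left,
    ← adjoint_inner_left, inner_self_eq_norm_sq_to_K]
  push_cast
  rfl

theorem adjoint_gramIntegrand (M : X →L[ℂ] X) (b : U →L[ℂ] X) (s : ℝ) :
    adjoint (gramIntegrand M b s) = gramIntegrand M b s := by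
  change adjoint (flow (-M) s ∘L ((b ∘L adjoint b) ∘L adjoint (flow (-M) s))) = _
  rw [adjoint_comp, adjoint_comp, adjoint_comp, adjoint_adjoint, adjoint_adjoint]
  rfl

theorem hasDerivAt_gramIntegrand (M : X →L[ℂ] X) (b : U →L[ℂ] X) (s : ℝ) :
    HasDerivAt (gramIntegrand M b)
      (-(M * gramIntegrand M b s + gramIntegrand M b s * adjoint M)) s := by
  have h1 := hasDerivAt_flow' (-M) s
  have h2 := HasDerivAt.adjoint_clm (hasDerivAt_flow' (-M) s)
  refine (h1.mul (h2.const_mul (b.comp (adjoint b)))).congr_deriv ?_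
  have e : adjoint (-M * flow (-M) s) = -(adjoint (flow (-M) s) * adjoint M) := by
    change adjoint ((-M) ∘L flow (-M) s) = _
    rw [adjoint_comp, map_neg]
    ext; simp
  rw [e, gramIntegrand]
  noncomm_ring

theorem continuous_gramIntegrand (M : X →L[ℂ] X) (b : U →L[ℂ] X) :
    Continuous (gramIntegrand M b) :=
  continuous_iff_continuousAt.2 fun s => (hasDerivAt_gramIntegrand M b s).continuousAt

/-- The controllability Gramian on the time interval `[0, 1]`. -/
def gramian (M : X →L[ℂ] X) (b : U →L[ℂ] X) : X →L[ℂ] X := ∫ s in (0 : ℝ)..1, gramIntegrand M b s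

theorem inner_gramian (M : X →L[ℂ] X) (b : U →L[ℂ] X) (x y : X) :
    inner ℂ x (gramian M b y) = ∫ s in (0 : ℝ)..1, inner ℂ x (gramIntegrand M b s y) :=
  (((innerSL ℂ x).comp (ContinuousLinearMap.apply ℂ X y)).intervalIntegral_comp_comm
    ((continuous_gramIntegrand M b).intervalIntegrable 0 1)).symm

theorem inner_gramian_comm (M : X →L[ℂ] X) (b : U →L[ℂ] X) (x y : X) :
    inner ℂ (gramian M b x) y = inner ℂ x (gramian M b y) := by
  rw [← inner_conj_symm, inner_gramian, inner_gramian]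
  have h := (Complex.conjCLE.toContinuousLinearMap).intervalIntegral_comp_comm
    (((innerSL ℂ y).continuous.comp ((continuous_gramIntegrand M b).clm_apply
        (continuous_const (y := x)))).intervalIntegrable (μ := MeasureTheory.volume) 0 1)
  refine h.symm.trans (intervalIntegral.integral_congr fun s _ => ?_)
  change (starRingEnd ℂ) (inner ℂ y (gramIntegrand M b s x)) = _
  rw [inner_conj_symm, ← adjoint_inner_right, adjoint_gramIntegrand]

theorem inner_gramian_self (M : X →L[ℂ] X) (b : U →L[ℂ] X) (p : X) :
    inner ℂ p (gramian M b p) =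
      ((∫ s in (0 : ℝ)..1, ‖adjoint b (adjoint (flow (-M) s) p)‖ ^ 2 : ℝ) : ℂ) := by
  rw [inner_gramian, ← intervalIntegral.integral_ofReal]
  exact intervalIntegral.integral_congr fun s _ => inner_gramIntegrand M b s p

/-- The derivative of the integrand is minus the Lyapunov operator applied to it, so integration
over `[0, 1]` leaves the two boundary values. -/
theorem gramian_lyapunov (M : X →L[ℂ] X) (b : U →L[ℂ] X) :
    M * gramian M b + gramian M b * adjoint M = b.comp (adjoint b) - gramIntegrand M b 1 := by
  let Λ : (X →L[ℂ] X) →L[ℂ] (X →L[ℂ] X) :=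
    ContinuousLinearMap.mul ℂ _ M + (ContinuousLinearMap.mul ℂ _).flip (adjoint M)
  have h1 := Λ.intervalIntegral_comp_comm
    ((continuous_gramIntegrand M b).intervalIntegrable (μ := MeasureTheory.volume) 0 1)
  have hcont : Continuous fun s => -Λ (gramIntegrand M b s) :=
    (Λ.continuous.comp (continuous_gramIntegrand M b)).neg
  have h2 := intervalIntegral.integral_eq_sub_of_hasDerivAt (a := 0) (b := 1)
    (f := gramIntegrand M b) (f' := fun s => -Λ (gramIntegrand M b s))
    (fun s _ => hasDerivAt_gramIntegrand M b s) (hcont.intervalIntegrable 0 1)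
  rw [intervalIntegral.integral_neg, h1] at h2
  have h3 : gramIntegrand M b 0 = b.comp (adjoint b) := by
    rw [gramIntegrand, flow_zero, ← star_eq_adjoint (1 : X →L[ℂ] X), star_one, one_mul, mul_one]
  rw [h3] at h2
  have h4 : Λ (gramian M b) = M * gramian M b + gramian M b * adjoint M := rfl
  rw [← h4, gramian, ← neg_sub, ← h2, neg_neg]

theorem flow_neg (M : X →L[ℂ] X) (t : ℝ) : flow (-M) t = flow M (-t) := by
  simp [flow]

theorem flow_mul_flow_neg (M : X →L[ℂ] X) (t : ℝ) : flow M t * flow (-M) t = 1 := by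
  rw [flow_neg, ← flow_add, add_neg_cancel, flow_zero]

theorem adjoint_flow_hasDerivAt (M : X →L[ℂ] X) (s : ℝ) (p : X) :
    HasDerivAt (fun s => adjoint (flow (-M) s) p) (-(adjoint M (adjoint (flow (-M) s) p))) s := by
  have h2 := HasDerivAt.adjoint_clm (hasDerivAt_flow (-M) s)
  have h3 := ((ContinuousLinearMap.apply ℂ X p).restrictScalars ℝ).hasFDerivAt.comp_hasDerivAt s h2
  refine h3.congr_deriv ?_
  change adjoint (flow (-M) s ∘L (-M)) p = _
  rw [adjoint_comp, map_neg]
  simp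

theorem adjoint_flow_neg_hasDerivAt (M : X →L[ℂ] X) (s : ℝ) (p : X) :
    HasDerivAt (fun s => adjoint (flow (-M) s) p) (-(adjoint (flow (-M) s) (adjoint M p))) s := by
  have h2 := HasDerivAt.adjoint_clm (hasDerivAt_flow' (-M) s)
  have h3 := ((ContinuousLinearMap.apply ℂ X p).restrictScalars ℝ).hasFDerivAt.comp_hasDerivAt s h2
  refine h3.congr_deriv ?_
  change adjoint ((-M) ∘L flow (-M) s) p = _
  rw [adjoint_comp, map_neg]
  simp

/-- The vectors `p` whose observation `b* e^{-s M*} p` vanishes on `[0, 1]` form an `M*`-invariant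
subspace: differentiate inside the interval and close up at the endpoints. Were it nonzero, it would
contain an eigenvector of `M*`, killed by `b*` at `s = 0`, against the Hautus condition. -/
theorem gramian_pos [FiniteDimensional ℂ X] {M : X →L[ℂ] X} {b : U →L[ℂ] X}
    (h : ∀ (p : X) (c : ℂ), adjoint M p = c • p → adjoint b p = 0 → p = 0) {p : X} (hp : p ≠ 0) :
    0 < (inner ℂ p (gramian M b p)).re := by
  rw [inner_gramian_self, Complex.ofReal_re]
  let N : Submodule ℂ X :=
    { carrier := {p | ∀ s ∈ Icc (0 : ℝ) 1, adjoint b (adjoint (flow (-M) s) p) = 0}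
      add_mem' := fun hx hy s hs => by rw [map_add, map_add, hx s hs, hy s hs, add_zero]
      zero_mem' := fun s _ => by rw [map_zero, map_zero]
      smul_mem' := fun c x hx s hs => by rw [map_smul, map_smul, hx s hs, smul_zero] }
  have hcont : ∀ q, Continuous fun s => adjoint b (adjoint (flow (-M) s) q) := fun q =>
    (adjoint b).continuous.comp (continuous_iff_continuousAt.2
      fun s => (adjoint_flow_neg_hasDerivAt M s q).continuousAt)
  have hinv : ∀ x ∈ N, adjoint M x ∈ N := by
    intro x hx
    have hopen : ∀ s ∈ Ioo (0 : ℝ) 1, adjoint b (adjoint (flow (-M) s) (adjoint M x)) = 0 := by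
      intro s hs
      have h1 := ((adjoint b).restrictScalars ℝ).hasFDerivAt.comp_hasDerivAt s
        (adjoint_flow_neg_hasDerivAt M s x)
      have h2 : HasDerivAt (fun s => adjoint b (adjoint (flow (-M) s) x)) 0 s := by
        refine (hasDerivAt_const s (0 : U)).congr_of_eventuallyEq ?_
        filter_upwards [Ioo_mem_nhds hs.1 hs.2] with r hr using hx r (Ioo_subset_Icc_self hr)
      have h3 := h1.unique h2
      simpa using h3
    have hcl : closure (Ioo (0 : ℝ) 1) ⊆
        {s | adjoint b (adjoint (flow (-M) s) (adjoint M x)) = 0} :=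
      closure_minimal hopen (isClosed_eq (hcont _) continuous_const)
    rw [closure_Ioo zero_ne_one] at hcl
    exact hcl
  have hbot : N = ⊥ := by
    by_contra hne
    have : Nontrivial N := Submodule.nontrivial_iff_ne_bot.2 hne
    obtain ⟨c, hc⟩ := Module.End.exists_eigenvalue
      (((adjoint M : X →L[ℂ] X) : X →ₗ[ℂ] X).restrict hinv)
    obtain ⟨v, hv⟩ := hc.exists_hasEigenvector
    have h1 : adjoint M (v : X) = c • (v : X) := congrArg Subtype.val hv.apply_eq_smul
    have h2 : adjoint b (v : X) = 0 := by
      have := v.2 0 ⟨le_rfl, zero_le_one⟩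
      rwa [flow_zero, ← star_eq_adjoint (1 : X →L[ℂ] X), star_one, one_apply_eq_self] at this
    exact hv.2 (Subtype.ext (h _ c h1 h2))
  have hpN : p ∉ N := by rw [hbot]; exact hp
  have hex : ∃ s ∈ Icc (0 : ℝ) 1, adjoint b (adjoint (flow (-M) s) p) ≠ 0 := by
    by_contra! hall
    exact hpN hall
  obtain ⟨s, hs, hs0⟩ := hex
  exact intervalIntegral.integral_pos zero_lt_one ((hcont p).norm.pow 2).continuousOn
    (fun _ _ => by positivity) ⟨s, hs, by positivity⟩

theorem exists_pos_le_inner [FiniteDimensional ℂ X] {W : X →L[ℂ] X}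
    (h : ∀ p : X, p ≠ 0 → 0 < (inner ℂ p (W p)).re) :
    ∃ c > 0, ∀ p : X, c * ‖p‖ ^ 2 ≤ (inner ℂ p (W p)).re := by
  rcases subsingleton_or_nontrivial X with hX | hX
  · exact ⟨1, one_pos, fun p => by simp [Subsingleton.elim p 0]⟩
  have : ProperSpace X := FiniteDimensional.proper ℂ X
  have hne : (Metric.sphere (0 : X) 1).Nonempty := by
    obtain ⟨x, hx⟩ := exists_ne (0 : X)
    refine ⟨((‖x‖⁻¹ : ℝ) : ℂ) • x, ?_⟩
    rw [mem_sphere_zero_iff_norm, norm_smul, Complex.norm_real, norm_inv, norm_norm]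
    exact inv_mul_cancel₀ (norm_ne_zero_iff.2 hx)
  obtain ⟨q, hq, hmin⟩ := (isCompact_sphere (0 : X) 1).exists_isMinOn hne
    (f := fun p => (inner ℂ p (W p)).re) (by fun_prop)
  have hq0 : q ≠ 0 := by
    rintro rfl
    simp at hq
  refine ⟨_, h q hq0, fun p => ?_⟩
  rcases eq_or_ne p 0 with rfl | hp
  · simp
  have hp' : ‖p‖ ≠ 0 := norm_ne_zero_iff.2 hp
  have h1 := hmin (show ((‖p‖⁻¹ : ℝ) : ℂ) • p ∈ Metric.sphere (0 : X) 1 by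
    rw [mem_sphere_zero_iff_norm, norm_smul, Complex.norm_real, norm_inv, norm_norm]
    exact inv_mul_cancel₀ hp')
  simp only [map_smul, inner_smul_left, inner_smul_right, Complex.conj_ofReal, mem_ofPred_eq,
    Complex.re_ofReal_mul] at h1
  calc _ ≤ ‖p‖⁻¹ * (‖p‖⁻¹ * (inner ℂ p (W p)).re) * ‖p‖ ^ 2 := by gcongr
    _ = _ := by field_simp

/-- Stabilization with an arbitrary decay rate under the Hautus condition. -/
theorem exists_stabilizing_feedback [FiniteDimensional ℂ X] (M : X →L[ℂ] X) (b : U →L[ℂ] X)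
    (h : ∀ (p : X) (c : ℂ), adjoint M p = c • p → adjoint b p = 0 → p = 0) (β : ℝ) :
    ∃ F : X →L[ℂ] U, ∃ C > 0, ∀ t : ℝ, 0 ≤ t →
      ‖flow (M + b.comp F) t‖ ≤ C * Real.exp (-β * t) := by
  -- The shift by `β` produces the prescribed rate and does not affect the Hautus condition.
  set N : X →L[ℂ] X := M + (β : ℂ) • 1 with hN
  have hN' : ∀ (p : X) (c : ℂ), adjoint N p = c • p → adjoint b p = 0 → p = 0 := by
    intro p c hp hb
    refine h p (c - β) ?_ hb
    rw [hN, map_add, map_smulₛₗ, ← star_eq_adjoint (1 : X →L[ℂ] X), star_one, Complex.conj_ofReal]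
      at hp
    rw [sub_smul, ← hp]
    simp
  set W := gramian N b with hW
  have hpos : ∀ p : X, p ≠ 0 → 0 < (inner ℂ p (W p)).re := fun p hp => gramian_pos hN' hp
  have hinj : Function.Injective (W : X →ₗ[ℂ] X) := by
    rw [injective_iff_map_eq_zero]
    intro p hp
    by_contra hne
    have := hpos p hne
    rw [show W p = 0 from hp, inner_zero_right] at this
    simp at this
  let We := (LinearEquiv.ofInjectiveEndo (W : X →ₗ[ℂ] X) hinj).toContinuousLinearEquiv
  let V : X →L[ℂ] X := (We.symm : X →L[ℂ] X)
  have hWV : ∀ x, W (V x) = x := fun x => We.apply_symm_apply x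
  obtain ⟨c, hc, hcW⟩ := exists_pos_le_inner hpos
  set F : X →L[ℂ] U := -((adjoint b).comp V) with hF
  set P : X →L[ℂ] X := M + b.comp F with hP
  have hlyap := gramian_lyapunov N b
  rw [← hW] at hlyap
  -- With `F = -b* W⁻¹` the feedback subtracts `2 ‖b* p‖²`, which outweighs the `‖b* p‖²` in the
  -- Lyapunov identity; the remaining boundary term has a good sign.
  have key : ∀ p : X, 2 * (inner ℂ p (P (W p))).re ≤ -(2 * β) * (inner ℂ p (W p)).re := by
    intro p
    have hVW : V (W p) = p := We.symm_apply_apply p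
    have e1 : P (W p) = M (W p) - b (adjoint b p) := by
      simp [hP, hF, hVW, sub_eq_add_neg]
    have e2 := congrArg (fun T : X →L[ℂ] X => (inner ℂ p (T p)).re) hlyap
    simp only [add_apply, sub_apply, mul_apply_eq_comp, comp_apply, inner_add_right,
      inner_sub_right, Complex.add_re, Complex.sub_re] at e2
    rw [inner_gramIntegrand, Complex.ofReal_re] at e2
    have e3 : (inner ℂ p (W (adjoint N p))).re = (inner ℂ p (N (W p))).re := by
      rw [← inner_gramian_comm, adjoint_inner_right, ← inner_conj_symm, Complex.conj_re]
    have e4 : (inner ℂ p (N (W p))).re = (inner ℂ p (M (W p))).re + β * (inner ℂ p (W p)).re := by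
      simp [hN]
    have e5 : 0 ≤ (inner ℂ p (b (adjoint b p))).re := by
      rw [← adjoint_inner_left, inner_self_eq_norm_sq_to_K, ← RCLike.ofReal_pow]
      exact sq_nonneg ‖adjoint b p‖
    rw [e1, inner_sub_right, Complex.sub_re]
    nlinarith [sq_nonneg ‖adjoint b (adjoint (flow (-N) 1) p)‖]
  -- Adding 1 gives `C ≤ C²`, so the estimate of the squared norm can be absorbed into `C²` without
  -- a square root.
  set C := ‖W‖ ^ 2 * ‖V‖ / c + 1 with hC
  have hC1 : 1 ≤ C := by
    have : 0 ≤ ‖W‖ ^ 2 * ‖V‖ / c := by positivity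
    linarith
  refine ⟨F, C, by positivity, fun t ht => ?_⟩
  refine opNorm_le_bound _ (by positivity) fun z₀ => ?_
  -- In the variable `p = W⁻¹ z` the Lyapunov function `(W⁻¹ z | z)` is `(p | W p)`, and `key` says
  -- that `e^{2 β t}` times it does not increase.
  set p : ℝ → X := fun t => V (flow P t z₀) with hp
  have hpd : ∀ t, HasDerivAt p (V (P (flow P t z₀))) t := fun t =>
    ((V.comp (ContinuousLinearMap.apply ℂ X z₀ : (X →L[ℂ] X) →L[ℂ] X)).restrictScalars
      ℝ).hasFDerivAt.comp_hasDerivAt t (hasDerivAt_flow' P t)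
  have hWp : ∀ t, W (p t) = flow P t z₀ := fun t => hWV _
  have hLd : ∀ t, HasDerivAt (fun t => Real.exp (2 * β * t) * (inner ℂ (p t) (W (p t))).re)
      (Real.exp (2 * β * t) * (2 * β * (inner ℂ (p t) (W (p t))).re +
        2 * (inner ℂ (p t) (P (W (p t)))).re)) t := by
    intro t
    have d1 : HasDerivAt (fun t => W (p t)) (P (W (p t))) t := by
      have := (W.restrictScalars ℝ).hasFDerivAt.comp_hasDerivAt t (hpd t)
      refine this.congr_deriv ?_
      rw [hWp]
      exact hWV _
    have d2 := (hpd t).inner ℂ d1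
    have d3 := Complex.reCLM.hasFDerivAt.comp_hasDerivAt t d2
    have d4 : HasDerivAt (fun t : ℝ => Real.exp (2 * β * t))
        (Real.exp (2 * β * t) * (2 * β * 1)) t := ((hasDerivAt_id t).const_mul (2 * β)).exp
    refine (d4.mul d3).congr_deriv ?_
    simp only [Complex.reCLM_apply, Complex.add_re, Function.comp_apply]
    have e6 : (inner ℂ (V (P (flow P t z₀))) (W (p t))).re = (inner ℂ (p t) (P (W (p t)))).re := by
      rw [← inner_gramian_comm, ← hW, hWV, ← inner_conj_symm, Complex.conj_re, hWp]
    rw [e6]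
    ring
  have hanti : Antitone fun t => Real.exp (2 * β * t) * (inner ℂ (p t) (W (p t))).re := by
    refine antitone_of_deriv_nonpos (fun t => (hLd t).differentiableAt) fun t => ?_
    rw [(hLd t).deriv]
    refine mul_nonpos_of_nonneg_of_nonpos (Real.exp_pos _).le ?_
    linarith [key (p t)]
  have h0 := hanti ht
  simp only [mul_zero, Real.exp_zero, one_mul] at h0
  have hfl0 : flow P 0 z₀ = z₀ := by rw [flow_zero]; rfl
  have hz0 : (inner ℂ (p 0) (W (p 0))).re ≤ ‖V‖ * ‖z₀‖ ^ 2 := by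
    rw [hWp, hfl0]
    calc _ ≤ ‖inner ℂ (p 0) z₀‖ := Complex.re_le_norm _
      _ ≤ ‖p 0‖ * ‖z₀‖ := norm_inner_le_norm _ _
      _ ≤ (‖V‖ * ‖z₀‖) * ‖z₀‖ := by
        gcongr
        simp only [hp, hfl0]
        exact V.le_opNorm z₀
      _ = _ := by ring
  have hzt : ‖flow P t z₀‖ ^ 2 ≤ ‖W‖ ^ 2 * ‖p t‖ ^ 2 := by
    rw [← hWp, ← mul_pow]
    exact pow_le_pow_left₀ (norm_nonneg _) (W.le_opNorm _) 2
  have hexp : Real.exp (2 * β * t) * Real.exp (-β * t) ^ 2 = 1 := by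
    rw [sq, ← Real.exp_add, ← Real.exp_add, ← Real.exp_zero]; ring_nf
  refine le_of_sq_le_sq ?_ (by positivity)
  have hstep : Real.exp (2 * β * t) * ‖flow P t z₀‖ ^ 2 ≤ ‖W‖ ^ 2 * ‖V‖ / c * ‖z₀‖ ^ 2 := by
    have h1 := hcW (p t)
    calc Real.exp (2 * β * t) * ‖flow P t z₀‖ ^ 2
        ≤ Real.exp (2 * β * t) * (‖W‖ ^ 2 * ‖p t‖ ^ 2) := by gcongr
      _ = ‖W‖ ^ 2 / c * (Real.exp (2 * β * t) * (c * ‖p t‖ ^ 2)) := by field_simp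
      _ ≤ ‖W‖ ^ 2 / c * (Real.exp (2 * β * t) * (inner ℂ (p t) (W (p t))).re) := by gcongr
      _ ≤ ‖W‖ ^ 2 / c * (‖V‖ * ‖z₀‖ ^ 2) :=
        mul_le_mul_of_nonneg_left (h0.trans hz0) (by positivity)
      _ = _ := by ring
  calc ‖flow P t z₀‖ ^ 2 = (Real.exp (2 * β * t) * ‖flow P t z₀‖ ^ 2) * Real.exp (-β * t) ^ 2 := by
        rw [mul_right_comm, hexp, one_mul]
    _ ≤ (‖W‖ ^ 2 * ‖V‖ / c * ‖z₀‖ ^ 2) * Real.exp (-β * t) ^ 2 := by gcongr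
    _ ≤ (C ^ 2 * ‖z₀‖ ^ 2) * Real.exp (-β * t) ^ 2 := by
        gcongr
        nlinarith
    _ = _ := by ring

end Gramian

section WeakSolutions

open ContinuousLinearMap

variable {H : Type*} [NormedAddCommGroup H] [InnerProductSpace ℂ H] [CompleteSpace H]
variable {U : Type*} [NormedAddCommGroup U] [InnerProductSpace ℂ U]
variable {A : H →ₗ.[ℂ] H} {S S' : ℝ → H →L[ℂ] H} {B : U →L[ℂ] DStarDual A} {σ : ℝ}

/-! ### Weak solutions -/

-- A product rule in which `y` is only continuous and its pairing with the frozen vector `p t` is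
-- differentiable. The remaining term pairs a difference quotient of `p` with `y`, for which
-- continuity of `y` suffices.
omit [CompleteSpace H] in
theorem HasDerivWithinAt.inner_weak {p y : ℝ → H} {p' : H} {d : ℂ} {s : Set ℝ} {t : ℝ}
    (hp : HasDerivWithinAt p p' s t) (hy : ContinuousWithinAt y s t)
    (hd : HasDerivWithinAt (fun r => inner ℂ (p t) (y r)) d s t) :
    HasDerivWithinAt (fun r => inner ℂ (p r) (y r)) (inner ℂ p' (y t) + d) s t := by
  have h1 : HasDerivWithinAt (fun r => inner ℂ (p r - p t) (y r)) (inner ℂ p' (y t)) s t := by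
    rw [hasDerivWithinAt_iff_tendsto_slope] at hp ⊢
    have h2 : Tendsto y (𝓝[s \ {t}] t) (𝓝 (y t)) :=
      hy.tendsto.mono_left (nhdsWithin_mono _ sdiff_subset)
    refine (hp.inner h2).congr fun r => ?_
    rw [slope_def_module, slope_def_module, sub_self, inner_zero_left, sub_zero,
      inner_smul_left_eq_smul]
  refine (h1.add hd).congr_of_eventuallyEq (Eventually.of_forall fun r => ?_) ?_ <;>
    simp

theorem IsDifferentiableSemigroup.hasDerivWithinAt_adjoint_apply (hS : IsC0Semigroup S)
    (hA : IsGenerator A S) (hd : IsDifferentiableSemigroup S S') {e f : H}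
    (h : (e, f) ∈ A.adjoint.graph) {t : ℝ} (ht : 0 ≤ t) :
    HasDerivWithinAt (fun t => adjoint (S t) e) (adjoint (S t) f) (Ici 0) t := by
  have hpos : ∀ t, 0 < t → HasDerivAt (fun t => adjoint (S t) e) (adjoint (S t) f) t := by
    intro t ht
    have := hd.hasDerivAt_adjoint_apply ht e
    rwa [hd.adjoint_deriv_apply hS hA ht h] at this
  rcases ht.eq_or_lt with rfl | h0
  · refine hasDerivWithinAt_Ici_of_tendsto_deriv (s := Ioi 0)
      (fun t ht => (hpos t ht).differentiableAt.differentiableWithinAt) ?_ self_mem_nhdsWithin ?_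
    · exact (hd.continuousOn_adjoint_apply hS e 0 self_mem_Ici).mono Ioi_subset_Ici_self
    · rw [hS.zero, ← star_eq_adjoint, star_one]
      refine (hd.tendsto_adjoint_apply_zero hS f).congr' ?_
      filter_upwards [self_mem_nhdsWithin] with t ht
      exact (hpos t ht).deriv.symm
  · exact (hpos t h0).hasDerivWithinAt

theorem eq_of_hasDerivWithinAt_zero {g : ℝ → ℂ} {T : ℝ}
    (h : ∀ t ∈ Ico 0 T, HasDerivWithinAt g 0 (Ici 0) t) {t : ℝ} (ht : t ∈ Ico 0 T) :
    g t = g 0 := by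
  refine constant_of_has_deriv_right_zero (a := 0) (b := t) (fun s hs => ?_) (fun s hs => ?_) t
    ⟨ht.1, le_rfl⟩
  · exact (h s ⟨hs.1, hs.2.trans_lt ht.2⟩).continuousWithinAt.mono Icc_subset_Ici_self
  · exact (h s ⟨hs.1, hs.2.trans ht.2⟩).mono (Ici_subset_Ici.2 hs.1)

/-- Uniqueness for the homogeneous equation. -/
theorem IsSolution.eq_zero (hS : IsC0Semigroup S) (hA : IsGenerator A S)
    (hd : IsDifferentiableSemigroup S S') {y : ℝ → H} (hy : IsSolution A σ B (fun _ => 0) y)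
    (h0 : y 0 = 0) {t : ℝ} (ht : 0 ≤ t) : y t = 0 := by
  rcases ht.eq_or_lt with rfl | hpos
  · exact h0
  refine ext_inner_left ℂ fun e => ?_
  rw [inner_zero_right]
  -- This solves the backward adjoint equation and lies in `D(A*)` for `s < t`, so its pairing with
  -- `y` is constant on `[0, t)`. The limit `s → t` recovers `(y(t) | e)` up to a positive factor.
  set p : ℝ → H := fun s => Real.exp (-σ * s) • adjoint (S (t - s)) e with hp
  have hder : ∀ s ∈ Ico 0 t, HasDerivWithinAt (fun s => inner ℂ (p s) (y s)) 0 (Ici 0) s := by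
    intro s hs
    have hts : 0 < t - s := sub_pos.2 hs.2
    have h1 : HasDerivAt (fun s => adjoint (S (t - s)) e) (-(adjoint (S' (t - s)) e)) s := by
      exact (hd.hasDerivAt_adjoint_apply hts e).comp_const_sub t s
    have h2 : HasDerivAt (fun s : ℝ => Real.exp (-σ * s)) (Real.exp (-σ * s) * (-σ * 1)) s :=
      ((hasDerivAt_id s).const_mul (-σ)).exp
    have hmem : (p s, Real.exp (-σ * s) • adjoint (S' (t - s)) e) ∈ A.adjoint.graph := by
      have := A.adjoint.graph.smul_mem ((Real.exp (-σ * s) : ℝ) : ℂ)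
        (hd.mem_adjoint_graph hS hA hts e)
      simpa only [Prod.smul_mk, Complex.coe_smul] using this
    have h3 := hy.2 ⟨_, hmem⟩ s hs.1
    simp only [map_zero, zero_apply, add_zero] at h3
    refine (HasDerivWithinAt.inner_weak (h2.smul h1).hasDerivWithinAt (hy.1 s hs.1)
      h3).congr_deriv ?_
    have e1 : (Real.exp (-σ * s) • -(adjoint (S' (t - s)) e) +
        (Real.exp (-σ * s) * (-σ * 1)) • adjoint (S (t - s)) e) =
        -(Real.exp (-σ * s) • adjoint (S' (t - s)) e) - σ • p s := by
      simp only [hp]; module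
    rw [e1, inner_sub_left, inner_neg_left, inner_smul_left_eq_smul (p s) (y s) σ,
      Complex.real_smul]
    ring
  have hconst : ∀ s ∈ Ico 0 t, inner ℂ (p s) (y s) = 0 := by
    intro s hs
    rw [eq_of_hasDerivWithinAt_zero hder hs, h0, inner_zero_right]
  have hlim : Tendsto (fun s => inner ℂ (p s) (y s)) (𝓝[<] t)
      (𝓝 (inner ℂ (Real.exp (-σ * t) • e) (y t))) := by
    refine Tendsto.inner ?_ ?_
    · have h1 : Tendsto (fun s : ℝ => t - s) (𝓝[<] t) (𝓝[>] 0) := by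
        refine tendsto_nhdsWithin_iff.2 ⟨?_, ?_⟩
        · have : Tendsto (fun s : ℝ => t - s) (𝓝 t) (𝓝 (t - t)) := by
            exact (continuous_const.sub continuous_id).tendsto t
          rw [sub_self] at this
          exact this.mono_left nhdsWithin_le_nhds
        · filter_upwards [self_mem_nhdsWithin] with s hs using sub_pos.2 (mem_Iio.1 hs)
      have h2 : Tendsto (fun s : ℝ => Real.exp (-σ * s)) (𝓝[<] t) (𝓝 (Real.exp (-σ * t))) := by
        have : Continuous fun s : ℝ => Real.exp (-σ * s) := by fun_prop
        exact (this.tendsto t).mono_left nhdsWithin_le_nhds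
      exact h2.smul ((hd.tendsto_adjoint_apply_zero hS e).comp h1)
    · have : ContinuousAt y t := (hy.1 t ht).continuousAt (Ici_mem_nhds hpos)
      exact this.tendsto.mono_left nhdsWithin_le_nhds
  have hz : inner ℂ (Real.exp (-σ * t) • e) (y t) = 0 := by
    refine tendsto_nhds_unique (hlim.congr' ?_) tendsto_const_nhds
    filter_upwards [Ico_mem_nhdsLT hpos] with s hs using hconst s hs
  rw [inner_smul_left_eq_smul, smul_eq_zero] at hz
  exact hz.resolve_left (Real.exp_pos _).ne'

theorem IsSolution.sub {u v : ℝ → U} {y w : ℝ → H} (hy : IsSolution A σ B u y)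
    (hw : IsSolution A σ B v w) :
    IsSolution A σ B (fun t => u t - v t) (fun t => y t - w t) := by
  refine ⟨hy.1.sub hw.1, fun e t ht => ?_⟩
  simp only [inner_sub_right]
  refine ((hy.2 e t ht).sub (hw.2 e t ht)).congr_deriv ?_
  rw [map_sub, sub_apply]
  ring

/-! ### The unstable component of a solution -/

/-- `b` is the control operator of the unstable part. -/
def IsReducedControl (D : SpectralSplitting A S σ) (B : U →L[ℂ] DStarDual A) (b : U →L[ℂ] D.X) :
    Prop :=
  ∀ (u : U) (p : D.X) (f : H) (h : (adjoint D.L p, f) ∈ A.adjoint.graph),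
    inner ℂ p (b u) = B u ⟨(adjoint D.L p, f), h⟩

theorem exists_isReducedControl [CompleteSpace U] (hA : IsGenerator A S)
    (hdense : Dense (A.domain : Set H)) (D : SpectralSplitting A S σ) :
    ∃ b, IsReducedControl D B b := by
  let R : D.X →L[ℂ] DStar A := ((adjoint D.L).prod ((adjoint D.L).comp (adjoint D.M))).codRestrict
    A.adjoint.graph fun p => D.adjoint_L_mem_graph hA hdense p
  refine ⟨adjoint ((controlAdjoint B).comp R), fun u p f h => ?_⟩
  have hf := LinearPMap_graph_unique h (D.adjoint_L_mem_graph hA hdense p)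
  subst hf
  rw [adjoint_inner_right, comp_apply, inner_controlAdjoint]
  rfl

/-- The generator of the closed loop on the unstable subspace. -/
def SpectralSplitting.closedLoop (D : SpectralSplitting A S σ) (b : U →L[ℂ] D.X)
    (F : D.X →L[ℂ] U) : D.X →L[ℂ] D.X :=
  D.M + (σ : ℂ) • 1 + b.comp F

/-- Since the feedback depends on `y` only through `L y`, testing the equation with `L* p` yields an
autonomous linear equation on `X`, solved by pairing with the backward flow. -/
theorem IsSolution.L_eq_flow (hA : IsGenerator A S) (hdense : Dense (A.domain : Set H))
    {D : SpectralSplitting A S σ} {b : U →L[ℂ] D.X} (hb : IsReducedControl D B b)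
    {F : D.X →L[ℂ] U} {y : ℝ → H} (hy : IsSolution A σ B (fun t => F (D.L (y t))) y)
    {t : ℝ} (ht : 0 ≤ t) : D.L (y t) = flow (D.closedLoop b F) t (D.L (y 0)) := by
  set P := D.closedLoop b F with hP
  have hz : ∀ (p : D.X) (t : ℝ), 0 ≤ t → HasDerivWithinAt (fun s => inner ℂ p (D.L (y s)))
      (inner ℂ p (P (D.L (y t)))) (Ici 0) t := by
    intro p t ht
    have h1 := hy.2 ⟨_, D.adjoint_L_mem_graph hA hdense p⟩ t ht
    simp only [adjoint_inner_left] at h1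
    refine h1.congr_deriv ?_
    rw [← hb, hP, SpectralSplitting.closedLoop]
    simp
  have hconst : ∀ p : D.X, inner ℂ p (flow (-P) t (D.L (y t))) = inner ℂ p (D.L (y 0)) := by
    intro p
    have hder : ∀ s ∈ Ico 0 (t + 1), HasDerivWithinAt
        (fun s => inner ℂ (adjoint (flow (-P) s) p) (D.L (y s))) 0 (Ici 0) s := by
      intro s hs
      have h1 := adjoint_flow_hasDerivAt P s p
      refine (HasDerivWithinAt.inner_weak h1.hasDerivWithinAt
        (D.L.continuous.continuousAt.comp_continuousWithinAt (hy.1 s hs.1))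
        (hz _ s hs.1)).congr_deriv ?_
      rw [inner_neg_left, adjoint_inner_left]
      exact neg_add_cancel _
    have h2 := eq_of_hasDerivWithinAt_zero hder (t := t) ⟨ht, by linarith⟩
    rw [adjoint_inner_left, adjoint_inner_left, flow_zero] at h2
    exact h2
  have h3 : flow (-P) t (D.L (y t)) = D.L (y 0) := ext_inner_left ℂ hconst
  rw [← h3, ← mul_apply_eq_comp, flow_mul_flow_neg, one_apply_eq_self]

/-- Equal initial values give equal unstable components, hence equal controls, so the difference
solves the homogeneous equation. -/
theorem IsSolution.unique (hS : IsC0Semigroup S) (hA : IsGenerator A S)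
    (hd : IsDifferentiableSemigroup S S') {D : SpectralSplitting A S σ} {b : U →L[ℂ] D.X}
    (hb : IsReducedControl D B b) {F : D.X →L[ℂ] U} {y w : ℝ → H}
    (hy : IsSolution A σ B (fun t => F (D.L (y t))) y)
    (hw : IsSolution A σ B (fun t => F (D.L (w t))) w) (h0 : y 0 = w 0) {t : ℝ} (ht : 0 ≤ t) :
    y t = w t := by
  have hdense := hd.dense_domain hS hA
  have h1 := hy.sub hw
  have h2 : IsSolution A σ B (fun _ => 0) (fun t => y t - w t) := by
    refine ⟨h1.1, fun e t ht => ?_⟩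
    have h3 := h1.2 e t ht
    have h4 : F (D.L (y t)) - F (D.L (w t)) = 0 := by
      rw [hy.L_eq_flow hA hdense hb ht, hw.L_eq_flow hA hdense hb ht, h0, sub_self]
    simpa only [h4] using h3
  exact sub_eq_zero.1 (h2.eq_zero hS hA hd (by simp only [h0, sub_self]) ht)

end WeakSolutions

section Convolution

open ContinuousLinearMap MeasureTheory

variable {H : Type*} [NormedAddCommGroup H] [InnerProductSpace ℂ H] [CompleteSpace H]
variable {U : Type*} [NormedAddCommGroup U] [InnerProductSpace ℂ U]
variable {X : Type*} [NormedAddCommGroup X] [InnerProductSpace ℂ X] [CompleteSpace X]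

theorem HasDerivWithinAt.clm_bilin {E F G : Type*} [NormedAddCommGroup E] [NormedSpace ℂ E]
    [NormedAddCommGroup F] [NormedSpace ℂ F] [NormedAddCommGroup G] [NormedSpace ℂ G]
    (L : E →L[ℂ] F →L[ℂ] G) {u : ℝ → E} {v : ℝ → F} {u' : E} {v' : F} {s : Set ℝ} {t : ℝ}
    (hu : HasDerivWithinAt u u' s t) (hv : HasDerivWithinAt v v' s t) :
    HasDerivWithinAt (fun t => L (u t) (v t)) (L (u t) v' + L u' (v t)) s t :=
  (L.bilinearRestrictScalars ℝ).hasDerivWithinAt_of_bilinear hu hv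

/-! ### Convolutions of a kernel with an exponential -/

/-- `∫_0^t k(r) F e^{-rP} dr`. -/
def convolution (k : ℝ → U →L[ℂ] H) (F : X →L[ℂ] U) (P : X →L[ℂ] X) (t : ℝ) : X →L[ℂ] H :=
  ∫ r in (0 : ℝ)..t, (k r).comp (F.comp (flow (-P) r))

variable {k : ℝ → U →L[ℂ] H} {F : X →L[ℂ] U} {P : X →L[ℂ] X}

theorem intervalIntegrable_convolution (hk : Integrable k) (a b : ℝ) :
    IntervalIntegrable (fun r => (k r).comp (F.comp (flow (-P) r))) volume a b := by
  have h1 : Continuous fun r => F.comp (flow (-P) r) :=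
    continuous_const.clm_comp (continuous_flow _)
  refine IntervalIntegrable.mono_fun
    (f := fun r => ‖k r‖ * ‖F.comp (flow (-P) r)‖) ?_ ?_ ?_
  · exact hk.norm.intervalIntegrable.mul_continuousOn h1.norm.continuousOn
  · have h2 : AEStronglyMeasurable (fun r => compL ℂ X U H (k r) (F.comp (flow (-P) r))) volume :=
      (compL ℂ X U H).aestronglyMeasurable_comp₂ hk.1 h1.aestronglyMeasurable
    exact h2.restrict
  · refine Eventually.of_forall fun r => ?_
    simp only [norm_mul, norm_norm]
    exact opNorm_comp_le _ _

theorem continuous_convolution (hk : Integrable k) : Continuous (convolution k F P) :=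
  intervalIntegral.continuous_primitive (intervalIntegrable_convolution hk) 0

/-- Composition with `flow P t` restores the Duhamel integral with weight `e^{(t - r) P}`, and the
bound `e^{-β (t - r)}` splits into `e^{-β t}` and a factor absorbed by the kernel. -/
theorem norm_convolution_comp_flow_le {β C : ℝ} (hC : 0 ≤ C)
    (hβ : Integrable fun r => Real.exp (β * r) * ‖k r‖) (hk : Integrable k)
    (hP : ∀ t, 0 ≤ t → ‖flow P t‖ ≤ C * Real.exp (-β * t)) {t : ℝ} (ht : 0 ≤ t) :
    ‖(convolution k F P t).comp (flow P t)‖ ≤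
      ‖F‖ * C * (∫ r, Real.exp (β * r) * ‖k r‖) * Real.exp (-β * t) := by
  have h1 : (convolution k F P t).comp (flow P t) =
      ∫ r in (0 : ℝ)..t, (k r).comp (F.comp (flow P (t - r))) := by
    have h2 := ((compL ℂ X X H).flip (flow P t)).intervalIntegral_comp_comm
      (intervalIntegrable_convolution (F := F) (P := P) hk 0 t)
    rw [flip_apply, compL_apply] at h2
    rw [convolution, ← h2]
    refine intervalIntegral.integral_congr fun r _ => ?_
    simp only [flip_apply, compL_apply]
    rw [comp_assoc, comp_assoc, flow_neg, ← mul_def, ← flow_add, neg_add_eq_sub]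
  have hle : ‖∫ r in (0 : ℝ)..t, (k r).comp (F.comp (flow P (t - r)))‖ ≤
      ∫ r in (0 : ℝ)..t, ‖F‖ * C * Real.exp (-β * t) * (Real.exp (β * r) * ‖k r‖) := by
    refine intervalIntegral.norm_integral_le_of_norm_le ht
      (Eventually.of_forall fun r hr => ?_) (hβ.const_mul _).intervalIntegrable
    calc ‖(k r).comp (F.comp (flow P (t - r)))‖ ≤ ‖k r‖ * (‖F‖ * ‖flow P (t - r)‖) :=
          (opNorm_comp_le _ _).trans (by gcongr; exact opNorm_comp_le _ _)
      _ ≤ ‖k r‖ * (‖F‖ * (C * Real.exp (-β * (t - r)))) := by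
          gcongr
          exact hP _ (sub_nonneg.2 hr.2)
      _ = _ := by
          rw [show -β * (t - r) = -β * t + β * r by ring, Real.exp_add]
          ring
  rw [h1]
  refine hle.trans ?_
  rw [intervalIntegral.integral_const_mul, intervalIntegral.integral_of_le ht]
  have h3 : ∫ r in Ioc 0 t, Real.exp (β * r) * ‖k r‖ ≤ ∫ r, Real.exp (β * r) * ‖k r‖ :=
    setIntegral_le_integral hβ (Eventually.of_forall fun r => by positivity)
  calc ‖F‖ * C * Real.exp (-β * t) * ∫ r in Ioc 0 t, Real.exp (β * r) * ‖k r‖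
      ≤ ‖F‖ * C * Real.exp (-β * t) * ∫ r, Real.exp (β * r) * ‖k r‖ := by gcongr
    _ = _ := by ring

theorem hasDerivAt_flow_apply (P : X →L[ℂ] X) (z : X) (t : ℝ) :
    HasDerivAt (fun t => flow P t z) (P (flow P t z)) t := by
  have := HasDerivWithinAt.clm_bilin (ContinuousLinearMap.id ℂ (X →L[ℂ] X))
    (hasDerivAt_flow' P t).hasDerivWithinAt (hasDerivWithinAt_const t univ z)
  simpa using hasDerivWithinAt_univ.1 this

/-- Weak differentiation of the convolution of a kernel with `e^{tP} z`. -/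
theorem hasDerivWithinAt_inner_convolution (hk : Integrable k) {e g : H} {φ : ℝ → U →L[ℂ] ℂ}
    (hφ : Continuous φ) (hφk : ∀ r, 0 < r → φ r = (innerSL ℂ e).comp (k r))
    (hder : ∀ r, 0 < r → HasDerivAt φ ((innerSL ℂ g).comp (k r)) r)
    (z : X) {t : ℝ} (ht : 0 ≤ t) :
    HasDerivWithinAt (fun t => inner ℂ e (convolution k F P t (flow P t z)))
      (inner ℂ g (convolution k F P t (flow P t z)) + φ 0 (F (flow P t z))) (Ici 0) t := by
  set Φ : ℝ → X →L[ℂ] ℂ := fun r => (φ r).comp (F.comp (flow (-P) r)) with hΦ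
  have hΦc : Continuous Φ := hφ.clm_comp (continuous_const.clm_comp (continuous_flow _))
  have hint := intervalIntegrable_convolution (F := F) (P := P) hk
  have hprim : ∀ t, 0 ≤ t → (innerSL ℂ e).comp (convolution k F P t) = ∫ r in (0 : ℝ)..t, Φ r := by
    intro t ht
    have h2 := (compL ℂ X H ℂ (innerSL ℂ e)).intervalIntegral_comp_comm (hint 0 t)
    rw [compL_apply] at h2
    rw [convolution, ← h2]
    refine intervalIntegral.integral_congr_ae (Eventually.of_forall fun r hr => ?_)
    rw [uIoc_of_le ht] at hr
    simp only [hΦ, compL_apply]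
    rw [hφk r hr.1, comp_assoc]
  have hII : HasDerivWithinAt (fun t => (innerSL ℂ e).comp (convolution k F P t)) (Φ t) (Ici 0) t :=
    ((hΦc.integral_hasStrictDerivAt 0 t).hasDerivAt.hasDerivWithinAt).congr
      (fun s hs => hprim s hs) (hprim t ht)
  -- Integrating `Φ'` is an integration by parts: it avoids applying `A` to the singular convolution
  -- and yields the boundary term `Φ 0`, which will be the control term.
  have hI : (innerSL ℂ g).comp (convolution k F P t) -
      (innerSL ℂ e).comp ((convolution k F P t).comp P) = Φ t - Φ 0 := by
    let Λ : (X →L[ℂ] H) →L[ℂ] (X →L[ℂ] ℂ) := compL ℂ X H ℂ (innerSL ℂ g) -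
      (compL ℂ X H ℂ (innerSL ℂ e)).comp ((compL ℂ X X H).flip P)
    have h2 := Λ.intervalIntegral_comp_comm (hint 0 t)
    have h3 := intervalIntegral.integral_eq_sub_of_hasDerivAt_of_le ht hΦc.continuousOn
      (f' := fun r => Λ ((k r).comp (F.comp (flow (-P) r)))) (fun r hr => ?_)
      ⟨Λ.integrable_comp (hint 0 t).1, Λ.integrable_comp (hint 0 t).2⟩
    · rw [h3] at h2
      exact h2.symm
    · have h3 := HasDerivWithinAt.clm_bilin (compL ℂ X X U) (hasDerivWithinAt_const r univ F)
        (hasDerivAt_flow (-P) r).hasDerivWithinAt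
      have h4 := HasDerivWithinAt.clm_bilin (compL ℂ X U ℂ) (hder r hr.1).hasDerivWithinAt h3
      refine (hasDerivWithinAt_univ.1 h4).congr_deriv ?_
      simp only [compL_apply]
      rw [hφk r hr.1]
      ext x
      simp only [Λ]
      simp [sub_eq_add_neg, add_comm]
  have h5 := HasDerivWithinAt.clm_bilin (ContinuousLinearMap.id ℂ (X →L[ℂ] ℂ)) hII
    (hasDerivAt_flow_apply P z t).hasDerivWithinAt
  refine h5.congr_deriv ?_
  simp only [id_apply]
  have h6 := congrArg (fun T => T (flow P t z)) hI
  simp only [sub_apply, comp_apply, innerSL_apply_apply] at h6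
  simp only [comp_apply, innerSL_apply_apply]
  have h7 : Φ 0 (flow P t z) = φ 0 (F (flow P t z)) := by simp [hΦ, flow_zero]
  rw [← h7]
  linear_combination -h6

end Convolution

section ClosedLoop

open ContinuousLinearMap MeasureTheory

variable {H : Type*} [NormedAddCommGroup H] [InnerProductSpace ℂ H] [CompleteSpace H]
variable {U : Type*} [NormedAddCommGroup U] [InnerProductSpace ℂ U]
variable {A : H →ₗ.[ℂ] H} {S S' : ℝ → H →L[ℂ] H} {B : U →L[ℂ] DStarDual A} {σ : ℝ}

namespace SpectralSplitting

variable (D : SpectralSplitting A S σ)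

theorem commute_stable {t : ℝ} (ht : 0 ≤ t) : S t * (1 - D.proj) = (1 - D.proj) * S t := by
  have := D.commute t ht
  rw [mul_sub, sub_mul, mul_one, one_mul]
  exact congrArg (S t - ·) this

theorem L_stable (x : H) : D.L ((1 - D.proj) x) = 0 := by
  simp only [sub_apply, one_apply_eq_self, map_sub, proj_apply, D.L_coe, sub_self]

end SpectralSplitting

/-! ### The stable part of the control kernel -/

/-- `k(r) = e^{σ r} (1 - E) K(r)` for `r > 0`. -/
structure IsStableKernel (D : SpectralSplitting A S σ) (K k : ℝ → U →L[ℂ] H) (β : ℝ) : Prop where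
  eq : ∀ r, 0 < r → k r = (Real.exp (σ * r) : ℂ) • (1 - D.proj).comp (K r)
  integrable : Integrable k
  integrable_exp : Integrable fun r => Real.exp (β * r) * ‖k r‖
  decay : ∃ C > 0, ∀ t, 0 ≤ t → ‖S t * (1 - D.proj)‖ ≤ C * Real.exp (-(σ + β) * t)

/-- Near zero the singularity `r^{-γ}` is integrable; for `r ≥ 1` the identity `K(r) = S(r - 1)
K(1)` passes the decay of the stable semigroup on to the kernel. -/
theorem IsControlKernel.exists_isStableKernel {γ : ℝ} {K : ℝ → U →L[ℂ] H} (hγ : γ < 1)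
    (hγ0 : 0 < γ)
    (hK : IsControlKernel A S B γ K) (hS : IsC0Semigroup S) (hA : IsGenerator A S)
    (hd : IsDifferentiableSemigroup S S') (D : SpectralSplitting A S σ) :
    ∃ β > 0, ∃ k, IsStableKernel D K k β := by
  obtain ⟨C, hC, a, ha, hdec⟩ := D.decay
  obtain ⟨C1, hC1, hK1⟩ := hK.norm_le
  -- Half of the gap between `a` and `-σ`: after the weights `e^{σ r}` and `e^{β r}` a factor `e^{-β
  -- r}` is left.
  set β := -(a + σ) / 2 with hβdef
  have hβ : 0 < β := by rw [hβdef]; linarith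
  have ha' : a = -σ - 2 * β := by rw [hβdef]; ring
  set k : ℝ → U →L[ℂ] H := (Ioi (0 : ℝ)).indicator
    fun r => (Real.exp (σ * r) : ℂ) • (1 - D.proj).comp (K r) with hk
  have hkeq : ∀ r, 0 < r → k r = (Real.exp (σ * r) : ℂ) • (1 - D.proj).comp (K r) :=
    fun r hr => indicator_of_mem (mem_Ioi.2 hr) _
  have hnorm : ∀ r, 0 < r → ‖k r‖ = Real.exp (σ * r) * ‖(1 - D.proj).comp (K r)‖ := by
    intro r hr
    rw [hkeq r hr, norm_smul, Complex.norm_real, Real.norm_of_nonneg (Real.exp_pos _).le]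
  have hcont : ContinuousOn k (Ioi 0) := by
    refine ContinuousOn.congr ?_ fun r hr => hkeq r hr
    refine ContinuousOn.smul (Continuous.continuousOn
      (Complex.continuous_ofReal.comp (Real.continuous_exp.comp (continuous_const_mul σ)))) ?_
    exact continuousOn_const.clm_comp (hK.continuousOn hS hA hd)
  have hmeas : AEStronglyMeasurable k (volume.restrict (Ioi 0)) :=
    hcont.aestronglyMeasurable measurableSet_Ioi
  set C2 := Real.exp |2 * β + σ| * ‖1 - D.proj‖ * C1 with hC2
  set C3 := C * ‖K 1‖ * Real.exp (-a) with hC3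
  have hC2' : 0 ≤ C2 := by positivity
  have hC3' : 0 ≤ C3 := by positivity
  have hbound : ∀ r, 0 < r → Real.exp (β * r) * ‖k r‖ ≤
      C2 * (r ^ (-γ) * Real.exp (-β * r)) + C3 * (r ^ (0 : ℝ) * Real.exp (-β * r)) := by
    intro r hr
    rw [hnorm r hr, Real.rpow_zero, one_mul]
    rcases le_total r 1 with h1 | h1
    · have h2 : ‖(1 - D.proj).comp (K r)‖ ≤ ‖1 - D.proj‖ * (C1 * r ^ (-γ)) :=
        (opNorm_comp_le _ _).trans (by gcongr; exact hK1 r ⟨hr, h1⟩)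
      have h3 : (2 * β + σ) * r ≤ |2 * β + σ| := by
        have := le_abs_self (2 * β + σ)
        have := abs_nonneg (2 * β + σ)
        nlinarith
      have h4 : Real.exp (β * r) * Real.exp (σ * r) ≤
          Real.exp |2 * β + σ| * Real.exp (-β * r) := by
        rw [← Real.exp_add, ← Real.exp_add]
        exact Real.exp_le_exp.2 (by linarith)
      calc Real.exp (β * r) * (Real.exp (σ * r) * ‖(1 - D.proj).comp (K r)‖)
          = Real.exp (β * r) * Real.exp (σ * r) * ‖(1 - D.proj).comp (K r)‖ := by ring
        _ ≤ Real.exp |2 * β + σ| * Real.exp (-β * r) * (‖1 - D.proj‖ * (C1 * r ^ (-γ))) := by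
            gcongr
        _ = C2 * (r ^ (-γ) * Real.exp (-β * r)) := by rw [hC2]; ring
        _ ≤ _ := le_add_of_nonneg_right (by positivity)
    · have h2 : (1 - D.proj).comp (K r) = (S (r - 1) * (1 - D.proj)).comp (K 1) := by
        rw [D.commute_stable (by linarith), mul_def, comp_assoc,
          ← hK.add hS hA hd (by linarith) one_pos, sub_add_cancel]
      have h3 : ‖(1 - D.proj).comp (K r)‖ ≤ C * Real.exp (a * (r - 1)) * ‖K 1‖ := by
        rw [h2]
        exact (opNorm_comp_le _ _).trans (by gcongr; exact hdec _ (by linarith))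
      calc Real.exp (β * r) * (Real.exp (σ * r) * ‖(1 - D.proj).comp (K r)‖)
          ≤ Real.exp (β * r) * (Real.exp (σ * r) * (C * Real.exp (a * (r - 1)) * ‖K 1‖)) := by
            gcongr
        _ = C3 * (Real.exp (β * r) * Real.exp (σ * r) * Real.exp (a * r)) := by
            rw [hC3, show a * (r - 1) = a * r + -a by ring, Real.exp_add]; ring
        _ = C3 * Real.exp (-β * r) := by
            rw [← Real.exp_add, ← Real.exp_add, ha']
            congr 2; ring
        _ ≤ _ := le_add_of_nonneg_left (by positivity)
  have hzero : ∀ r, r ∉ Ioi (0 : ℝ) → k r = 0 := fun r hr => indicator_of_notMem hr _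
  have hexpc : Continuous fun r : ℝ => Real.exp (β * r) := by fun_prop
  have hint : IntegrableOn (fun r => Real.exp (β * r) * ‖k r‖) (Ioi 0) := by
    have h1 := (integrableOn_rpow_mul_exp_neg_mul (s := -γ) (by linarith) hβ).const_mul C2
    have h2 := (integrableOn_rpow_mul_exp_neg_mul (s := 0) (by norm_num) hβ).const_mul C3
    refine Integrable.mono' (h1.add h2)
      (hexpc.aestronglyMeasurable.mul hmeas.norm) ?_
    refine (ae_restrict_iff' measurableSet_Ioi).2 (Eventually.of_forall fun r hr => ?_)
    rw [Real.norm_of_nonneg (by positivity)]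
    exact hbound r hr
  refine ⟨β, hβ, k, hkeq, ?_, ?_, C, hC, fun t ht => ?_⟩
  · refine IntegrableOn.integrable_of_forall_notMem_eq_zero (f := k) (s := Ioi 0) ?_ hzero
    refine Integrable.mono' hint hmeas ?_
    refine (ae_restrict_iff' measurableSet_Ioi).2 (Eventually.of_forall fun r hr => ?_)
    have hr' : 0 < r := hr
    exact le_mul_of_one_le_left (norm_nonneg _) (Real.one_le_exp (by positivity))
  · exact hint.integrable_of_forall_notMem_eq_zero fun r hr => by rw [hzero r hr]; simp
  · refine (hdec t ht).trans ?_
    gcongr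
    linarith

theorem HasDerivAt.semilinear {E F : Type*} [NormedAddCommGroup E] [NormedSpace ℂ E]
    [NormedAddCommGroup F] [NormedSpace ℂ F] (T : E →L⋆[ℂ] F) {q : ℝ → E} {q' : E} {t : ℝ}
    (h : HasDerivAt q q' t) : HasDerivAt (fun s => T (q s)) (T q') t :=
  (((T : E →ₛₗ[starRingEnd ℂ] F).toAddMonoidHom.toRealLinearMap
    T.continuous).hasFDerivAt.comp_hasDerivAt t h)

/-- The function `r ↦ (k(r) · | e)` extends continuously to `r = 0`, and it is differentiable
for `r > 0`. -/
theorem IsStableKernel.exists_weak_extension {γ : ℝ} {K k : ℝ → U →L[ℂ] H} {β : ℝ}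
    {D : SpectralSplitting A S σ}
    (hk : IsStableKernel D K k β) (hK : IsControlKernel A S B γ K) (hS : IsC0Semigroup S)
    (hA : IsGenerator A S) (hd : IsDifferentiableSemigroup S S') (e : DStar A)
    (h1 : (adjoint (1 - D.proj) e.1.1, adjoint (1 - D.proj) e.1.2) ∈ A.adjoint.graph) :
    ∃ φ : ℝ → U →L[ℂ] ℂ, Continuous φ ∧
      (∀ r, 0 < r → φ r = (innerSL ℂ e.1.1).comp (k r)) ∧
      (∀ r, 0 < r → HasDerivAt φ ((innerSL ℂ (e.1.2 + (σ : ℂ) • e.1.1)).comp (k r)) r) ∧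
      ∀ u, φ 0 u = B u ⟨_, h1⟩ := by
  set e1 := adjoint (1 - D.proj) e.1.1 with he1
  set f1 := adjoint (1 - D.proj) e.1.2 with hf1
  have hdense := hd.dense_domain hS hA
  have hmem : ∀ r, 0 ≤ r → (adjoint (S r) e1, adjoint (S r) f1) ∈ A.adjoint.graph :=
    fun r hr => adjoint_mem_adjoint_graph_of_commute hA hdense (fun _ hs => hS.commute hs hr) h1
  -- Freezing the orbit at negative times makes it continuous into `D(A*)` on the whole line.
  set orbit : ℝ → DStar A := fun r => ⟨_, hmem (max r 0) (le_max_right r 0)⟩ with horbit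
  have horbitc : Continuous orbit := by
    refine Continuous.subtype_mk (Continuous.prodMk ?_ ?_) _
    · exact (hd.continuousOn_adjoint_apply hS e1).comp_continuous (by fun_prop)
        fun r => le_max_right r 0
    · exact (hd.continuousOn_adjoint_apply hS f1).comp_continuous (by fun_prop)
        fun r => le_max_right r 0
  set φ : ℝ → U →L[ℂ] ℂ := fun r => (Real.exp (σ * r) : ℂ) • B.flip (orbit r) with hφ
  have hφk : ∀ r, 0 < r → φ r = (innerSL ℂ e.1.1).comp (k r) := by
    intro r hr
    ext u
    have h2 := hK.inner_of_mem_graph hS hA hd hr u h1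
    have h3 : B.flip (orbit r) u = inner ℂ e1 (K r u) := by
      rw [h2, flip_apply]
      congr 1
      simp only [horbit, max_eq_left hr.le]
    rw [hφ, hk.eq r hr]
    simp only [smul_apply, h3, comp_apply, innerSL_apply_apply, inner_smul_right, smul_eq_mul]
    rw [he1, adjoint_inner_left]
  refine ⟨φ, ?_, hφk, fun r hr => ?_, fun u => ?_⟩
  · exact Continuous.smul
      (Complex.continuous_ofReal.comp (Real.continuous_exp.comp (continuous_const_mul σ))) (B.flip.continuous.comp horbitc)
  -- Writing `K(s) = S(s - r/2) K(r/2)` near `r` moves the differentiation onto the orbit of the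
  -- adjoint semigroup.
  · have hr2 : 0 < r / 2 := by linarith
    have h2 : HasDerivAt (fun s => adjoint (S (s - r / 2)) e1) (adjoint (S (r / 2)) f1) r := by
      have h3 : HasDerivAt (fun t => adjoint (S t) e1) (adjoint (S (r / 2)) f1) (r - r / 2) := by
        rw [show r - r / 2 = r / 2 by ring]
        exact (hd.hasDerivWithinAt_adjoint_apply hS hA h1 hr2.le).hasDerivAt (Ici_mem_nhds hr2)
      exact h3.comp_sub_const r (r / 2)
    have h4 : HasDerivAt (fun s : ℝ => Real.exp (σ * s)) (Real.exp (σ * r) * (σ * 1)) r :=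
      ((hasDerivAt_id r).const_mul σ).exp
    have h5 := HasDerivAt.semilinear
      (((compL ℂ U H ℂ).flip (K (r / 2))).comp (innerSL ℂ)) (h4.smul h2)
    refine (h5.congr_of_eventuallyEq ?_).congr_deriv ?_
    · filter_upwards [lt_mem_nhds (show r / 2 < r by linarith)] with s hs
      have hs0 : 0 < s := by linarith
      rw [hφk s hs0, hk.eq s hs0]
      ext u
      simp only [comp_apply, flip_apply, compL_apply, innerSL_apply_apply, smul_apply,
        inner_smul_right, Pi.smul_apply']
      rw [inner_smul_left_eq_smul, adjoint_inner_left, he1, adjoint_inner_left,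
        Complex.real_smul, ← comp_apply (S (s - r / 2)),
        ← hK.add hS hA hd (by linarith) hr2, sub_add_cancel]
    · rw [hk.eq r hr, show r - r / 2 = r / 2 by ring]
      ext u
      have h7 : K r u = S (r / 2) (K (r / 2) u) := by
        rw [← comp_apply, ← hK.add hS hA hd hr2.le hr2, add_halves]
      simp only [comp_apply, flip_apply, compL_apply, innerSL_apply_apply, smul_apply,
        inner_smul_right, h7, he1, hf1, inner_add_left, inner_smul_left_eq_smul,
        adjoint_inner_left, inner_smul_left, Complex.real_smul, Complex.conj_ofReal]
      push_cast
      ring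
  · have h2 : orbit 0 = ⟨_, h1⟩ := by
      refine Subtype.ext (Prod.ext ?_ ?_) <;>
        simp only [horbit, max_self, hS.zero, ← star_eq_adjoint, star_one, one_apply_eq_self]
    simp only [hφ, h2, mul_zero, Real.exp_zero, Complex.ofReal_one, one_smul, flip_apply]
    rfl

end ClosedLoop

section Stabilization

open ContinuousLinearMap MeasureTheory

variable {H : Type*} [NormedAddCommGroup H] [InnerProductSpace ℂ H] [CompleteSpace H]
variable {U : Type*} [NormedAddCommGroup U] [InnerProductSpace ℂ U]
variable {A : H →ₗ.[ℂ] H} {S S' : ℝ → H →L[ℂ] H} {B : U →L[ℂ] DStarDual A} {σ : ℝ}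

/-! ### Solutions of the closed-loop system -/

/-- The solution of the closed-loop system with initial value `y₀`. -/
def closedLoopSolution (D : SpectralSplitting A S σ) (b : U →L[ℂ] D.X) (F : D.X →L[ℂ] U)
    (k : ℝ → U →L[ℂ] H) (y₀ : H) (t : ℝ) : H :=
  flow (D.closedLoop b F) t (D.L y₀) + (Real.exp (σ * t) : ℂ) • S t ((1 - D.proj) y₀) +
    convolution k F (D.closedLoop b F) t (flow (D.closedLoop b F) t (D.L y₀))

variable {D : SpectralSplitting A S σ} {b : U →L[ℂ] D.X} {F : D.X →L[ℂ] U}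
  {K k : ℝ → U →L[ℂ] H} {β γ : ℝ}

theorem IsStableKernel.L_convolution (hk : IsStableKernel D K k β) (P : D.X →L[ℂ] D.X) {t : ℝ}
    (ht : 0 ≤ t) (x : D.X) : D.L (convolution k F P t x) = 0 := by
  have h1 := (compL ℂ D.X H D.X D.L).intervalIntegral_comp_comm
    (intervalIntegrable_convolution (F := F) (P := P) hk.integrable 0 t)
  have h2 : ∫ r in (0 : ℝ)..t, (compL ℂ D.X H D.X D.L) ((k r).comp (F.comp (flow (-P) r))) = 0 := by
    rw [← intervalIntegral.integral_zero (μ := volume) (E := D.X →L[ℂ] D.X) (a := (0 : ℝ)) (b := t)]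
    refine intervalIntegral.integral_congr_ae (Eventually.of_forall fun r hr => ?_)
    rw [uIoc_of_le ht] at hr
    ext x
    simp only [compL_apply, comp_apply, hk.eq r hr.1, smul_apply, map_smul, D.L_stable, smul_zero,
      zero_apply]
  rw [h2] at h1
  exact (congrArg (fun T => T x) h1).symm

theorem IsStableKernel.L_closedLoopSolution (hk : IsStableKernel D K k β) (y₀ : H) {t : ℝ}
    (ht : 0 ≤ t) : D.L (closedLoopSolution D b F k y₀ t) = flow (D.closedLoop b F) t (D.L y₀) := by
  have h1 : S t ((1 - D.proj) y₀) = (1 - D.proj) (S t y₀) :=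
    congrArg (fun T => T y₀) (D.commute_stable ht)
  rw [closedLoopSolution, map_add, map_add, map_smul, hk.L_convolution _ ht, h1, D.L_stable,
    smul_zero, add_zero, add_zero, D.L_coe]

theorem IsStableKernel.closedLoopSolution_zero (hS : IsC0Semigroup S) (y₀ : H) :
    closedLoopSolution D b F k y₀ 0 = y₀ := by
  simp [closedLoopSolution, flow_zero, hS.zero, convolution, D.proj_apply]

/-- The test vector splits along `proj*` and `(1 - proj)*`. The flow on `X` contributes `B` tested
on the first piece, through `b`; the boundary term of the convolution contributes `B` tested on the
second. Together they form the control term of the equation. -/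
theorem IsStableKernel.isSolution (hk : IsStableKernel D K k β) (hK : IsControlKernel A S B γ K)
    (hS : IsC0Semigroup S) (hA : IsGenerator A S) (hd : IsDifferentiableSemigroup S S')
    (hb : IsReducedControl D B b) (y₀ : H) :
    IsSolution A σ B (fun t => F (D.L (closedLoopSolution D b F k y₀ t)))
      (closedLoopSolution D b F k y₀) := by
  set P := D.closedLoop b F with hP
  have hdense := hd.dense_domain hS hA
  refine ⟨?_, fun e t ht => ?_⟩
  · have hz : Continuous fun t => flow P t (D.L y₀) := (continuous_flow P).clm_apply continuous_const
    refine ((continuous_subtype_val.comp hz).continuousOn.add ?_).add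
      ((continuous_convolution hk.integrable).clm_apply hz).continuousOn
    exact ContinuousOn.smul (Complex.continuous_ofReal.comp
      (Real.continuous_exp.comp (continuous_const_mul σ))).continuousOn (hS.continuousOn _)
  · set z := flow P t (D.L y₀) with hz
    have hgE : (adjoint D.proj e.1.1, adjoint D.proj e.1.2) ∈ A.adjoint.graph :=
      adjoint_mem_adjoint_graph_of_commute hA hdense D.commute e.2
    have hg1 : (adjoint (1 - D.proj) e.1.1, adjoint (1 - D.proj) e.1.2) ∈ A.adjoint.graph :=
      adjoint_mem_adjoint_graph_of_commute hA hdense (fun _ ht => D.commute_stable ht) e.2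
    obtain ⟨φ, hφc, hφk, hφd, hφ0⟩ := hk.exists_weak_extension hK hS hA hd e hg1
    have h1 : HasDerivWithinAt (fun t => inner ℂ e.1.1 ((flow P t (D.L y₀) : D.X) : H))
        (inner ℂ e.1.1 ((P z : D.X) : H)) (Ici 0) t :=
      (((innerSL ℂ e.1.1).comp D.X.subtypeL).restrictScalars ℝ).hasFDerivAt.comp_hasDerivWithinAt t
        (hasDerivAt_flow_apply P (D.L y₀) t).hasDerivWithinAt
    have h2 : HasDerivWithinAt
        (fun t => inner ℂ e.1.1 ((Real.exp (σ * t) : ℂ) • S t ((1 - D.proj) y₀)))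
        ((Real.exp (σ * t) : ℂ) * inner ℂ e.1.2 (S t ((1 - D.proj) y₀)) +
          σ * ((Real.exp (σ * t) : ℂ) * inner ℂ e.1.1 (S t ((1 - D.proj) y₀)))) (Ici 0) t := by
      have h3 : HasDerivWithinAt (fun t => inner ℂ e.1.1 (S t ((1 - D.proj) y₀)))
          (inner ℂ e.1.2 (S t ((1 - D.proj) y₀))) (Ici 0) t := by
        have := (hd.hasDerivWithinAt_adjoint_apply hS hA e.2 ht).inner ℂ
          (hasDerivWithinAt_const t (Ici 0) ((1 - D.proj) y₀))
        simpa only [adjoint_inner_left, inner_zero_right, zero_add] using this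
      have h4 : HasDerivAt (fun s : ℝ => (Real.exp (σ * s) : ℂ)) (Real.exp (σ * t) * (σ * 1) : ℝ) t :=
        (((hasDerivAt_id t).const_mul σ).exp).ofReal_comp
      simp only [inner_smul_right]
      refine (h4.hasDerivWithinAt.mul h3).congr_deriv ?_
      push_cast
      ring
    have h3 := hasDerivWithinAt_inner_convolution (F := F) (P := P) hk.integrable hφc hφk hφd
      (D.L y₀) ht
    have h4 := (h1.add h2).add h3
    have h5 : D.L (closedLoopSolution D b F k y₀ t) = z := hk.L_closedLoopSolution y₀ ht
    have h6 : inner ℂ e.1.1 ((P z : D.X) : H) = inner ℂ e.1.2 (z : H) + σ * inner ℂ e.1.1 (z : H) +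
        B (F z) ⟨_, hgE⟩ := by
      have h7 : inner ℂ e.1.1 ((D.M z : D.X) : H) = inner ℂ e.1.2 (z : H) :=
        ((mem_adjoint_graph_iff hdense).1 e.2 _ _ (D.mem_graph z)).symm
      have hadj : ∀ x, adjoint D.proj x = adjoint D.L (adjoint D.X.subtypeL x) := by
        intro x
        rw [SpectralSplitting.proj, adjoint_comp, comp_apply]
      have h8 : inner ℂ e.1.1 ((b (F z) : D.X) : H) = B (F z) ⟨_, hgE⟩ := by
        have h9 := hb (F z) (adjoint D.X.subtypeL e.1.1) (adjoint D.proj e.1.2)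
          (by rw [← hadj]; exact hgE)
        rw [adjoint_inner_left] at h9
        refine h9.trans ?_
        congr 1
        exact Subtype.ext (Prod.ext (hadj _).symm rfl)
      rw [hP, SpectralSplitting.closedLoop]
      simp only [add_apply, smul_apply, one_apply_eq_self, comp_apply, Submodule.coe_add,
        Submodule.coe_smul, inner_add_right, inner_smul_right, h7, h8]
    have h7 : B (F z) e = B (F z) ⟨_, hgE⟩ + B (F z) ⟨_, hg1⟩ := by
      rw [← map_add]
      congr 1
      refine Subtype.ext (Prod.ext ?_ ?_) <;>
        simp [← star_eq_adjoint]
    rw [h6, hφ0] at h4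
    refine (h4.congr_of_eventuallyEq (Eventually.of_forall fun r => ?_) ?_).congr_deriv ?_
    · simp only [closedLoopSolution, inner_add_right]
      rfl
    · simp only [closedLoopSolution, inner_add_right]
      rfl
    · simp only [h5, h7]
      simp only [closedLoopSolution, inner_add_right, inner_add_left, inner_smul_right,
        inner_smul_left, Complex.conj_ofReal]
      rw [← hP, ← hz]
      ring

/-- Uniqueness identifies every solution with the explicit one, whose unstable, free stable and
driven stable terms all decay at rate `β`. -/
theorem IsStableKernel.isStabilizable [CompleteSpace U] (hk : IsStableKernel D K k β)
    (hK : IsControlKernel A S B γ K) (hS : IsC0Semigroup S) (hA : IsGenerator A S)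
    (hd : IsDifferentiableSemigroup S S') (hb : IsReducedControl D B b) (hβ : 0 < β)
    (h : ∀ (p : D.X) (c : ℂ), adjoint (D.M + (σ : ℂ) • 1) p = c • p → adjoint b p = 0 → p = 0) :
    IsStabilizable A σ B := by
  obtain ⟨F, C, hC, hF⟩ := exists_stabilizing_feedback _ b h β
  obtain ⟨C', hC', hdec⟩ := hk.decay
  set P := D.closedLoop b F with hP
  set I := ∫ r, Real.exp (β * r) * ‖k r‖ with hI
  have hI0 : 0 ≤ I := integral_nonneg fun r => by positivity
  refine ⟨F.comp D.L, C * ‖D.L‖ + C' + ‖F‖ * C * I * ‖D.L‖, by positivity, β, hβ, fun y₀ =>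
    ⟨closedLoopSolution D b F k y₀, IsStableKernel.closedLoopSolution_zero hS y₀,
      hk.isSolution hK hS hA hd hb y₀⟩, fun y hy t ht => ?_⟩
  have h1 := hy.unique hS hA hd hb (hk.isSolution hK hS hA hd hb (y 0))
    (IsStableKernel.closedLoopSolution_zero hS (y 0)).symm ht
  rw [h1, closedLoopSolution, ← hP]
  have e1 : ‖((flow P t (D.L (y 0)) : D.X) : H)‖ ≤ C * Real.exp (-β * t) * (‖D.L‖ * ‖y 0‖) :=
    (le_opNorm (flow P t) _).trans (by gcongr; exacts [hF t ht, le_opNorm _ _])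
  have e2 : ‖(Real.exp (σ * t) : ℂ) • S t ((1 - D.proj) (y 0))‖ ≤
      C' * Real.exp (-β * t) * ‖y 0‖ := by
    rw [norm_smul, Complex.norm_real, Real.norm_of_nonneg (Real.exp_pos _).le]
    calc Real.exp (σ * t) * ‖S t ((1 - D.proj) (y 0))‖
        ≤ Real.exp (σ * t) * (C' * Real.exp (-(σ + β) * t) * ‖y 0‖) := by
          gcongr
          exact (le_opNorm (S t * (1 - D.proj)) (y 0)).trans
            (mul_le_mul_of_nonneg_right (hdec t ht) (norm_nonneg _))
      _ = C' * (Real.exp (σ * t) * Real.exp (-(σ + β) * t)) * ‖y 0‖ := by ring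
      _ = _ := by rw [← Real.exp_add]; congr 3; ring
  have e3 : ‖convolution k F P t (flow P t (D.L (y 0)))‖ ≤
      ‖F‖ * C * I * Real.exp (-β * t) * (‖D.L‖ * ‖y 0‖) := by
    refine (le_opNorm ((convolution k F P t).comp (flow P t)) _).trans ?_
    gcongr
    · exact norm_convolution_comp_flow_le hC.le hk.integrable_exp hk.integrable hF ht
    · exact le_opNorm _ _
  calc _ ≤ _ := norm_add₃_le
    _ ≤ _ := add_le_add (add_le_add e1 e2) e3
    _ = _ := by ring

/-! ### Unique continuation and stabilizability -/

/-- The Hautus condition for the unstable part. -/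
theorem UCσ.hautus [CompleteSpace U] (huc : UCσ A σ B) (hA : IsGenerator A S)
    (hdense : Dense (A.domain : Set H)) (hb : IsReducedControl D B b) (p : D.X) (c : ℂ)
    (hp : adjoint (D.M + (σ : ℂ) • 1) p = c • p) (hbp : adjoint b p = 0) : p = 0 := by
  by_contra hne
  have h1 : adjoint D.M p = (c - σ) • p := by
    have : adjoint D.M p + (σ : ℂ) • p = c • p := by
      rw [← hp]
      simp [← star_eq_adjoint]
    rw [sub_smul, ← this, add_sub_cancel_right]
  have h2 := D.adjoint_L_mem_graph hA hdense p
  rw [h1] at h2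
  have h3 := huc ⟨_, h2⟩ (c - σ) (D.re_ge p _ hne h1) (by simp) ?_
  · have h4 : adjoint D.L p = 0 := congrArg (fun e : DStar A => e.1.1) h3
    exact hne (D.adjoint_L_injective (h4.trans (map_zero _).symm))
  · refine ext_inner_right ℂ fun u => ?_
    rw [inner_controlAdjoint, inner_zero_left, ← hb, ← adjoint_inner_left, hbp, inner_zero_left]

theorem UCσ.isStabilizable [CompleteSpace U] (huc : UCσ A σ B) (hS : IsC0Semigroup S)
    (hA : IsGenerator A S) (hd : IsDifferentiableSemigroup S S') {μ : ℝ}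
    (hμ : ∀ l ∈ spec A, l.re < μ) (h5 : HypH5 A S μ B) (D : SpectralSplitting A S σ) :
    IsStabilizable A σ B := by
  have hdense := hd.dense_domain hS hA
  obtain ⟨γ, hγ0, hγ1, K, hK⟩ := h5.exists_isControlKernel hS hA hd hμ
  obtain ⟨b, hb⟩ := exists_isReducedControl (B := B) hA hdense D
  obtain ⟨β, hβ, k, hk⟩ := hK.exists_isStableKernel hγ1 hγ0 hS hA hd D
  exact hk.isStabilizable hK hS hA hd hb hβ (huc.hautus hA hdense hb)

/-- Since `B* e = 0`, the pairing with `e` does not see the feedback: it is `e^{(conj l + σ) t}`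
times its initial value, and the exponent has nonnegative real part. Decay forces it to vanish for
every initial value, hence `e = 0`. -/
theorem IsStabilizable.ucσ [CompleteSpace U] (h : IsStabilizable A σ B) : UCσ A σ B := by
  obtain ⟨F, C, hC, ω, hω, hex, hdec⟩ := h
  intro e l hl he hB
  have hzero : ∀ y₀, inner ℂ e.1.1 y₀ = 0 := by
    intro y₀
    obtain ⟨y, rfl, hy⟩ := hex y₀
    set c : ℂ := starRingEnd ℂ l + σ with hc
    have hc0 : 0 ≤ c.re := by simp [hc]; linarith
    have hder : ∀ t, 0 ≤ t → HasDerivWithinAt (fun s => inner ℂ e.1.1 (y s))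
        (c * inner ℂ e.1.1 (y t)) (Ici 0) t := by
      intro t ht
      refine (hy.2 e t ht).congr_deriv ?_
      rw [← inner_controlAdjoint, hB, inner_zero_left, he, inner_smul_left, hc]
      ring
    have hconst : ∀ t : ℝ, 0 ≤ t → Complex.exp (-c * t) * inner ℂ e.1.1 (y t) =
        inner ℂ e.1.1 (y 0) := by
      intro t ht
      have h1 : ∀ s ∈ Ico 0 (t + 1), HasDerivWithinAt
          (fun s : ℝ => Complex.exp (-c * s) * inner ℂ e.1.1 (y s)) 0 (Ici 0) s := by
        intro s hs
        have h2 : HasDerivAt (fun s : ℝ => Complex.exp (-c * s)) (Complex.exp (-c * s) * (-c * 1)) s :=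
          (((hasDerivAt_id s).ofReal_comp).const_mul (-c)).cexp
        refine (h2.hasDerivWithinAt.mul (hder s hs.1)).congr_deriv ?_
        ring
      have h2 := eq_of_hasDerivWithinAt_zero h1 (t := t) ⟨ht, by linarith⟩
      simpa using h2
    have hle : ∀ t : ℝ, 0 ≤ t → ‖inner ℂ e.1.1 (y 0)‖ ≤ ‖e.1.1‖ * C * ‖y 0‖ * Real.exp (-ω * t) := by
      intro t ht
      rw [← hconst t ht, norm_mul, Complex.norm_exp]
      have h1 : Real.exp (-c * t : ℂ).re ≤ 1 := by
        rw [Real.exp_le_one_iff]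
        simp
        positivity
      calc _ ≤ 1 * (‖e.1.1‖ * (C * Real.exp (-ω * t) * ‖y 0‖)) := by
            gcongr
            exact (norm_inner_le_norm _ _).trans (by gcongr; exact hdec y hy t ht)
        _ = _ := by ring
    have hlim : Tendsto (fun t : ℝ => ‖e.1.1‖ * C * ‖y 0‖ * Real.exp (-ω * t)) atTop (𝓝 0) := by
      have h1 : Tendsto (fun t : ℝ => Real.exp (-ω * t)) atTop (𝓝 0) :=
        Real.tendsto_exp_atBot.comp (tendsto_id.const_mul_atTop_of_neg (by linarith))
      simpa using h1.const_mul (‖e.1.1‖ * C * ‖y 0‖)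
    have h1 := ge_of_tendsto hlim ((eventually_ge_atTop 0).mono hle)
    exact norm_eq_zero.1 (le_antisymm h1 (norm_nonneg _))
  have h1 : e.1.1 = 0 := inner_self_eq_zero.1 (hzero _)
  refine Subtype.ext (Prod.ext h1 ?_)
  rw [he, h1, smul_zero]
  rfl

end Stabilization

section Eigenspaces

open ContinuousLinearMap

variable {H : Type*} [NormedAddCommGroup H] [InnerProductSpace ℂ H] [CompleteSpace H]
variable {A : H →ₗ.[ℂ] H} {S S' : ℝ → H →L[ℂ] H} {σ : ℝ}

/-! ### The eigenspaces of `A` and of `A*` for unstable eigenvalues -/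

theorem finrank_ker_adjoint_eq {X : Type*} [NormedAddCommGroup X] [InnerProductSpace ℂ X]
    [CompleteSpace X] [FiniteDimensional ℂ X] (T : X →L[ℂ] X) :
    Module.finrank ℂ (adjoint T).ker = Module.finrank ℂ T.ker := by
  have h1 := LinearMap.finrank_range_add_finrank_ker (T : X →ₗ[ℂ] X)
  have h2 := T.range.finrank_add_finrank_orthogonal
  rw [orthogonal_range] at h2
  exact Nat.add_left_cancel (h2.trans h1.symm)

theorem eq_zero_of_norm_exp_smul_le {v : H} {c : ℂ} {a C : ℝ} (ha : a < c.re)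
    (h : ∀ t : ℝ, 0 < t → ‖Complex.exp (c * t) • v‖ ≤ C * Real.exp (a * t)) : v = 0 := by
  have hle : ∀ t : ℝ, 0 < t → ‖v‖ ≤ C * Real.exp (-(c.re - a) * t) := by
    intro t ht
    have h1 := h t ht
    rw [norm_smul, Complex.norm_exp, Complex.re_mul_ofReal] at h1
    have h2 : Real.exp (-(c.re - a) * t) = Real.exp (a * t) * (Real.exp (c.re * t))⁻¹ := by
      rw [← Real.exp_neg, ← Real.exp_add]
      ring_nf
    rw [h2, ← mul_assoc, ← div_eq_mul_inv, le_div_iff₀ (Real.exp_pos _), mul_comm]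
    exact h1
  have hlim : Tendsto (fun t : ℝ => C * Real.exp (-(c.re - a) * t)) atTop (𝓝 0) := by
    have h1 : Tendsto (fun t : ℝ => Real.exp (-(c.re - a) * t)) atTop (𝓝 0) :=
      Real.tendsto_exp_atBot.comp (tendsto_id.const_mul_atTop_of_neg (by linarith))
    simpa using h1.const_mul C
  exact norm_eq_zero.1 (le_antisymm (ge_of_tendsto hlim ((eventually_gt_atTop 0).mono hle))
    (norm_nonneg _))

namespace SpectralSplitting

variable (D : SpectralSplitting A S σ)

/-- On the stable component of `x` the semigroup acts as `e^{l t}` with `Re l ≥ -σ`, which is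
incompatible with the decay there unless that component is zero. -/
theorem proj_eigenvector (hS : IsC0Semigroup S) (hA : IsGenerator A S)
    (hd : IsDifferentiableSemigroup S S') {l : ℂ} (hl : -σ ≤ l.re) {x : H}
    (h : (x, l • x) ∈ A.graph) : D.proj x = x := by
  obtain ⟨C, hC, a, ha, hdec⟩ := D.decay
  have h1 : (1 - D.proj) x = 0 := by
    refine eq_zero_of_norm_exp_smul_le (c := l) (C := C * ‖x‖) (ha.trans_le hl) fun t ht => ?_
    have h2 : Complex.exp (l * t) • (1 - D.proj) x = (S t * (1 - D.proj)) x := by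
      rw [D.commute_stable ht.le, mul_apply_eq_comp, hd.apply_eigenvector hS hA h ht, map_smul]
    rw [h2, mul_right_comm]
    exact (le_opNorm _ _).trans (mul_le_mul_of_nonneg_right (hdec t ht.le) (norm_nonneg _))
  exact (sub_eq_zero.1 h1).symm

theorem adjoint_proj_eigenvector (hS : IsC0Semigroup S) (hA : IsGenerator A S)
    (hd : IsDifferentiableSemigroup S S') {l : ℂ} (hl : -σ ≤ l.re) {e : H}
    (h : (e, l • e) ∈ A.adjoint.graph) : adjoint D.proj e = e := by
  obtain ⟨C, hC, a, ha, hdec⟩ := D.decay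
  have h1 : adjoint (1 - D.proj) e = 0 := by
    refine eq_zero_of_norm_exp_smul_le (c := l) (C := C * ‖e‖) (ha.trans_le hl) fun t ht => ?_
    have h2 : Complex.exp (l * t) • adjoint (1 - D.proj) e = adjoint (S t * (1 - D.proj)) e := by
      rw [mul_def, adjoint_comp, comp_apply, hd.adjoint_apply_eigenvector hS hA h ht, map_smul]
    rw [h2, mul_right_comm]
    refine (le_opNorm _ _).trans (mul_le_mul_of_nonneg_right ?_ (norm_nonneg _))
    rw [LinearIsometryEquiv.norm_map]
    exact hdec t ht.le
  have h2 : adjoint (1 - D.proj) e = e - adjoint D.proj e := by simp [← star_eq_adjoint]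
  exact (sub_eq_zero.1 (h2.symm.trans h1)).symm

/-- `Ker (l - A)` is the eigenspace of the unstable part. -/
theorem exists_equiv_eigenspace (hS : IsC0Semigroup S) (hA : IsGenerator A S)
    (hd : IsDifferentiableSemigroup S S') {l : ℂ} (hl : -σ ≤ l.re) :
    Nonempty ((D.M - l • 1).ker ≃ₗ[ℂ] eigenspace A l) := by
  have hker : ∀ p : (D.M - l • 1).ker, D.M p = l • (p : D.X) := fun p =>
    sub_eq_zero.1 (show (D.M - l • 1) p = 0 from p.2)
  let R : D.X →ₗ[ℂ] GraphDom A := LinearMap.codRestrict A.graph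
    ((D.X.subtype).prod (D.X.subtype ∘ₗ (D.M : D.X →ₗ[ℂ] D.X))) D.mem_graph
  let f : (D.M - l • 1).ker →ₗ[ℂ] eigenspace A l :=
    (R ∘ₗ (D.M - l • 1).ker.subtype).codRestrict _ fun p =>
      mem_eigenspace_iff.2 (congrArg Subtype.val (hker p))
  refine ⟨LinearEquiv.ofBijective f ⟨fun p q hpq => ?_, fun x => ?_⟩⟩
  · exact Subtype.ext (Subtype.ext (congrArg (fun z : eigenspace A l => z.1.1.1) hpq))
  · obtain ⟨⟨⟨x, y⟩, hxy⟩, hx⟩ := x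
    have hy : y = l • x := mem_eigenspace_iff.1 hx
    subst hy
    have hp := D.proj_eigenvector hS hA hd hl hxy
    have hMx : D.M (D.L x) = l • D.L x := by rw [← D.L_apply_of_mem_graph hA hxy, map_smul]
    refine ⟨⟨D.L x, show (D.M - l • 1) (D.L x) = 0 from sub_eq_zero.2 hMx⟩, ?_⟩
    refine Subtype.ext (Subtype.ext (Prod.ext hp ?_))
    refine (congrArg Subtype.val hMx).trans ?_
    exact congrArg (l • ·) hp

theorem exists_equiv_adjoint_eigenspace (hS : IsC0Semigroup S) (hA : IsGenerator A S)
    (hd : IsDifferentiableSemigroup S S') {l : ℂ} (hl : -σ ≤ l.re) :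
    Nonempty ((adjoint D.M - l • 1).ker ≃ₗ[ℂ] eigenspace A.adjoint l) := by
  have hdense := hd.dense_domain hS hA
  have hker : ∀ p : (adjoint D.M - l • 1).ker, adjoint D.M p = l • (p : D.X) := fun p =>
    sub_eq_zero.1 (show (adjoint D.M - l • 1) p = 0 from p.2)
  let R : D.X →ₗ[ℂ] DStar A := LinearMap.codRestrict A.adjoint.graph
    ((adjoint D.L : D.X →ₗ[ℂ] H).prod
      ((adjoint D.L).comp (adjoint D.M) : D.X →ₗ[ℂ] H)) (D.adjoint_L_mem_graph hA hdense)
  let f : (adjoint D.M - l • 1).ker →ₗ[ℂ] eigenspace A.adjoint l :=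
    (R ∘ₗ (adjoint D.M - l • 1).ker.subtype).codRestrict _ fun p =>
      mem_eigenspace_iff.2 ((congrArg (adjoint D.L) (hker p)).trans (map_smul _ _ _))
  refine ⟨LinearEquiv.ofBijective f ⟨fun p q hpq => ?_, fun x => ?_⟩⟩
  · exact Subtype.ext (D.adjoint_L_injective
      (congrArg (fun z : eigenspace A.adjoint l => z.1.1.1) hpq))
  · obtain ⟨⟨⟨e, y⟩, hey⟩, hx⟩ := x
    have hy : y = l • e := mem_eigenspace_iff.1 hx
    subst hy
    have hp : adjoint D.L (adjoint D.X.subtypeL e) = e := by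
      rw [← comp_apply, ← adjoint_comp]
      exact D.adjoint_proj_eigenvector hS hA hd hl hey
    have h1 := D.adjoint_L_mem_graph hA hdense (adjoint D.X.subtypeL e)
    rw [hp] at h1
    have h2 : adjoint D.L (adjoint D.M (adjoint D.X.subtypeL e)) = l • e :=
      LinearPMap_graph_unique h1 hey
    have hM : adjoint D.M (adjoint D.X.subtypeL e) = l • adjoint D.X.subtypeL e := by
      refine D.adjoint_L_injective ?_
      rw [h2, map_smul, hp]
    refine ⟨⟨adjoint D.X.subtypeL e,
      show (adjoint D.M - l • 1) (adjoint D.X.subtypeL e) = 0 from sub_eq_zero.2 hM⟩, ?_⟩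
    exact Subtype.ext (Subtype.ext (Prod.ext hp h2))

theorem finiteDimensional_adjoint_eigenspace (D : SpectralSplitting A S σ) (hS : IsC0Semigroup S)
    (hA : IsGenerator A S)
    (hd : IsDifferentiableSemigroup S S') {l : ℂ} (hl : -σ ≤ l.re) :
    FiniteDimensional ℂ (eigenspace A.adjoint l) := by
  obtain ⟨f⟩ := D.exists_equiv_adjoint_eigenspace hS hA hd hl
  exact f.finiteDimensional

/-- Both eigenspaces are realized on the finite-dimensional `X`, where the kernels of an operator
and of its adjoint have the same dimension. -/
theorem finrank_adjoint_eigenspace (D : SpectralSplitting A S σ) (hS : IsC0Semigroup S)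
    (hA : IsGenerator A S)
    (hd : IsDifferentiableSemigroup S S') {l : ℂ} (hl : -σ ≤ l.re) :
    Module.finrank ℂ (eigenspace A.adjoint (starRingEnd ℂ l)) = geomMult A l := by
  obtain ⟨f⟩ := D.exists_equiv_eigenspace hS hA hd hl
  obtain ⟨g⟩ := D.exists_equiv_adjoint_eigenspace hS hA hd (l := starRingEnd ℂ l) (by simpa using hl)
  have h1 : adjoint (D.M - l • 1) = adjoint D.M - starRingEnd ℂ l • 1 := by
    simp [← star_eq_adjoint]
  rw [geomMult, ← f.finrank_eq, ← g.finrank_eq, ← h1]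
  exact finrank_ker_adjoint_eq _

end SpectralSplitting

/-- The conjugate of an eigenvalue of `A*` is a spectral value of `A`. -/
theorem conj_mem_spec_of_adjoint_eigenvector (hdense : Dense (A.domain : Set H)) {e : H} {c : ℂ}
    (he : e ≠ 0) (h : (e, c • e) ∈ A.adjoint.graph) : starRingEnd ℂ c ∈ spec A := by
  rintro ⟨R, hR⟩
  refine he (inner_self_eq_zero (𝕜 := ℂ).1 ?_)
  obtain ⟨hx, hf⟩ := (hR (R e) e).1 rfl
  have h1 := (mem_adjoint_graph_iff hdense).1 h (R e) (A ⟨R e, hx⟩) (A.mem_graph ⟨R e, hx⟩)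
  rw [inner_smul_left] at h1
  nth_rewrite 2 [← hf]
  rw [inner_sub_right, inner_smul_right, h1, sub_self]

end Eigenspaces

section Families

/-! ### Generic linear independence -/

/-- A left inverse `g` for the one independent family turns families into square matrices `N v` with
`N (v + t • v0) = N v + t`. Its determinant is the characteristic polynomial of `-N v` at `t`,
nonzero for all but finitely many `t`, so arbitrarily small perturbations of `v` along `v0` are
independent. -/
theorem dense_setOf_linearIndependent_of_exists {E Y : Type*} [NormedAddCommGroup E]
    [NormedSpace ℂ E] [AddCommGroup Y] [Module ℂ Y] {n : ℕ} (Φ : E →ₗ[ℂ] Fin n → Y)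
    (h : ∃ v, LinearIndependent ℂ (Φ v)) : Dense {v | LinearIndependent ℂ (Φ v)} := by
  obtain ⟨v0, hv0⟩ := h
  obtain ⟨g, hg⟩ := (Fintype.linearCombination ℂ (Φ v0)).exists_leftInverse_of_injective
    (LinearMap.ker_eq_bot.2 (linearIndependent_iff_injective_fintypeLinearCombination.1 hv0))
  have hg' : ∀ i, g (Φ v0 i) = Pi.single i 1 := by
    intro i
    have := congrArg (fun T => T (Pi.single i 1)) hg
    simpa using this
  let N : E → Matrix (Fin n) (Fin n) ℂ := fun v => Matrix.of fun i => g (Φ v i)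
  have hN : ∀ (v : E) (t : ℂ), N (v + t • v0) = N v + Matrix.scalar (Fin n) t := by
    intro v t
    ext i j
    simp [N, hg', Matrix.diagonal_apply, Pi.single_apply, eq_comm]
  have hunit : ∀ v, IsUnit (N v) → LinearIndependent ℂ (Φ v) := fun v hv =>
    LinearIndependent.of_comp g (Matrix.linearIndependent_rows_iff_isUnit.2 hv)
  intro v
  have hev : ∀ᶠ t : ℂ in 𝓝[≠] 0, v + t • v0 ∈ {v | LinearIndependent ℂ (Φ v)} := by
    have h1 : {t : ℂ | (-N v).charpoly.IsRoot t}.Finite :=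
      Polynomial.finite_setOfPred_isRoot (Matrix.charpoly_monic _).ne_zero
    have h2 := nhdsNE_le_cofinite (0 : ℂ) h1.compl_mem_cofinite
    filter_upwards [h2] with t ht
    refine hunit _ ?_
    rw [hN, Matrix.isUnit_iff_isUnit_det, isUnit_iff_ne_zero]
    intro h0
    refine ht ?_
    rw [mem_ofPred_eq, Polynomial.IsRoot.def, Matrix.eval_charpoly, sub_neg_eq_add, add_comm, h0]
  have hlim : Tendsto (fun t : ℂ => v + t • v0) (𝓝[≠] 0) (𝓝 v) := by
    have h1 : Continuous fun t : ℂ => v + t • v0 := by fun_prop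
    have h2 := h1.tendsto 0
    rw [zero_smul, add_zero] at h2
    exact h2.mono_left nhdsWithin_le_nhds
  exact mem_closure_of_tendsto hlim hev

end Families

section Admissibility

variable {H : Type*} [NormedAddCommGroup H] [InnerProductSpace ℂ H] [CompleteSpace H]
variable {U : Type*} [NormedAddCommGroup U] [InnerProductSpace ℂ U] [CompleteSpace U]
variable {A : H →ₗ.[ℂ] H} {S S' : ℝ → H →L[ℂ] H} {B : U →L[ℂ] DStarDual A} {σ : ℝ}

/-! ### Unique continuation on the unstable eigenspaces -/

theorem ucσ_iff (hdense : Dense (A.domain : Set H)) :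
    UCσ A σ B ↔ ∀ l ∈ unstableSpec A σ, ∀ e ∈ eigenspace A.adjoint (starRingEnd ℂ l),
      controlAdjoint B e = 0 → e = 0 := by
  refine ⟨fun h l hl e he hB => h e (starRingEnd ℂ l) (by simpa using hl.2)
    (mem_eigenspace_iff.1 he) hB, fun h e l hl he hB => ?_⟩
  by_contra hne
  have h1 : e.1.1 ≠ 0 := by
    intro h0
    refine hne (Subtype.ext (Prod.ext h0 ?_))
    rw [he, h0, smul_zero]
    rfl
  have h2 : (e.1.1, l • e.1.1) ∈ A.adjoint.graph := he ▸ e.2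
  refine hne (h (starRingEnd ℂ l)
    ⟨conj_mem_spec_of_adjoint_eigenvector hdense h1 h2, by simpa using hl⟩ e ?_ hB)
  rw [mem_eigenspace_iff, Complex.conj_conj, he]

theorem HypH5.restrictControl {μ : ℝ} (h : HypH5 A S μ B) (V : Submodule ℂ U) :
    HypH5 A S μ (restrictControl B V) := by
  obtain ⟨γ, h0, h1, B', hB'⟩ := h
  exact ⟨γ, h0, h1, B'.comp V.subtypeL, fun u e e' he => hB' u e e' he⟩

theorem controlAdjoint_restrictControl_eq_zero_iff (V : Submodule ℂ U) [CompleteSpace V]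
    (e : DStar A) : controlAdjoint (restrictControl B V) e = 0 ↔
      ∀ v ∈ V, inner ℂ (controlAdjoint B e) v = 0 := by
  refine ⟨fun h v hv => ?_, fun h => ext_inner_right ℂ fun u => ?_⟩
  · have h1 := inner_controlAdjoint (restrictControl B V) e ⟨v, hv⟩
    rw [h, inner_zero_left] at h1
    rw [inner_controlAdjoint]
    exact h1.symm
  · rw [inner_controlAdjoint, inner_zero_left, ← h u u.2, inner_controlAdjoint]
    rfl

/-! ### Stabilizability by controls in a finite-dimensional subspace -/

/-- The standing hypotheses in the form in which they are used. -/
structure Standing (A : H →ₗ.[ℂ] H) (S S' : ℝ → H →L[ℂ] H) (μ : ℝ) : Prop where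
  semigroup : IsC0Semigroup S
  generator : IsGenerator A S
  differentiable : IsDifferentiableSemigroup S S'
  spec_lt : ∀ l ∈ spec A, l.re < μ
  hypH1 : HypH1 A
  hypH6 : HypH6 A

variable {μ : ℝ}

namespace Standing

theorem dense_domain (h : Standing A S S' μ) : Dense (A.domain : Set H) :=
  h.differentiable.dense_domain h.semigroup h.generator

theorem splitting (h : Standing A S S' μ) (σ : ℝ) : Nonempty (SpectralSplitting A S σ) :=
  exists_spectralSplitting h.semigroup h.generator h.differentiable h.spec_lt h.hypH1 h.hypH6 σ

theorem finite_unstableSpec (h : Standing A S S' μ) (σ : ℝ) : (unstableSpec A σ).Finite :=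
  FattoriniStab.finite_unstableSpec h.semigroup h.generator h.differentiable h.spec_lt h.hypH1
    h.hypH6 σ

theorem isStabilizable_iff (h : Standing A S S' μ) (h5 : HypH5 A S μ B) :
    IsStabilizable A σ B ↔ UCσ A σ B := by
  obtain ⟨D⟩ := h.splitting σ
  exact ⟨fun h => h.ucσ, fun huc => huc.isStabilizable h.semigroup h.generator h.differentiable
    h.spec_lt h5 D⟩

theorem finiteDimensional_eigenspace (h : Standing A S S' μ) {l : ℂ} (hl : l ∈ unstableSpec A σ) :
    FiniteDimensional ℂ (eigenspace A.adjoint (starRingEnd ℂ l)) := by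
  obtain ⟨D⟩ := h.splitting σ
  exact D.finiteDimensional_adjoint_eigenspace h.semigroup h.generator h.differentiable
    (by simpa using hl.2)

theorem finrank_eigenspace (h : Standing A S S' μ) {l : ℂ} (hl : l ∈ unstableSpec A σ) :
    Module.finrank ℂ (eigenspace A.adjoint (starRingEnd ℂ l)) = geomMult A l := by
  obtain ⟨D⟩ := h.splitting σ
  exact D.finrank_adjoint_eigenspace h.semigroup h.generator h.differentiable hl.2

theorem exists_basis (h : Standing A S S' μ) {l : ℂ} (hl : l ∈ unstableSpec A σ) :
    Nonempty (Module.Basis (Fin (geomMult A l)) ℂ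
      (eigenspace A.adjoint (starRingEnd ℂ l))) := by
  have := h.finiteDimensional_eigenspace hl
  have := Module.Free.of_divisionRing ℂ (eigenspace A.adjoint (starRingEnd ℂ l))
  exact ⟨Module.finBasisOfFinrankEq ℂ _ (h.finrank_eigenspace hl)⟩

theorem isStabilizable_restrictControl_iff (h : Standing A S S' μ) (h5 : HypH5 A S μ B)
    (V : Submodule ℂ U) [FiniteDimensional ℂ V] :
    IsStabilizable A σ (FattoriniStab.restrictControl B V) ↔
      ∀ l ∈ unstableSpec A σ, ∀ e ∈ eigenspace A.adjoint (starRingEnd ℂ l),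
        (∀ v ∈ V, inner ℂ (controlAdjoint B e) v = 0) → e = 0 := by
  have : CompleteSpace V := FiniteDimensional.complete ℂ V
  rw [h.isStabilizable_iff (h5.restrictControl V), ucσ_iff h.dense_domain]
  simp only [controlAdjoint_restrictControl_eq_zero_iff]

theorem isAdmissible_iff (h : Standing A S S' μ) (h5 : HypH5 A S μ B) {K : ℕ} (v : Fin K → U) :
    IsAdmissible A σ B v ↔
      ∀ l ∈ unstableSpec A σ, ∀ e ∈ eigenspace A.adjoint (starRingEnd ℂ l),
        (∀ k, inner ℂ (controlAdjoint B e) (v k) = 0) → e = 0 := by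
  have hspan : ∀ x : U, (∀ w ∈ Submodule.span ℂ (range v), inner ℂ x w = 0) ↔
      ∀ k, inner ℂ x (v k) = 0 := by
    intro x
    refine ⟨fun hx k => hx _ (Submodule.subset_span ⟨k, rfl⟩), fun hx w hw => ?_⟩
    have h1 : Submodule.span ℂ (range v) ≤ LinearMap.ker (innerSL ℂ x : U →ₗ[ℂ] ℂ) :=
      Submodule.span_le.2 (range_subset_iff.2 hx)
    exact h1 hw
  have : FiniteDimensional ℂ (Submodule.span ℂ (range v)) :=
    FiniteDimensional.span_of_finite ℂ (finite_range v)
  rw [IsAdmissible, h.isStabilizable_restrictControl_iff h5]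
  simp only [hspan]

end Standing

/-! ### The rank conditions -/

/-- The entries depend antilinearly on the eigenvector, hence the conjugated coefficients. -/
theorem sum_smul_col_rankMatrix {K n : ℕ} {c : ℂ} (v : Fin K → U)
    (b : Fin n → eigenspace A.adjoint c) (g : Fin n → ℂ) (k : Fin K) :
    (∑ i, g i • (rankMatrix B v b).col i) k =
      inner ℂ (controlAdjoint B ((∑ i, starRingEnd ℂ (g i) • b i : eigenspace A.adjoint c) :
        DStar A)) (v k) := by
  rw [Submodule.coe_sum, map_sum, sum_inner]
  simp [rankMatrix, inner_smul_left]

theorem linearIndependent_col_rankMatrix_iff {K n : ℕ} {c : ℂ} (v : Fin K → U)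
    (b : Module.Basis (Fin n) ℂ (eigenspace A.adjoint c)) :
    LinearIndependent ℂ (rankMatrix B v b).col ↔
      ∀ e ∈ eigenspace A.adjoint c, (∀ k, inner ℂ (controlAdjoint B e) (v k) = 0) → e = 0 := by
  rw [Fintype.linearIndependent_iff]
  constructor
  · intro h e he hk
    have h1 := h (fun i => starRingEnd ℂ (b.repr ⟨e, he⟩ i)) ?_
    · have h2 : b.repr ⟨e, he⟩ = 0 := by
        ext i
        simpa using h1 i
      exact congrArg Subtype.val (b.repr.map_eq_zero_iff.1 h2)
    · funext k
      rw [sum_smul_col_rankMatrix]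
      simp only [Complex.conj_conj, b.sum_repr]
      exact hk k
  · intro h g hg i
    have h1 := h _ (∑ i, starRingEnd ℂ (g i) • b i : eigenspace A.adjoint c).2 fun k => by
      rw [← sum_smul_col_rankMatrix, hg]
      rfl
    have h2 : ∑ i, starRingEnd ℂ (g i) • b i = 0 := Submodule.coe_eq_zero.1 h1
    have h3 := b.repr_sum_self fun i => starRingEnd ℂ (g i)
    rw [h2, map_zero] at h3
    exact (map_eq_zero _).1 (congrFun h3 i).symm

theorem rank_eq_iff_linearIndependent_col {K n : ℕ} (M : Matrix (Fin K) (Fin n) ℂ) :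
    M.rank = n ↔ LinearIndependent ℂ M.col := by
  rw [linearIndependent_iff_card_eq_finrank_span, Fintype.card_fin, Matrix.rank_eq_finrank_span_cols,
    eq_comm]
  rfl

/-- The columns of the rank matrix as a linear function of the family of controls. -/
def colMap (B : U →L[ℂ] DStarDual A) (K : ℕ) {n : ℕ} {c : ℂ}
    (b : Fin n → eigenspace A.adjoint c) : (Fin K → U) →ₗ[ℂ] Fin n → Fin K → ℂ where
  toFun v := (rankMatrix B v b).col
  map_add' v w := by
    ext i k
    simp [rankMatrix]
  map_smul' a v := by
    ext i k
    simp [rankMatrix]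

theorem continuous_colMap (K : ℕ) {n : ℕ} {c : ℂ} (b : Fin n → eigenspace A.adjoint c) :
    Continuous (colMap B K b) := by
  refine continuous_pi fun i => continuous_pi fun k => ?_
  exact continuous_const.inner (continuous_apply k)

theorem isOpen_setOf_linearIndependent_col (K : ℕ) {n : ℕ} {c : ℂ}
    (b : Fin n → eigenspace A.adjoint c) :
    IsOpen {v : Fin K → U | LinearIndependent ℂ (rankMatrix B v b).col} :=
  (isOpen_setOfPred_linearIndependent (𝕜 := ℂ) (E := Fin K → ℂ)).preimage (continuous_colMap K b)

theorem dense_setOf_linearIndependent_col {K n : ℕ} (hn : n ≤ K) {c : ℂ}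
    (b : Module.Basis (Fin n) ℂ (eigenspace A.adjoint c))
    (huc : ∀ e ∈ eigenspace A.adjoint c, controlAdjoint B e = 0 → e = 0) :
    Dense {v : Fin K → U | LinearIndependent ℂ (rankMatrix B v b).col} := by
  -- The vectors `B* b_k`, padded by zeros, form one good family: a vector `B* e` orthogonal to all
  -- of them is orthogonal to itself, as `e` is a combination of the `b_k`.
  refine dense_setOf_linearIndependent_of_exists (colMap B K b) ⟨fun k =>
    if h : (k : ℕ) < n then controlAdjoint B (b ⟨k, h⟩ : DStar A) else 0, ?_⟩
  refine (linearIndependent_col_rankMatrix_iff _ b).2 fun e he hk => huc e he ?_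
  have h1 : ∀ i, inner ℂ (controlAdjoint B e) (controlAdjoint B (b i : DStar A)) = 0 := by
    intro i
    have h2 := hk ⟨i, i.2.trans_le hn⟩
    rwa [dif_pos i.2] at h2
  have h3 : e = ((∑ i, b.repr ⟨e, he⟩ i • b i : eigenspace A.adjoint c) : DStar A) := by
    rw [b.sum_repr]
  refine inner_self_eq_zero (𝕜 := ℂ).1 ?_
  nth_rewrite 2 [h3]
  rw [Submodule.coe_sum, map_sum, inner_sum]
  exact Finset.sum_eq_zero fun i _ => by
    rw [Submodule.coe_smul, map_smul, inner_smul_right, h1, mul_zero]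

/-! ### Genericity, dimension counts and projection of admissible families -/

namespace Standing

theorem isAdmissible_iff_linearIndependent_col (h : Standing A S S' μ) (h5 : HypH5 A S μ B) {K : ℕ}
    (v : Fin K → U) :
    IsAdmissible A σ B v ↔ ∀ l ∈ unstableSpec A σ,
      ∀ b : Module.Basis (Fin (geomMult A l)) ℂ (eigenspace A.adjoint (starRingEnd ℂ l)),
        LinearIndependent ℂ (rankMatrix B v b).col := by
  rw [h.isAdmissible_iff h5]
  refine forall₂_congr fun l hl => ⟨fun h1 b => (linearIndependent_col_rankMatrix_iff v b).2 h1,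
    fun h1 => ?_⟩
  obtain ⟨b⟩ := h.exists_basis hl
  exact (linearIndependent_col_rankMatrix_iff v b).1 (h1 b)

/-- The rank condition at each eigenvalue does not depend on the basis and is open and dense; only
finitely many eigenvalues are intersected, so the set itself is open. -/
theorem isOpen_and_dense_isAdmissible (h : Standing A S S' μ) (h5 : HypH5 A S μ B) {K : ℕ}
    (huc : UCσ A σ B) (hM : ∀ l ∈ unstableSpec A σ, geomMult A l ≤ K) :
    IsOpen {v : Fin K → U | IsAdmissible A σ B v} ∧
      Dense {v : Fin K → U | IsAdmissible A σ B v} := by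
  have hfin := h.finite_unstableSpec σ
  set O : ℂ → Set (Fin K → U) := fun l =>
    {v | ∀ b : Module.Basis (Fin (geomMult A l)) ℂ (eigenspace A.adjoint (starRingEnd ℂ l)),
        LinearIndependent ℂ (rankMatrix B v b).col} with hO
  have hOeq : ∀ l (b : Module.Basis (Fin (geomMult A l)) ℂ
      (eigenspace A.adjoint (starRingEnd ℂ l))),
      O l = {v | LinearIndependent ℂ (rankMatrix B v b).col} := by
    intro l b
    ext v
    refine ⟨fun hv => hv b, fun hv b' => ?_⟩
    rw [linearIndependent_col_rankMatrix_iff]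
    exact (linearIndependent_col_rankMatrix_iff v b).1 hv
  have heq : {v : Fin K → U | IsAdmissible A σ B v} = ⋂ l ∈ unstableSpec A σ, O l := by
    ext v
    simp only [mem_ofPred_eq, h.isAdmissible_iff_linearIndependent_col h5, mem_iInter, hO]
  have hopen : ∀ l ∈ unstableSpec A σ, IsOpen (O l) := by
    intro l hl
    obtain ⟨b⟩ := h.exists_basis hl
    rw [hOeq l b]
    exact isOpen_setOf_linearIndependent_col K b
  rw [heq]
  refine ⟨hfin.isOpen_biInter hopen, dense_biInter_of_isOpen hopen hfin.countable fun l hl => ?_⟩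
  obtain ⟨b⟩ := h.exists_basis hl
  rw [hOeq l b]
  exact dense_setOf_linearIndependent_col (hM l hl) b ((ucσ_iff h.dense_domain).1 huc l hl)

theorem isOpen_and_dense_linearIndependent_isAdmissible (h : Standing A S S' μ)
    (h5 : HypH5 A S μ B) {K : ℕ} (huc : UCσ A σ B)
    (hM : ∀ l ∈ unstableSpec A σ, geomMult A l ≤ K) (hK : (K : Cardinal) ≤ Module.rank ℂ U) :
    IsOpen {v : Fin K → U | LinearIndependent ℂ v ∧ IsAdmissible A σ B v} ∧
      Dense {v : Fin K → U | LinearIndependent ℂ v ∧ IsAdmissible A σ B v} := by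
  obtain ⟨ho, hd⟩ := h.isOpen_and_dense_isAdmissible h5 huc hM
  have ho' : IsOpen {v : Fin K → U | LinearIndependent ℂ v} := isOpen_setOfPred_linearIndependent
  have hd' : Dense {v : Fin K → U | LinearIndependent ℂ v} :=
    dense_setOf_linearIndependent_of_exists (E := Fin K → U) (Y := U) LinearMap.id
      (Module.le_rank_iff.1 hK)
  exact ⟨ho'.inter ho, hd'.inter_of_isOpen_left hd ho'⟩

/-- Stabilizability through `V` makes the adjoint of the restricted control operator injective from
each unstable eigenspace of `A*` into `V`, and that eigenspace has the dimension of the one of `A`.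
-/
theorem ucσ_and_geomMult_le (h : Standing A S S' μ) (h5 : HypH5 A S μ B) {K : ℕ}
    (hs : IsStabilizableByDimLE A σ B K) :
    UCσ A σ B ∧ ∀ l ∈ unstableSpec A σ, geomMult A l ≤ K := by
  obtain ⟨V, hV, hVK, hstab⟩ := hs
  have : CompleteSpace V := FiniteDimensional.complete ℂ V
  have h1 := (h.isStabilizable_restrictControl_iff h5 V).1 hstab
  refine ⟨(ucσ_iff h.dense_domain).2 fun l hl e he hB => h1 l hl e he fun v _ => by
    rw [hB, inner_zero_left], fun l hl => ?_⟩
  rw [← h.finrank_eigenspace hl]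
  refine (LinearMap.finrank_le_finrank_of_injective
    (f := (controlAdjoint (FattoriniStab.restrictControl B V) : DStar A →ₗ[ℂ] V).domRestrict
      (eigenspace A.adjoint (starRingEnd ℂ l))) ?_).trans hVK
  refine (injective_iff_map_eq_zero _).2 fun e he => Subtype.ext (h1 l hl e e.2 ?_)
  exact (controlAdjoint_restrictControl_eq_zero_iff V (e : DStar A)).1 he

theorem isStabilizableByDimLE_iff (h : Standing A S S' μ) (h5 : HypH5 A S μ B) {K : ℕ} :
    IsStabilizableByDimLE A σ B K ↔
      UCσ A σ B ∧ ∀ l ∈ unstableSpec A σ, geomMult A l ≤ K := by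
  refine ⟨h.ucσ_and_geomMult_le h5, fun ⟨huc, hM⟩ => ?_⟩
  obtain ⟨v, hv⟩ := (h.isOpen_and_dense_isAdmissible h5 huc hM).2.nonempty
  exact ⟨Submodule.span ℂ (range v), FiniteDimensional.span_of_finite ℂ (finite_range v),
    (finrank_range_le_card v).trans_eq (Fintype.card_fin K), hv⟩

theorem isStabilizableByDim_iff (h : Standing A S S' μ) (h5 : HypH5 A S μ B) {K : ℕ}
    (hK : (K : Cardinal) ≤ Module.rank ℂ U) :
    IsStabilizableByDim A σ B K ↔
      UCσ A σ B ∧ ∀ l ∈ unstableSpec A σ, geomMult A l ≤ K := by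
  refine ⟨fun ⟨V, hV, hVK, hs⟩ => h.ucσ_and_geomMult_le h5 ⟨V, hV, hVK.le, hs⟩,
    fun ⟨huc, hM⟩ => ?_⟩
  obtain ⟨v, hli, hv⟩ :=
    (h.isOpen_and_dense_linearIndependent_isAdmissible h5 huc hM hK).2.nonempty
  exact ⟨Submodule.span ℂ (range v), FiniteDimensional.span_of_finite ℂ (finite_range v),
    (finrank_span_eq_card hli).trans (Fintype.card_fin K), hv⟩

theorem finiteDimensional_bstarEσ (h : Standing A S S' μ) :
    FiniteDimensional ℂ (BstarEσ A σ B) := by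
  have h1 : FiniteDimensional ℂ (Eσ A σ) := by
    rw [Eσ, iSup_subtype']
    have : Finite (unstableSpec A σ) := (h.finite_unstableSpec σ).to_subtype
    have : ∀ l : unstableSpec A σ,
        FiniteDimensional ℂ (eigenspace A.adjoint (starRingEnd ℂ (l : ℂ))) :=
      fun l => h.finiteDimensional_eigenspace l.2
    exact Submodule.finiteDimensional_iSup _
  rw [BstarEσ]
  infer_instance

/-- Admissibility only involves inner products with vectors `B* e` of the finite-dimensional space
`B* 𝓔_σ`, and orthogonal projection onto that space leaves them unchanged. -/
theorem exists_projection_isAdmissible (h : Standing A S S' μ) (h5 : HypH5 A S μ B) {K : ℕ}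
    {v : Fin K → U} (hv : IsAdmissible A σ B v) :
    ∃ w : Fin K → U, (∀ k, w k ∈ BstarEσ A σ B ∧ v k - w k ∈ (BstarEσ A σ B)ᗮ) ∧
      IsAdmissible A σ B w := by
  have := h.finiteDimensional_bstarEσ (σ := σ) (B := B)
  refine ⟨fun k => (BstarEσ A σ B).starProjection (v k), fun k =>
    ⟨Submodule.starProjection_apply_mem _ _, Submodule.sub_starProjection_mem_orthogonal _⟩, ?_⟩
  rw [h.isAdmissible_iff h5] at hv ⊢
  intro l hl e he hk
  refine hv l hl e he fun k => ?_
  have h1 : controlAdjoint B e ∈ BstarEσ A σ B :=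
    Submodule.mem_map_of_mem (Submodule.mem_iSup_of_mem l (Submodule.mem_iSup_of_mem hl he))
  have h2 := Submodule.inner_right_of_mem_orthogonal h1
    (Submodule.sub_starProjection_mem_orthogonal (K := BstarEσ A σ B) (v k))
  rw [inner_sub_right, hk k, sub_zero] at h2
  exact h2

end Standing

theorem isResidualSet_of_isOpen_of_dense {X : Type*} [TopologicalSpace X] {s : Set X}
    (h : IsOpen s ∧ Dense s) : IsResidualSet s :=
  ⟨fun _ => s, fun _ => h, (iInter_const s).symm⟩

end Admissibility

end FattoriniStab

end

/-! ### The theorem -/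

theorem mainTheorem2
    {H : Type*} [NormedAddCommGroup H] [InnerProductSpace ℂ H] [CompleteSpace H]
    {U : Type*} [NormedAddCommGroup U] [InnerProductSpace ℂ U] [CompleteSpace U]
    (A : H →ₗ.[ℂ] H) (S : ℝ → H →L[ℂ] H)
    (hS : FattoriniStab.IsC0Semigroup S) (hA : FattoriniStab.IsGenerator A S)
    (B : U →L[ℂ] FattoriniStab.DStarDual A)
    (μ₀ : ℝ) (hμ₀ : ∀ l ∈ FattoriniStab.spec A, l.re < μ₀)
    (h1 : FattoriniStab.HypH1 A) (h3 : FattoriniStab.IsAnalyticSemigroup S)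
    (h5 : FattoriniStab.HypH5 A S μ₀ B) (h6 : FattoriniStab.HypH6 A)
    (K : ℕ) (hK : 1 ≤ K) (σ : ℝ) (hσ : 0 < σ) :
    -- the bases used in the rank conditions exist
    (∀ l ∈ FattoriniStab.unstableSpec A σ,
      Nonempty (Module.Basis (Fin (FattoriniStab.geomMult A l)) ℂ
        (FattoriniStab.eigenspace A.adjoint (starRingEnd ℂ l)))) ∧
    -- 1
    (FattoriniStab.IsStabilizable A σ B ↔ FattoriniStab.UCσ A σ B) ∧
    -- 2
    (FattoriniStab.IsStabilizableByDimLE A σ B K ↔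
      FattoriniStab.UCσ A σ B ∧
        ∀ l ∈ FattoriniStab.unstableSpec A σ, FattoriniStab.geomMult A l ≤ K) ∧
    ((K : Cardinal) ≤ Module.rank ℂ U →
      (FattoriniStab.IsStabilizableByDim A σ B K ↔
        FattoriniStab.UCσ A σ B ∧
          ∀ l ∈ FattoriniStab.unstableSpec A σ, FattoriniStab.geomMult A l ≤ K)) ∧
    -- 3
    (∀ v : Fin K → U, FattoriniStab.IsAdmissible A σ B v ↔
      ∀ l ∈ FattoriniStab.unstableSpec A σ,
        ∀ b : Module.Basis (Fin (FattoriniStab.geomMult A l)) ℂ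
          (FattoriniStab.eigenspace A.adjoint (starRingEnd ℂ l)),
          (FattoriniStab.rankMatrix B v b).rank = FattoriniStab.geomMult A l) ∧
    -- 4
    (FattoriniStab.UCσ A σ B →
      (∀ l ∈ FattoriniStab.unstableSpec A σ, FattoriniStab.geomMult A l ≤ K) →
      FattoriniStab.IsResidualSet {v : Fin K → U | FattoriniStab.IsAdmissible A σ B v} ∧
      ((K : Cardinal) ≤ Module.rank ℂ U →
        FattoriniStab.IsResidualSet
          {v : Fin K → U | LinearIndependent ℂ v ∧ FattoriniStab.IsAdmissible A σ B v}) ∧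
      ∀ v : Fin K → U, FattoriniStab.IsAdmissible A σ B v →
        ∃ w : Fin K → U,
          (∀ k, w k ∈ FattoriniStab.BstarEσ A σ B ∧
            v k - w k ∈ (FattoriniStab.BstarEσ A σ B)ᗮ) ∧
          FattoriniStab.IsAdmissible A σ B w) := by
  obtain ⟨S', hd⟩ := h3.exists_isDifferentiableSemigroup hS
  have h : FattoriniStab.Standing A S S' μ₀ := ⟨hS, hA, hd, hμ₀, h1, h6⟩
  refine ⟨fun l hl => h.exists_basis hl, h.isStabilizable_iff h5, h.isStabilizableByDimLE_iff h5,
    h.isStabilizableByDim_iff h5, fun v => ?_, fun huc hM =>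
      ⟨FattoriniStab.isResidualSet_of_isOpen_of_dense (h.isOpen_and_dense_isAdmissible h5 huc hM),
        fun hK' => FattoriniStab.isResidualSet_of_isOpen_of_dense
          (h.isOpen_and_dense_linearIndependent_isAdmissible h5 huc hM hK'),
        fun v hv => h.exists_projection_isAdmissible h5 hv⟩⟩
  simp only [FattoriniStab.rank_eq_iff_linearIndependent_col]
  exact h.isAdmissible_iff_linearIndependent_col h5 v
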